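/- **Model.** A network is a connected undirected graph $G$ with $n$ nodes, $m$ edges and diameter $D$. Nodes are anonymous; each knows $n$, its own degree and local (arbitrary) numbers of its incident edges, and has private fair coins; local computation is free. Initially all nodes sleep. A node wakes up when the environment wakes it or when a message reaches it; on waking it draws, once and for all, an identity of $O(\log n)$ bits. Messages have $O(\log n)$ bits; in each direction of an edge they are delivered without error in FIFO order, one at a time, each taking at most one time unit from the moment the edge is free for it. An adaptive adversary, which sees all past coin flips and configurations, decides which nodes it wakes (at least one) and when, and when messages are delivered. Time is counted from the first wake-up. Leader election is solved when all nodes have irrevocably terminated, exactly one node $v$ is elected, and every node outputs the identity of $v$, which is the identity of no other node. **Theorem.** For every constant $c>0$ there exist a randomized algorithm and constants $K,\kappa,n_0$ (depending only on $c$), with messages and identities taken from sets of size at most $n^{\kappa}$, such that for all $n\ge n_0$, every connected graph $G$ with $n$ nodes, $m$ edges and diameter $D$, every edge numbering, and every adaptive adversary as above, with probability at least $1-1/n^{c}$ the algorithm solves leader election within time $K\,D\log^2 n$ and sends at most $K\,m\log^2 n$ messages in the whole execution. -/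

import Mathlib

open MeasureTheory

/-- A randomized message-passing protocol, as run by every node of an anonymous network.
A node sees only its own state, its own degree, its own coins, and the messages that arrive,
each together with the local number of the edge over which it arrives.
`wake d b` is executed once, when a node of degree `d` wakes up, with fresh fair coins `b`; it fixes
the identity of the node once and for all, its first state, and the messages to send.
`receive d s i M b` is executed when a node of degree `d` in state `s` receives the message `M` over
its `i`-th edge, with fresh fair coins `b`.
Messages to send are given as a finite list for each of the edges `0, ..., d - 1` of the node.
`output s = some (e, x)` means that the node has irrevocably terminated, that it considers itself
elected iff `e = true`, and that it takes `x` to be the identity of the leader. -/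
structure Protocol where
  Msg : Type
  Ident : Type
  State : Type
  [fintypeMsg : Fintype Msg]
  [fintypeIdent : Fintype Ident]
  coins : ℕ
  wake : ℕ → (Fin coins → Bool) → Ident × State × (ℕ → List Msg)
  receive : ℕ → State → ℕ → Msg → (Fin coins → Bool) → State × (ℕ → List Msg)
  output : State → Option (Bool × Ident)

attribute [instance] Protocol.fintypeMsg Protocol.fintypeIdent

/-- `port v w` is the local number, at `v`, of the edge from `v` to its neighbor `w`. -/
def IsPortNumbering {V : Type} [Fintype V] (G : SimpleGraph V) [DecidableRel G.Adj]
    (port : V → V → ℕ) : Prop :=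
  ∀ v, Set.BijOn (port v) (G.neighborSet v) (Set.Iio (G.degree v))

namespace Protocol

/-- The data of an awake node. `flips` lists the coins that the node has used so far, one block for
each of its activations. -/
structure Node (P : Protocol) where
  ident : P.Ident
  state : P.State
  flips : List (Fin P.coins → Bool)

/-- A configuration of the network: the current time, the nodes (`none` is a sleeping node), for
each ordered pair `(u, w)` of neighbors the queue of the messages from `u` to `w` that have been
sent and not yet delivered, the time at which the transmission of the first message in that queue
began, and the number of messages sent so far in the whole network. -/
structure Config (P : Protocol) (V : Type) where
  now : ℝ
  node : V → Option P.Node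
  queue : V → V → List P.Msg
  since : V → V → ℝ
  sent : ℕ

/-- All nodes are asleep and no message has been sent. -/
def start (P : Protocol) (V : Type) : P.Config V where
  now := 0
  node := fun _ => none
  queue := fun _ _ => []
  since := fun _ _ => 0
  sent := 0

/-- The coins of the network: coin number `i` in the `k`-th activation of the node `v`. -/
abbrev Coins (P : Protocol) (V : Type) : Type := V × ℕ × Fin P.coins → Bool

/-- All coins are fair and independent. -/
noncomputable def coinMeasure (P : Protocol) (V : Type) : Measure (P.Coins V) :=
  Measure.infinitePi fun _ => (PMF.uniformOfFintype Bool).toMeasure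

/-- What the environment can do: wake up a sleeping node, or deliver the first message that is
waiting on the edge from `u` to `w`. -/
inductive Action (V : Type) where
  | wake (v : V)
  | deliver (u w : V)

section Execution

variable {P : Protocol} {V : Type} [Fintype V] [DecidableEq V]
  (G : SimpleGraph V) [DecidableRel G.Adj] (port : V → V → ℕ)

/-- The node `v` sends the messages `out`. If an edge was free, a transmission starts on it now. -/
def emit (c : P.Config V) (v : V) (out : ℕ → List P.Msg) : P.Config V where
  now := c.now
  node := c.node
  queue := fun u w =>
    if u = v ∧ G.Adj u w then c.queue u w ++ out (port u w) else c.queue u w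
  since := fun u w => if c.queue u w = [] then c.now else c.since u w
  sent := c.sent + ∑ w ∈ G.neighborFinset v, (out (port v w)).length

/-- The node `v` wakes up if it is asleep. -/
def wakeUp (ω : P.Coins V) (c : P.Config V) (v : V) : P.Config V :=
  match c.node v with
  | some _ => c
  | none =>
    let b : Fin P.coins → Bool := fun i => ω (v, 0, i)
    let r := P.wake (G.degree v) b
    emit G port { c with node := Function.update c.node v (some ⟨r.1, r.2.1, [b]⟩) } v r.2.2

/-- The awake node `w` receives the message `M` from its neighbor `u`; a node that has terminated
ignores it. -/
def accept (ω : P.Coins V) (c : P.Config V) (u w : V) (M : P.Msg) : P.Config V :=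
  match c.node w with
  | none => c
  | some x =>
    if (P.output x.state).isSome then c
    else
      let b : Fin P.coins → Bool := fun i => ω (w, x.flips.length, i)
      let r := P.receive (G.degree w) x.state (port w u) M b
      emit G port
        { c with node := Function.update c.node w (some ⟨x.ident, r.1, x.flips ++ [b]⟩) } w r.2

/-- The first message waiting on the edge from `u` to `w` arrives (and wakes `w` up if `w` is
asleep); then the transmission of the next message in the queue, if any, begins. -/
def arrive (ω : P.Coins V) (c : P.Config V) (u w : V) : P.Config V :=
  match c.queue u w with
  | [] => c
  | M :: rest =>
    accept G port ω
      (wakeUp G port ω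
        { c with
          queue := fun a b => if a = u ∧ b = w then rest else c.queue a b
          since := fun a b => if a = u ∧ b = w then c.now else c.since a b } w) u w M

/-- One step of the execution; `some (t, a)` means that the action `a` happens at time `t`, and
`none` that nothing happens. -/
def step (ω : P.Coins V) (c : P.Config V) : Option (ℝ × Action V) → P.Config V
  | none => c
  | some (t, .wake v) => wakeUp G port ω { c with now := t } v
  | some (t, .deliver u w) => arrive G port ω { c with now := t } u w

/-- What the environment is allowed to do in the configuration `c`. The clock starts when the first
node is woken up, and some node has to be woken up. Time does not run backwards, and it does not
run past the moment at which some message has been crossing an edge for one time unit. The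
environment may be inactive only if no message is waiting for delivery. -/
def Allowed (c : P.Config V) : Option (ℝ × Action V) → Prop
  | none => (∃ v, c.node v ≠ none) ∧ ∀ u w, c.queue u w = []
  | some (t, a) =>
    c.now ≤ t ∧ ((∀ v, c.node v = none) → t = 0) ∧
    (∀ u w, c.queue u w ≠ [] → t ≤ c.since u w + 1) ∧
    match a with
    | .wake v => c.node v = none
    | .deliver u w => c.queue u w ≠ []

/-- An adaptive adversary chooses its next action on the basis of all earlier configurations (latest
first) and of the current configuration, hence of all coins that have been flipped so far. -/
abbrev Adversary (P : Protocol) (V : Type) : Type :=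
  List (P.Config V) → P.Config V → Option (ℝ × Action V)

/-- The first `k` configurations of the execution (latest first), and the one after `k` steps. -/
def trace (adv : Adversary P V) (ω : P.Coins V) : ℕ → List (P.Config V) × P.Config V
  | 0 => ([], P.start V)
  | k + 1 =>
    let h := trace adv ω k
    (h.2 :: h.1, step G port ω h.2 (adv h.1 h.2))

/-- The configuration after `k` steps. -/
def config (adv : Adversary P V) (ω : P.Coins V) (k : ℕ) : P.Config V :=
  (trace G port adv ω k).2

/-- The adversary respects the rules, whatever the coins are. -/
def Adversary.IsLegal (adv : Adversary P V) : Prop :=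
  ∀ (ω : P.Coins V) (k : ℕ),
    Allowed (config G port adv ω k) (adv (trace G port adv ω k).1 (trace G port adv ω k).2)

/-- All nodes have terminated, exactly one of them, `v`, is elected, and all nodes know the identity
of `v`, which is the identity of no other node. -/
def LeaderElected (c : P.Config V) : Prop :=
  ∃ (v : V) (x : P.Node), c.node v = some x ∧ P.output x.state = some (true, x.ident) ∧
    ∀ u, u ≠ v → ∃ y : P.Node, c.node u = some y ∧ y.ident ≠ x.ident ∧
      P.output y.state = some (false, x.ident)

/-- All nodes terminate, at time at most `T`, with a leader elected. -/
def SolvesWithin (adv : Adversary P V) (ω : P.Coins V) (T : ℝ) : Prop :=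
  ∃ k, LeaderElected (config G port adv ω k) ∧ (config G port adv ω k).now ≤ T

/-- At most `B` messages are sent in the whole execution. -/
def SendsAtMost (adv : Adversary P V) (ω : P.Coins V) (B : ℝ) : Prop :=
  ∀ k, ((config G port adv ω k).sent : ℝ) ≤ B

end Execution

end Protocol

/-! The algorithm is gossip: every node keeps a log of rumors without repetitions and sends each new
one once over each of its edges. A node whose label begins with `t` heads is a candidate, where `t`
makes the mean number `rate` of such nodes of order log n. On first hearing of a candidate, any
other node becomes a witness for it with the same probability 2^(-t), by fresh coins. A candidate
that knows `τ = ⌈3/4 * rate⌉` witnesses announces this fact together with the number of candidates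
it knows. A node that knows some candidate, and an announcement of every candidate it knows, elects
one with the smallest announced number and terminates; the result is flooded.

Complexity. With at most `U = O(log n)` candidates and at most `U` witnesses for each, a log has at
most B = U² + 2U + 2 entries (`length_logs_le`). Hence at most 2mB messages are sent, and by FIFO a
rumor crosses an edge within time B (`spread_edge`). Five floodings (wake-up, candidates, witnesses,
announcements, result) take time 5BD (`solvesWithin`).

Agreement. FIFO forwarding preserves causality: whatever the originator of a rumor knew before it
precedes the rumor in every log (`Sound.causal`). So if u announces without knowing v, the witnesses
it counted heard of u before v. For two candidates ignorant of each other the sets of such nodes are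
disjoint (`disjoint_draws`), one of them has at most n/2 elements, and there only `rate / 2`
witnesses are expected. Thus, with high probability, of any two announcing candidates at least one
knew the other (`NoSplit`). An election is based on a set K of announced candidates closed under
"known when announcing" (`Certified`). A candidate outside of K is unknown to all of K at their
announcements, so it knew all of K at its own and announced a number larger than |K|, while members
of K announce at most |K|. Hence the minimizers lie in every such set, and all elections agree
(`Sound.certified_unique`).

Probability. The adversary chooses the order of the samples, but each sample uses unseen coins. With
q = 2^(-t), the weight a^hits / (1 + q(a - 1))^tries has mean at most 1 at every step
(`Sampling.lintegral_weight_le`), which gives Chernoff bounds valid against adaptivity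
(`Sampling.measure_le_exp`). These bounds, a birthday bound for labels and a union bound over pairs
of nodes finish the proof (`measure_not_good_le`). -/

set_option linter.unusedSectionVars false

/-! ### The gossip protocol -/

/-- The labels of the nodes: the coins flipped on waking up. -/
abbrev Label (T : ℕ) : Type := Fin T → Bool

/-- The messages of the protocol: "`x` is a candidate", "`w` is a witness for `x`",
"`x` has enough witnesses, and knew `s` candidates when that happened", "`x` is elected". -/
inductive Rumor (T : ℕ) : Type
  | hello
  | cand (x : Label T)
  | wit (x w : Label T)
  | done (x : Label T) (s : Fin (2 ^ T + 1))
  | elect (x : Label T)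
  deriving DecidableEq

namespace Rumor

variable {T : ℕ}

/-- The node that a fact originates from, if it can be read off from the fact. -/
def owner : Rumor T → Option (Label T)
  | hello => none
  | cand x => some x
  | wit _ w => some w
  | done x _ => some x
  | elect _ => none

/-- A code for facts in a type of evident cardinality. -/
def code : Rumor T → Fin 5 × Label T × Label T × Fin (2 ^ T + 1)
  | hello => (0, fun _ => true, fun _ => true, 0)
  | cand x => (1, x, fun _ => true, 0)
  | wit x w => (2, x, w, 0)
  | done x s => (3, x, fun _ => true, s)
  | elect x => (4, x, fun _ => true, 0)

theorem code_injective : Function.Injective (code (T := T)) := by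
  intro a b h
  cases a <;> cases b <;> simp [code] at h ⊢ <;> simp_all

noncomputable instance : Fintype (Rumor T) := Fintype.ofInjective code code_injective

theorem card_le : Fintype.card (Rumor T) ≤ 5 * (2 ^ T * (2 ^ T * (2 ^ T + 1))) := by
  refine (Fintype.card_le_of_injective code code_injective).trans ?_
  simp

end Rumor

/-- A block of coins is lucky if its first `t` coins are all heads. -/
def Lucky {T : ℕ} (t : ℕ) (b : Label T) : Prop := ∀ i : Fin T, i.val < t → b i = true

section Rules

variable {T : ℕ}

open Classical in
/-- The candidates known from the log `l`. -/
noncomputable def cands (l : List (Rumor T)) : Finset (Label T) :=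
  Finset.univ.filter fun x => Rumor.cand x ∈ l

open Classical in
/-- The witnesses for `x` known from the log `l`. -/
noncomputable def wits (x : Label T) (l : List (Rumor T)) : Finset (Label T) :=
  Finset.univ.filter fun w => Rumor.wit x w ∈ l

theorem mem_cands {x : Label T} {l : List (Rumor T)} : x ∈ cands l ↔ Rumor.cand x ∈ l := by
  simp [cands]

theorem mem_wits {x w : Label T} {l : List (Rumor T)} : w ∈ wits x l ↔ Rumor.wit x w ∈ l := by
  simp [wits]

theorem card_cands_lt (l : List (Rumor T)) : (cands l).card < 2 ^ T + 1 :=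
  Nat.lt_succ_of_le ((Finset.card_le_univ _).trans (by simp))

/-- The number of candidates known from `l`. -/
noncomputable def count (l : List (Rumor T)) : Fin (2 ^ T + 1) := ⟨(cands l).card, card_cands_lt l⟩

open Classical in
/-- The count announced by `x`, according to `l`. -/
noncomputable def rank (l : List (Rumor T)) (x : Label T) : ℕ :=
  if h : ∃ s, Rumor.done x s ∈ l then h.choose.val else 0

/-- A node of `K` at which `σ` is minimal. -/
noncomputable def leaderOf (K : Finset (Label T)) (σ : Label T → ℕ) : Label T :=
  Classical.epsilon fun x => x ∈ K ∧ ∀ y ∈ K, σ x ≤ σ y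

/-- The leader elected on the basis of the log `l`. -/
noncomputable def leader (l : List (Rumor T)) : Label T := leaderOf (cands l) (rank l)

/-- No leader is known. -/
def Open (l : List (Rumor T)) : Prop := ∀ x, Rumor.elect x ∉ l

/-- The candidate `me` announces that it has collected `τ` witnesses. -/
def DoneRule (τ : ℕ) (me : Label T) (l : List (Rumor T)) : Prop :=
  Rumor.cand me ∈ l ∧ (∀ s, Rumor.done me s ∉ l) ∧ τ ≤ (wits me l).card

/-- A leader is chosen when all known candidates have announced their counts. -/
def ElectRule (l : List (Rumor T)) : Prop :=
  Open l ∧ (∃ x, Rumor.cand x ∈ l) ∧ ∀ x, Rumor.cand x ∈ l → ∃ s, Rumor.done x s ∈ l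

open Classical in
noncomputable def initLog (t : ℕ) (b : Label T) : List (Rumor T) :=
  (if Lucky t b then [Rumor.cand b] else []) ++ [Rumor.hello]

open Classical in
noncomputable def witNews (t : ℕ) (me b : Label T) : Rumor T → List (Rumor T)
  | .cand x => if Lucky t b then [Rumor.wit x me] else []
  | _ => []

open Classical in
noncomputable def doneNews (τ : ℕ) (me : Label T) (l : List (Rumor T)) : List (Rumor T) :=
  if DoneRule τ me l then [Rumor.done me (count l)] else []

open Classical in
noncomputable def electNews (l : List (Rumor T)) : List (Rumor T) :=
  if ElectRule l then [Rumor.elect (leader l)] else []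

/-- What a node adds to its log `l` when the new fact `f` arrives. -/
noncomputable def learnNews (t τ : ℕ) (me : Label T) (l : List (Rumor T)) (f : Rumor T)
    (b : Label T) : List (Rumor T) :=
  let e₁ := f :: witNews t me b f
  let e₂ := doneNews τ me (l ++ e₁)
  e₁ ++ e₂ ++ electNews (l ++ e₁ ++ e₂)

open Classical in
/-- What a node adds to its log `l` when the message `f` arrives. -/
noncomputable def news (t τ : ℕ) (me : Label T) (l : List (Rumor T)) (f : Rumor T)
    (b : Label T) : List (Rumor T) :=
  if f ∈ l then [] else learnNews t τ me l f b

end Rules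

/-- The state of a node: its label and the facts it knows, in the order in which it learnt them. -/
structure GossipState (T : ℕ) where
  me : Label T
  log : List (Rumor T)

open Classical in
/-- Every node forwards every fact once over each of its edges. -/
noncomputable abbrev gossip (T t τ : ℕ) : Protocol where
  Msg := Rumor T
  Ident := Label T
  State := GossipState T
  coins := T
  wake _ b := (b, ⟨b, initLog t b⟩, fun _ => initLog t b)
  receive _ s _ f b :=
    (⟨s.me, s.log ++ news t τ s.me s.log f b⟩, fun _ => news t τ s.me s.log f b)
  output s := if h : ∃ x, Rumor.elect x ∈ s.log then some (decide (h.choose = s.me), h.choose)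
    else none

/-! ### The order of the facts in a log -/

/-- `g` occurs in `l` before the first occurrence of `f`. -/
def Precedes {α : Type*} [DecidableEq α] (l : List α) (g f : α) : Prop :=
  f ∈ l ∧ l.idxOf g < l.idxOf f

namespace Precedes

variable {α : Type*} [DecidableEq α] {l e : List α} {f g h : α}

theorem mem_left (H : Precedes l g f) : g ∈ l :=
  List.idxOf_lt_length_iff.1 (H.2.trans (List.idxOf_lt_length_iff.2 H.1))

theorem trans (H : Precedes l h g) (H' : Precedes l g f) : Precedes l h f :=
  ⟨H'.1, H.2.trans H'.2⟩

theorem irrefl : ¬ Precedes l f f := fun H => lt_irrefl _ H.2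

/-- What comes before `f` is settled as soon as `f` is present; this makes statements about the past
of a rumor stable as logs grow. -/
theorem append_of_mem (hf : f ∈ l) : Precedes (l ++ e) g f ↔ Precedes l g f := by
  unfold Precedes
  have := List.idxOf_lt_length_iff.2 hf
  by_cases hg : g ∈ l
  · simp [hf, List.idxOf_append_of_mem hf, List.idxOf_append_of_mem hg]
  · simp [hf, List.idxOf_append_of_mem hf, List.idxOf_append_of_notMem hg,
      List.idxOf_eq_length hg]
    omega

theorem append_cons_self (hf : f ∉ l) : Precedes (l ++ f :: e) g f ↔ g ∈ l := by
  unfold Precedes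
  by_cases hg : g ∈ l
  · have := List.idxOf_lt_length_iff.2 hg
    simp [hg, List.idxOf_append_of_notMem hf, List.idxOf_append_of_mem hg, this]
  · simp [hg, List.idxOf_append_of_notMem hf, List.idxOf_append_of_notMem hg]

theorem append_singleton (hf : f ∉ l) :
    Precedes (l ++ [f]) g h ↔ Precedes l g h ∨ (h = f ∧ g ∈ l) := by
  by_cases hh : h ∈ l
  · rw [append_of_mem hh]
    constructor
    · exact Or.inl
    · rintro (H | ⟨rfl, -⟩)
      · exact H
      · exact absurd hh hf
  · by_cases hhf : h = f
    · subst hhf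
      rw [append_cons_self hf]
      constructor
      · exact fun H => Or.inr ⟨rfl, H⟩
      · rintro (H | ⟨-, H⟩)
        · exact absurd H.1 hh
        · exact H
    · constructor
      · intro H
        have := H.1
        simp [hh, hhf] at this
      · rintro (H | ⟨rfl, -⟩)
        · exact absurd H.1 hh
        · exact absurd rfl hhf

/-- The displayed `f` need not be the first one, but the first one is not later, so `g` lies in `p`
in any case. -/
theorem mem_prefix {p q : List α} (H : Precedes (p ++ f :: q) g f) : g ∈ p := by
  by_contra hg
  have h1 : (p ++ f :: q).idxOf f ≤ p.length := by
    by_cases hf : f ∈ p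
    · rw [List.idxOf_append_of_mem hf]; exact (List.idxOf_lt_length_iff.2 hf).le
    · simp [List.idxOf_append_of_notMem hf]
  have h2 : p.length ≤ (p ++ f :: q).idxOf g := by
    rw [List.idxOf_append_of_notMem hg]; omega
  exact absurd H.2 (by omega)

end Precedes

/-! ### Invariants of the logs -/

section Logs

variable {V : Type} {T : ℕ} (lab : V → Label T) (t τ : ℕ)

/-- `x` is the choice made on the basis of a set `K` of candidates that have announced their counts
and, when doing so, knew no candidate outside of `K`. -/
def Certified (L : V → List (Rumor T)) (x : Label T) : Prop :=
  ∃ (K : Finset (Label T)) (σ : Label T → ℕ), K.Nonempty ∧ x = leaderOf K σ ∧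
    ∀ y ∈ K, ∃ u s, lab u = y ∧ Rumor.done y s ∈ L u ∧ σ y = s.val ∧
      ∀ x, Precedes (L u) (Rumor.cand x) (Rumor.done y s) → x ∈ K

open Classical in
/-- What holds for the logs of all nodes at all times. -/
structure Sound (L : V → List (Rumor T)) : Prop where
  nodup : ∀ v, (L v).Nodup
  owned : ∀ v f x, f ∈ L v → f.owner = some x → ∃ u, lab u = x ∧ f ∈ L u
  causal : ∀ v u f g, f ∈ L v → f.owner = some (lab u) → Precedes (L u) g f → Precedes (L v) g f
  lucky_of_cand : ∀ v, Rumor.cand (lab v) ∈ L v → Lucky t (lab v)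
  cand_of_lucky : ∀ v, Rumor.hello ∈ L v → Lucky t (lab v) → Rumor.cand (lab v) ∈ L v
  wit_spec : ∀ z x, Rumor.wit x (lab z) ∈ L z → Rumor.cand x ∈ L z ∧ x ≠ lab z ∧
    ∀ g, Precedes (L z) g (Rumor.cand x) → Precedes (L z) g (Rumor.wit x (lab z))
  done_unique : ∀ u s s', Rumor.done (lab u) s ∈ L u → Rumor.done (lab u) s' ∈ L u → s = s'
  done_spec : ∀ u s, Rumor.done (lab u) s ∈ L u →
    (Finset.univ.filter fun x => Precedes (L u) (Rumor.cand x) (Rumor.done (lab u) s)).card = s ∧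
    Precedes (L u) (Rumor.cand (lab u)) (Rumor.done (lab u) s) ∧
    τ ≤ (Finset.univ.filter fun w =>
      Precedes (L u) (Rumor.wit (lab u) w) (Rumor.done (lab u) s)).card
  elect_unique : ∀ v x x', Rumor.elect x ∈ L v → Rumor.elect x' ∈ L v → x = x'
  elect_spec : ∀ v x, Rumor.elect x ∈ L v → Certified lab L x

/-- The ways in which the log of the node `w` can grow. -/
inductive Push (L : V → List (Rumor T)) (w : V) : Rumor T → Prop
  | relay {a f} : f ∈ L a → (∀ g, Precedes (L a) g f → g ∈ L w) → f ∉ L w → f ≠ .hello →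
      Open (L w) → Push L w f
  | cand : L w = [] → Lucky t (lab w) → Push L w (.cand (lab w))
  | hello : Rumor.hello ∉ L w → (Lucky t (lab w) → Rumor.cand (lab w) ∈ L w) → Push L w .hello
  | wit {x} : Rumor.cand x ∈ L w → x ≠ lab w → Rumor.wit x (lab w) ∉ L w →
      Push L w (.wit x (lab w))
  | done : DoneRule τ (lab w) (L w) → Push L w (.done (lab w) (count (L w)))
  | elect : ElectRule (L w) → Push L w (.elect (leader (L w)))

variable {lab t τ} {L : V → List (Rumor T)} {w : V} {f : Rumor T}

theorem Push.notMem (h : Push lab t τ L w f) : f ∉ L w := by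
  cases h with
  | relay _ _ h => exact h
  | cand h => simp [h]
  | hello h => exact h
  | wit _ _ h => exact h
  | done h => exact h.2.1 _
  | elect h => exact h.1 _

/-- A new rumor is either generated by its owner or relayed. -/
theorem Push.own_or_relay (h : Push lab t τ L w f) : (∀ x, f.owner = some x → x = lab w) ∨
    ∃ a, f ∈ L a ∧ (∀ g, Precedes (L a) g f → g ∈ L w) ∧ f ≠ .hello ∧ Open (L w) := by
  cases h with
  | relay h1 h2 _ h4 h5 => exact Or.inr ⟨_, h1, h2, h4, h5⟩
  | _ => left; intro x hx; simp [Rumor.owner] at hx; try exact hx.symm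

/-- The known counts of `x` agree. -/
theorem Sound.done_unique' (S : Sound lab t τ L) (hlab : Function.Injective lab) {v v' : V}
    {x : Label T} {s s' : Fin (2 ^ T + 1)} (h : Rumor.done x s ∈ L v)
    (h' : Rumor.done x s' ∈ L v') : s = s' := by
  obtain ⟨u, rfl, hu⟩ := S.owned _ _ _ h rfl
  obtain ⟨u', hu1, hu'⟩ := S.owned _ _ _ h' rfl
  rw [hlab hu1] at hu'
  exact S.done_unique _ _ _ hu hu'

/-- Neither the choice nor the default 0 in `rank` matters: a candidate announces only one number.
-/
theorem Sound.rank_eq (S : Sound lab t τ L) (hlab : Function.Injective lab) {v : V}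
    {x : Label T} {s : Fin (2 ^ T + 1)} (h : Rumor.done x s ∈ L v) : rank (L v) x = s.val := by
  have hex : ∃ s, Rumor.done x s ∈ L v := ⟨s, h⟩
  rw [rank, dif_pos hex, S.done_unique' hlab hex.choose_spec h]

variable [DecidableEq V]

/-- The logs after the node `w` has added `e` to its log. -/
def pushLog (L : V → List (Rumor T)) (w : V) (e : List (Rumor T)) : V → List (Rumor T) :=
  Function.update L w (L w ++ e)

theorem mem_pushLog {v : V} {e : List (Rumor T)} {g : Rumor T} :
    g ∈ pushLog L w e v ↔ g ∈ L v ∨ (v = w ∧ g ∈ e) := by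
  by_cases h : v = w
  · subst h; simp [pushLog]
  · simp [pushLog, h]

theorem pushLog_nil : pushLog L w [] = L := by simp [pushLog]

theorem pushLog_pushLog (e e' : List (Rumor T)) :
    pushLog (pushLog L w e) w e' = pushLog L w (e ++ e') := by
  simp [pushLog]

theorem pushLog_self (e : List (Rumor T)) : pushLog L w e w = L w ++ e := by simp [pushLog]

theorem pushLog_of_ne {v : V} (h : v ≠ w) (e : List (Rumor T)) : pushLog L w e v = L v := by
  simp [pushLog, h]

theorem precedes_pushLog (hf : f ∉ L w) {v : V} {g h : Rumor T} :
    Precedes (pushLog L w [f] v) g h ↔ Precedes (L v) g h ∨ (v = w ∧ h = f ∧ g ∈ L w) := by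
  by_cases hv : v = w
  · subst hv
    simp [pushLog_self, Precedes.append_singleton hf]
  · simp [pushLog_of_ne hv, hv]

theorem precedes_pushLog_of_mem {e : List (Rumor T)} {v : V} {g h : Rumor T} (hh : h ∈ L v) :
    Precedes (pushLog L w e v) g h ↔ Precedes (L v) g h := by
  by_cases hv : v = w
  · subst hv
    simp [pushLog_self, Precedes.append_of_mem hh]
  · simp [pushLog_of_ne hv]

/-- A certificate speaks only of announcements already made and of their past, which later entries
do not change. -/
theorem Certified.push {e : List (Rumor T)} {x : Label T} (h : Certified lab L x) :
    Certified lab (pushLog L w e) x := by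
  obtain ⟨K, σ, hK, hx, H⟩ := h
  refine ⟨K, σ, hK, hx, fun y hy => ?_⟩
  obtain ⟨u, s, h1, h2, h3, h4⟩ := H y hy
  exact ⟨u, s, h1, mem_pushLog.2 (Or.inl h2), h3,
    fun x hx => h4 x ((precedes_pushLog_of_mem h2).1 hx)⟩

/-- The core induction: every elementary extension of one log preserves all invariants. Rumors
created by their owner satisfy the specifications by the rule that creates them; relayed ones
inherit them because the relaying node passes on its log in order. -/
theorem Sound.push (S : Sound lab t τ L) (hlab : Function.Injective lab)
    (h : Push lab t τ L w f) : Sound lab t τ (pushLog L w [f]) := by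
  classical
  have hf := h.notMem
  -- A rumor present anywhere is already in its owner's log, so it is never new to its owner.
  have hown : ∀ u, f.owner = some (lab u) → ∀ v, f ∈ L v → u = w → False := by
    rintro u hu v hv rfl
    obtain ⟨u', hu', hm⟩ := S.owned v f _ hv hu
    rw [hlab hu'] at hm
    exact hf hm
  have hmem : ∀ {v g}, g ∈ pushLog L w [f] v ↔ g ∈ L v ∨ (v = w ∧ g = f) := by
    intro v g; rw [mem_pushLog, List.mem_singleton]
  constructor
  · intro v
    by_cases hv : v = w
    · subst hv
      rw [pushLog_self]
      exact (S.nodup _).append (by simp) (by simpa using hf)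
    · rw [pushLog_of_ne hv]; exact S.nodup v
  · intro v g x hg hx
    rw [hmem] at hg
    rcases hg with hg | ⟨rfl, rfl⟩
    · obtain ⟨u, hu, hu'⟩ := S.owned v g x hg hx
      exact ⟨u, hu, hmem.2 (Or.inl hu')⟩
    · rcases h.own_or_relay with h1 | ⟨a, ha, -⟩
      · exact ⟨v, (h1 x hx).symm, hmem.2 (Or.inr ⟨rfl, rfl⟩)⟩
      · obtain ⟨u, hu, hu'⟩ := S.owned a g x ha hx
        exact ⟨u, hu, hmem.2 (Or.inl hu')⟩
  · intro v u p g hp hu hg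
    rw [hmem] at hp
    rw [precedes_pushLog hf] at hg ⊢
    rcases hg with hg | ⟨rfl, rfl, hg⟩
    · by_cases hpv : p ∈ L v
      · exact Or.inl (S.causal v u p g hpv hu hg)
      · obtain ⟨rfl, rfl⟩ := hp.resolve_left hpv
        refine Or.inr ⟨rfl, rfl, ?_⟩
        -- A created rumor is not yet in its owner's log, so it has no past there. For a relayed
        -- one, the past at the owner is also past at `a`, and FIFO has already brought that to `w`.
        rcases h.own_or_relay with h1 | ⟨a, ha, ha', -⟩
        · have := hlab (h1 _ hu)
          subst this
          exact absurd hg.1 hf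
        · exact ha' g (S.causal a u p g ha hu hg)
    · by_cases hpv : p ∈ L v
      · exact (hown u hu v hpv rfl).elim
      · exact Or.inr ⟨(hp.resolve_left hpv).1, rfl, hg⟩
  · intro v hv
    rw [hmem] at hv
    rcases hv with hv | ⟨rfl, rfl⟩
    · exact S.lucky_of_cand v hv
    · cases h with
      | relay ha => exact (hown v rfl _ ha rfl).elim
      | cand _ h => exact h
  · intro v hv hl
    rw [hmem] at hv ⊢
    rcases hv with hv | ⟨rfl, rfl⟩
    · exact Or.inl (S.cand_of_lucky v hv hl)
    · cases h with
      | relay _ _ _ h => exact absurd rfl h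
      | hello _ h => exact Or.inl (h hl)
  · intro z x hz
    rw [hmem] at hz
    rcases hz with hz | ⟨rfl, rfl⟩
    · obtain ⟨h1, h2, h3⟩ := S.wit_spec z x hz
      refine ⟨hmem.2 (Or.inl h1), h2, fun g hg => ?_⟩
      rw [precedes_pushLog_of_mem h1] at hg
      rw [precedes_pushLog_of_mem hz]
      exact h3 g hg
    · cases h with
      | relay ha => exact (hown z rfl _ ha rfl).elim
      | wit h1 h2 h3 =>
        refine ⟨hmem.2 (Or.inl h1), h2, fun g hg => ?_⟩
        rw [precedes_pushLog_of_mem h1] at hg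
        rw [precedes_pushLog hf]
        exact Or.inr ⟨rfl, rfl, hg.mem_left⟩
  · have key : ∀ u s, Rumor.done (lab u) s ∈ L u → ∀ s', u = w → Rumor.done (lab u) s' = f →
        False := by
      rintro u s hs s' rfl rfl
      cases h with
      | relay ha => exact hown u rfl _ ha rfl
      | done h => exact h.2.1 _ hs
    intro u s s' hs hs'
    rw [hmem] at hs hs'
    rcases hs with hs | ⟨h1, h2⟩ <;> rcases hs' with hs' | ⟨h1', h2'⟩
    · exact S.done_unique u s s' hs hs'
    · exact (key u s hs s' h1' h2').elim
    · exact (key u s' hs' s h1 h2).elim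
    · have := h2.trans h2'.symm
      simpa using this
  · intro u s hs
    rw [hmem] at hs
    rcases hs with hs | ⟨rfl, rfl⟩
    · have := S.done_spec u s hs
      simpa only [precedes_pushLog_of_mem hs] using this
    · have hp : ∀ g, Precedes (pushLog L u [Rumor.done (lab u) s] u) g (Rumor.done (lab u) s) ↔
          g ∈ L u := by
        intro g
        rw [pushLog_self, Precedes.append_cons_self hf]
      simp only [hp]
      cases h with
      | relay ha => exact (hown u rfl _ ha rfl).elim
      | done h => exact ⟨rfl, h.1, h.2.2⟩
  · have key : ∀ v x, Rumor.elect x ∈ L v → ∀ x', v = w → Rumor.elect x' = f → False := by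
      rintro v x hx x' rfl rfl
      cases h with
      | relay _ _ _ _ h => exact h _ hx
      | elect h => exact h.1 _ hx
    intro v x x' hx hx'
    rw [hmem] at hx hx'
    rcases hx with hx | ⟨h1, h2⟩ <;> rcases hx' with hx' | ⟨h1', h2'⟩
    · exact S.elect_unique v x x' hx hx'
    · exact (key v x hx x' h1' h2').elim
    · exact (key v x' hx' x h1 h2).elim
    · have := h2.trans h2'.symm
      simpa using this
  · intro v x hx
    rw [hmem] at hx
    rcases hx with hx | ⟨rfl, rfl⟩
    · exact (S.elect_spec v x hx).push
    · cases h with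
      | relay ha => exact (S.elect_spec _ x ha).push
      | elect h =>
        -- The certificate consists of all candidates known to the elector. By causality, whatever
        -- an announcing candidate knew is known wherever its announcement is, so this set is
        -- closed.
        refine Certified.push ⟨cands (L v), rank (L v), ?_, rfl, fun y hy => ?_⟩
        · obtain ⟨x, hx⟩ := h.2.1
          exact ⟨x, mem_cands.2 hx⟩
        · obtain ⟨s, hs⟩ := h.2.2 y (mem_cands.1 hy)
          obtain ⟨u, rfl, hu⟩ := S.owned _ _ _ hs rfl
          exact ⟨u, s, rfl, hu, S.rank_eq hlab hs, fun x hx =>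
            mem_cands.2 (S.causal v u _ _ hs rfl hx).mem_left⟩

/-! ### Uniqueness of the leader -/

section Samples

variable (lab) [Fintype V]

open Classical in
/-- The nodes that have learnt that `u` is a candidate, before having heard the same of `v`. -/
noncomputable def draws (L : V → List (Rumor T)) (u v : V) : Finset V :=
  Finset.univ.filter fun z => z ≠ u ∧ Rumor.cand (lab u) ∈ L z ∧
    ¬ Precedes (L z) (Rumor.cand (lab v)) (Rumor.cand (lab u))

open Classical in
/-- Those of them that have become witnesses for `u`. -/
noncomputable def hits (L : V → List (Rumor T)) (u v : V) : Finset V :=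
  (draws lab L u v).filter fun z => Rumor.wit (lab u) (lab z) ∈ L z

/-- A node that has heard of both candidates heard of one of them first, since two rumors cannot
have the same first position. -/
theorem disjoint_draws {u v : V} (hlab : Function.Injective lab) (h : u ≠ v) :
    Disjoint (draws lab L u v) (draws lab L v u) := by
  rw [Finset.disjoint_left]
  intro z h1 h2
  simp only [draws, Finset.mem_filter, Finset.mem_univ, true_and, Precedes, not_and, not_lt]
    at h1 h2
  have h3 := le_antisymm (h1.2.2 h1.2.1) (h2.2.2 h2.2.1)
  have := (List.idxOf_inj h1.2.1).1 h3
  simp only [Rumor.cand.injEq] at this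
  exact h (hlab this)

theorem hits_subset_draws (u v : V) : hits lab L u v ⊆ draws lab L u v := Finset.filter_subset _ _

variable {lab}

/-- Had a counted witness `z` heard of `v` before `u`, that news would precede its witness rumor in
the log of `z`, hence by causality in the log of `u`, and so precede the announcement. All `τ`
counted witnesses are therefore hits in the restricted sample. -/
theorem Sound.le_card_hits (S : Sound lab t τ L) {u v : V}
    {s : Fin (2 ^ T + 1)} (h : Rumor.done (lab u) s ∈ L u)
    (hv : ¬ Precedes (L u) (Rumor.cand (lab v)) (Rumor.done (lab u) s)) :
    τ ≤ (hits lab L u v).card := by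
  classical
  refine (S.done_spec u s h).2.2.trans ?_
  refine (Finset.card_le_card (t := (hits lab L u v).image lab) ?_).trans Finset.card_image_le
  intro x hx
  simp only [Finset.mem_filter, Finset.mem_univ, true_and] at hx
  obtain ⟨z, rfl, hz⟩ := S.owned u _ _ hx.mem_left rfl
  refine Finset.mem_image_of_mem _ ?_
  obtain ⟨h1, h2, h3⟩ := S.wit_spec z _ hz
  simp only [hits, draws, Finset.mem_filter, Finset.mem_univ, true_and]
  refine ⟨⟨fun hzu => h2 (hzu ▸ rfl), h1, fun hc => hv ?_⟩, hz⟩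
  exact (S.causal u z _ _ hx.mem_left rfl (h3 _ hc)).trans hx

/-- No two candidates have collected their witnesses without hearing of each other. -/
def NoSplit (lab : V → Label T) (τ : ℕ) (L : V → List (Rumor T)) : Prop :=
  ∀ u v, u ≠ v → ¬ (τ ≤ (hits lab L u v).card ∧ τ ≤ (hits lab L v u).card)

/-- The epsilon choice depends on the set of minimizers alone, so ties are broken in the same way at
all nodes. -/
theorem leaderOf_congr {K K' : Finset (Label T)} {σ σ' : Label T → ℕ}
    (h : ∀ x, (x ∈ K ∧ ∀ y ∈ K, σ x ≤ σ y) ↔ (x ∈ K' ∧ ∀ y ∈ K', σ' x ≤ σ' y)) :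
    leaderOf K σ = leaderOf K' σ' := by
  unfold leaderOf
  congr 1
  funext x
  exact propext (h x)

theorem leaderOf_mem {K : Finset (Label T)} (hK : K.Nonempty) (σ : Label T → ℕ) :
    leaderOf K σ ∈ K := by
  have : ∃ x, x ∈ K ∧ ∀ y ∈ K, σ x ≤ σ y := K.exists_min_image σ hK
  exact (Classical.epsilon_spec this).1

/-- It suffices that two certificates have the same minimizers. This follows by comparing the size
of a certificate with the count announced by a candidate outside of it. -/
theorem Sound.certified_unique (S : Sound lab t τ L) (hlab : Function.Injective lab)
    (hN : NoSplit lab τ L) {x x' : Label T} (hx : Certified lab L x)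
    (hx' : Certified lab L x') : x = x' := by
  classical
  obtain ⟨K, σ, hK, rfl, H⟩ := hx
  obtain ⟨K', σ', hK', rfl, H'⟩ := hx'
  -- the common counts
  have hσ : ∀ y ∈ K, ∀ y' ∈ K', y = y' → σ y = σ' y' := by
    rintro y hy y' hy' rfl
    obtain ⟨u, s, -, h1, h2, -⟩ := H y hy
    obtain ⟨u', s', -, h1', h2', -⟩ := H' y hy'
    rw [h2, h2', S.done_unique' hlab h1 h1']
  -- a candidate of minimal count belongs to every certificate
  have key : ∀ (K K' : Finset (Label T)) (σ σ' : Label T → ℕ), K.Nonempty →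
      (∀ y ∈ K, ∃ u s, lab u = y ∧ Rumor.done y s ∈ L u ∧ σ y = s.val ∧
        ∀ x, Precedes (L u) (Rumor.cand x) (Rumor.done y s) → x ∈ K) →
      (∀ y ∈ K', ∃ u s, lab u = y ∧ Rumor.done y s ∈ L u ∧ σ' y = s.val ∧
        ∀ x, Precedes (L u) (Rumor.cand x) (Rumor.done y s) → x ∈ K') →
      ∀ m ∈ K', (∀ y ∈ K, σ' m ≤ σ y) → m ∈ K := by
    intro K K' σ σ' hK H H' m hm hmin
    by_contra hmK
    obtain ⟨v, s, rfl, h1, h2, h3⟩ := H' m hm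
    obtain ⟨y, hy⟩ := hK
    -- If `m = lab v` is outside of `K`, no member of `K` knew it when announcing, since `K` is
    -- closed. By `NoSplit` the node `v` then knew all of `K`, and itself, so its count is at least
    -- `K.card + 1`.
    have hsub : insert (lab v) K ⊆
        Finset.univ.filter fun x => Precedes (L v) (Rumor.cand x) (Rumor.done (lab v) s) := by
      intro z hz
      simp only [Finset.mem_filter, Finset.mem_univ, true_and]
      rcases Finset.mem_insert.1 hz with rfl | hz
      · exact (S.done_spec v s h1).2.1
      · obtain ⟨u, s', rfl, g1, g2, g3⟩ := H z hz
        by_contra hc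
        have huv : u ≠ v := fun h => hmK (h ▸ hz)
        exact hN u v huv ⟨S.le_card_hits g1 fun h => hmK (g3 _ h), S.le_card_hits h1 hc⟩
    have c1 := Finset.card_le_card hsub
    rw [(S.done_spec v s h1).1, Finset.card_insert_of_notMem hmK] at c1
    have c2 := hmin y hy
    obtain ⟨u, s', rfl, g1, g2, g3⟩ := H y hy
    -- By closedness a member of `K` knew only members of `K`, so its count is at most `K.card`,
    -- contradicting the minimality of `m`.
    have c3 : (Finset.univ.filter fun x =>
        Precedes (L u) (Rumor.cand x) (Rumor.done (lab u) s')).card ≤ K.card := by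
      refine Finset.card_le_card fun x hx => ?_
      simp only [Finset.mem_filter, Finset.mem_univ, true_and] at hx
      exact g3 x hx
    rw [(S.done_spec u s' g1).1] at c3
    omega
  obtain ⟨m, hm, hmin⟩ := K.exists_min_image σ hK
  obtain ⟨m', hm', hmin'⟩ := K'.exists_min_image σ' hK'
  -- The smaller of the two minima is attained at a candidate that lies in both sets and minimizes
  -- both counts.
  have main : ∃ m, m ∈ K ∧ m ∈ K' ∧ (∀ y ∈ K, σ m ≤ σ y) ∧ ∀ y ∈ K', σ' m ≤ σ' y := by
    rcases le_total (σ m) (σ' m') with hle | hle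
    · have h1 := key K' K σ' σ hK' H' H m hm fun y hy => hle.trans (hmin' y hy)
      exact ⟨m, hm, h1, hmin, fun y hy => hσ m hm m h1 rfl ▸ hle.trans (hmin' y hy)⟩
    · have h1 := key K K' σ σ' hK H H' m' hm' fun y hy => hle.trans (hmin y hy)
      exact ⟨m', h1, hm', fun y hy => (hσ m' h1 m' hm' rfl).symm ▸ hle.trans (hmin y hy), hmin'⟩
  obtain ⟨m, hm1, hm2, hm3, hm4⟩ := main
  refine leaderOf_congr fun x => ⟨fun ⟨h1, h2⟩ => ?_, fun ⟨h1, h2⟩ => ?_⟩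
  · have e1 : σ x = σ m := le_antisymm (h2 m hm1) (hm3 x h1)
    have e2 := hσ m hm1 m hm2 rfl
    have hxK : x ∈ K' := key K' K σ' σ hK' H' H x h1 fun y hy => by
      rw [e1, e2]; exact hm4 y hy
    exact ⟨hxK, fun y hy => by rw [← hσ x h1 x hxK rfl, e1, e2]; exact hm4 y hy⟩
  · have e1 : σ' x = σ' m := le_antisymm (h2 m hm2) (hm4 x h1)
    have e2 := hσ m hm1 m hm2 rfl
    have hxK : x ∈ K := key K K' σ σ' hK H H' x h1 fun y hy => by
      rw [e1, ← e2]; exact hm3 y hy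
    exact ⟨hxK, fun y hy => by rw [hσ x hxK x h1 rfl, e1, ← e2]; exact hm3 y hy⟩

end Samples

end Logs

/-! ### Waking up, sending and receiving -/

section Net

variable {V : Type} [DecidableEq V] {T : ℕ} {lab : V → Label T} {t τ : ℕ}
  {L : V → List (Rumor T)} {w : V} {f : Rumor T}

/-- The candidacy is entered before `hello`, so that at every intermediate stage a log with `hello`
already shows whether its node is a candidate. -/
theorem Sound.init (S : Sound lab t τ L) (hlab : Function.Injective lab) (hw : L w = []) :
    Sound lab t τ (pushLog L w (initLog t (lab w))) := by
  classical
  unfold initLog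
  rw [← pushLog_pushLog]
  by_cases h : Lucky t (lab w)
  · rw [if_pos h]
    refine (S.push hlab (.cand hw h)).push hlab (.hello ?_ ?_)
    · simp [pushLog_self, hw]
    · simp [pushLog_self]
  · rw [if_neg h, pushLog_nil]
    exact S.push hlab (.hello (by simp [hw]) fun h' => absurd h' h)

theorem doneNews_eq (me : Label T) (l : List (Rumor T)) :
    (DoneRule τ me l ∧ doneNews τ me l = [.done me (count l)]) ∨
      (¬ DoneRule τ me l ∧ doneNews τ me l = []) := by
  unfold doneNews; by_cases h : DoneRule τ me l <;> simp [h]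

theorem electNews_eq (l : List (Rumor T)) :
    (ElectRule l ∧ electNews l = [.elect (leader l)]) ∨ (¬ ElectRule l ∧ electNews l = []) := by
  unfold electNews; by_cases h : ElectRule l <;> simp [h]

theorem witNews_eq (me b : Label T) (f : Rumor T) :
    (∃ x, f = .cand x ∧ Lucky t b ∧ witNews t me b f = [.wit x me]) ∨
      (witNews t me b f = [] ∧ ∀ x, f = .cand x → ¬ Lucky t b) := by
  unfold witNews
  cases f <;> simp
  by_cases h : Lucky t b <;> simp [h]

/-- The reaction to a message splits into at most four elementary extensions: relay, witness,
announcement, election. -/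
theorem Sound.learn (S : Sound lab t τ L) (hlab : Function.Injective lab) {a : V} (b : Label T)
    (hhello : Rumor.hello ∈ L w) (ha : f ∈ L a) (hpre : ∀ g, Precedes (L a) g f → g ∈ L w)
    (hf : f ∉ L w) (hopen : Open (L w)) :
    Sound lab t τ (pushLog L w (learnNews t τ (lab w) (L w) f b)) := by
  have S1 := S.push hlab (.relay ha hpre hf (fun h => hf (h ▸ hhello)) hopen)
  have S2 : Sound lab t τ (pushLog L w (f :: witNews t (lab w) b f)) := by
    rw [← List.singleton_append, ← pushLog_pushLog]
    rcases witNews_eq (t := t) (lab w) b f with ⟨x, rfl, hb, he⟩ | ⟨he, -⟩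
    · rw [he]
      refine S1.push hlab (.wit ?_ ?_ ?_)
      · simp [pushLog_self]
      -- A node does not witness for itself: its own candidacy is in its log already, so it never
      -- arrives as news.
      · rintro rfl
        obtain ⟨u, hu, hu'⟩ := S.owned a _ _ ha rfl
        rw [hlab hu] at hu'
        exact hf hu'
      · simp only [pushLog_self, List.mem_append, List.mem_singleton, reduceCtorEq, or_false]
        exact fun h => hf (S.wit_spec w x h).1
    · rw [he, pushLog_nil]; exact S1
  have S3 : Sound lab t τ (pushLog L w ((f :: witNews t (lab w) b f) ++
      doneNews τ (lab w) (L w ++ (f :: witNews t (lab w) b f)))) := by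
    rw [← pushLog_pushLog, ← pushLog_self]
    rcases doneNews_eq (τ := τ) (lab w) (pushLog L w (f :: witNews t (lab w) b f) w) with h | h
    · rw [h.2]; exact S2.push hlab (.done h.1)
    · rw [h.2, pushLog_nil]; exact S2
  unfold learnNews
  dsimp only
  generalize doneNews τ (lab w) (L w ++ (f :: witNews t (lab w) b f)) = e at *
  rw [← pushLog_pushLog, List.append_assoc (L w), ← pushLog_self (L := L) (w := w)]
  rcases electNews_eq (pushLog L w ((f :: witNews t (lab w) b f) ++ e) w) with h | h
  · rw [h.2]; exact S3.push hlab (.elect h.1)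
  · rw [h.2, pushLog_nil]; exact S3

/-- No rule is applicable to the log `l`. -/
def Settled (τ : ℕ) (me : Label T) (l : List (Rumor T)) : Prop := ¬ DoneRule τ me l ∧ ¬ ElectRule l

/-- A fresh log contains no witnesses and no announcements, so a positive threshold blocks both
rules. -/
theorem settled_initLog (hτ : 1 ≤ τ) (b : Label T) : Settled τ b (initLog t b) := by
  have h : ∀ x s, Rumor.done x s ∉ initLog t b := by
    intro x s; unfold initLog; split_ifs <;> simp
  have h' : ∀ x w, Rumor.wit x w ∉ initLog t b := by
    intro x s; unfold initLog; split_ifs <;> simp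
  constructor
  · rintro ⟨-, -, hc⟩
    have : wits b (initLog t b) = ∅ := by
      ext w; simp [mem_wits, h']
    rw [this] at hc
    simp at hc
    omega
  · rintro ⟨-, ⟨x, hx⟩, hc⟩
    obtain ⟨s, hs⟩ := hc x hx
    exact h _ _ hs

/-- One pass over the rules suffices: an announcement disables the rule for announcing, an election
disables the rule for electing, and electing adds no witness. -/
theorem settled_learn (me b : Label T) (l : List (Rumor T)) :
    Settled τ me (l ++ learnNews t τ me l f b) := by
  unfold learnNews
  dsimp only
  generalize f :: witNews t me b f = e
  rw [← List.append_assoc, ← List.append_assoc]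
  generalize l ++ e = l1
  have h2 : ¬ DoneRule τ me (l1 ++ doneNews τ me l1) := by
    rcases doneNews_eq (τ := τ) me l1 with h | h
    · rintro ⟨-, h', -⟩
      rw [h.2] at h'
      exact h' (count l1) (by simp)
    · rw [h.2, List.append_nil]; exact h.1
  generalize l1 ++ doneNews τ me l1 = l2 at *
  rcases electNews_eq l2 with h | h
  · rw [h.2]
    refine ⟨fun hd => h2 ?_, fun he => he.1 (leader l2) (by simp)⟩
    obtain ⟨a1, a2, a3⟩ := hd
    refine ⟨by simpa using a1, by simpa using a2, ?_⟩
    have : wits me (l2 ++ [Rumor.elect (leader l2)]) = wits me l2 := by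
      ext x; simp [mem_wits]
    rwa [this] at a3
  · rw [h.2, List.append_nil]; exact ⟨h2, h.1⟩

theorem cand_mem_learnNews {me b x : Label T} {l : List (Rumor T)} :
    Rumor.cand x ∈ learnNews t τ me l f b ↔ f = .cand x := by
  unfold learnNews
  dsimp only
  generalize l ++ f :: witNews t me b f ++ doneNews τ me (l ++ f :: witNews t me b f) = l2
  generalize l ++ f :: witNews t me b f = l1
  rcases electNews_eq l2 with h | h <;> rcases doneNews_eq (τ := τ) me l1 with h' | h' <;>
    rcases witNews_eq (t := t) me b f with ⟨y, -, -, h''⟩ | ⟨h'', -⟩ <;>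
      simp [h.2, h'.2, h'', eq_comm]

theorem wit_mem_learnNews {me b x y : Label T} {l : List (Rumor T)} :
    Rumor.wit x y ∈ learnNews t τ me l f b ↔
      f = .wit x y ∨ (f = .cand x ∧ Lucky t b ∧ y = me) := by
  unfold learnNews
  dsimp only
  generalize l ++ f :: witNews t me b f ++ doneNews τ me (l ++ f :: witNews t me b f) = l2
  generalize l ++ f :: witNews t me b f = l1
  rcases witNews_eq (t := t) me b f with ⟨z, hz, hb, h''⟩ | ⟨h'', hn⟩
  · subst hz
    rcases electNews_eq l2 with h | h <;> rcases doneNews_eq (τ := τ) me l1 with h' | h' <;>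
      simp [h.2, h'.2, h'', hb, eq_comm]
  · have : ¬ (f = .cand x ∧ Lucky t b ∧ y = me) := fun h => hn _ h.1 h.2.1
    rw [or_iff_left this]
    rcases electNews_eq l2 with h | h <;> rcases doneNews_eq (τ := τ) me l1 with h' | h' <;>
      simp [h.2, h'.2, h'', eq_comm]

/-! ### How waking up and receiving change the samples of witnesses. -/

section Samples

variable [Fintype V]

theorem mem_draws {u v z : V} : z ∈ draws lab L u v ↔ z ≠ u ∧ Rumor.cand (lab u) ∈ L z ∧
    ¬ Precedes (L z) (Rumor.cand (lab v)) (Rumor.cand (lab u)) := by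
  simp [draws]

theorem mem_hits {u v z : V} : z ∈ hits lab L u v ↔ z ∈ draws lab L u v ∧
    Rumor.wit (lab u) (lab z) ∈ L z := by
  simp [hits]

theorem mem_draws_pushLog_of_ne {u v z : V} (e : List (Rumor T)) (hz : z ≠ w) :
    z ∈ draws lab (pushLog L w e) u v ↔ z ∈ draws lab L u v := by
  simp only [mem_draws, pushLog_of_ne hz]

theorem mem_hits_pushLog_of_ne {u v z : V} (e : List (Rumor T)) (hz : z ≠ w) :
    z ∈ hits lab (pushLog L w e) u v ↔ z ∈ hits lab L u v := by
  simp only [mem_hits, mem_draws, pushLog_of_ne hz]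

/-- The only candidacy in a fresh log is the node's own, which `draws` excludes. -/
theorem draws_init (hlab : Function.Injective lab) (hw : L w = []) (u v : V) :
    draws lab (pushLog L w (initLog t (lab w))) u v = draws lab L u v := by
  ext z
  by_cases hz : z = w
  · subst hz
    simp only [mem_draws, pushLog_self, hw, List.nil_append, List.not_mem_nil, false_and, and_false,
      iff_false, not_and]
    intro h1 h2
    unfold initLog at h2
    split_ifs at h2
    · simp at h2
      exact absurd (hlab h2).symm h1
    · simp at h2
  · exact mem_draws_pushLog_of_ne _ hz

theorem hits_init (hlab : Function.Injective lab) (hw : L w = []) (u v : V) :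
    hits lab (pushLog L w (initLog t (lab w))) u v = hits lab L u v := by
  ext z
  by_cases hz : z = w
  · subst hz
    rw [mem_hits, mem_hits, draws_init hlab hw]
    simp [mem_draws, hw]
  · exact mem_hits_pushLog_of_ne _ hz

/-- When `f` arrives, the node `w` samples whether to become a witness for `u`. -/
def Samples (lab : V → Label T) (l : List (Rumor T)) (u v w : V) (f : Rumor T) : Prop :=
  f = .cand (lab u) ∧ w ≠ u ∧ f ∉ l ∧ Rumor.cand (lab v) ∉ l

theorem news_of_notMem {me b : Label T} {l : List (Rumor T)} (h : f ∉ l) :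
    news t τ me l f b = learnNews t τ me l f b := by
  unfold news; rw [if_neg h]

theorem news_of_mem {me b : Label T} {l : List (Rumor T)} (h : f ∈ l) :
    news t τ me l f b = [] := by
  unfold news; rw [if_pos h]

theorem learnNews_eq_cons (me b : Label T) (l : List (Rumor T)) :
    ∃ e, learnNews t τ me l f b = f :: e := ⟨_, rfl⟩

theorem draws_news_of_samples {u v : V} {me b : Label T} (h : Samples lab (L w) u v w f) :
    w ∉ draws lab L u v ∧
    draws lab (pushLog L w (news t τ me (L w) f b)) u v = insert w (draws lab L u v) := by
  obtain ⟨rfl, h1, h2, h3⟩ := h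
  refine ⟨fun h => h2 (mem_draws.1 h).2.1, ?_⟩
  ext z
  by_cases hz : z = w
  · subst hz
    rw [news_of_notMem h2]
    obtain ⟨e, he⟩ := learnNews_eq_cons (t := t) (τ := τ) (f := .cand (lab u)) me b (L z)
    rw [mem_draws, pushLog_self, he, Precedes.append_cons_self h2]
    simp [h1, h3]
  · rw [mem_draws_pushLog_of_ne _ hz]
    simp [hz]

-- Rumors of `w` as a witness originate at `w` itself, and it had none for `u` before hearing of
-- `u`; so the fresh coins alone decide.
open Classical in
theorem hits_news_of_samples (S : Sound lab t τ L) {u v : V} {b : Label T}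
    (h : Samples lab (L w) u v w f) :
    w ∉ hits lab L u v ∧ hits lab (pushLog L w (news t τ (lab w) (L w) f b)) u v =
      if Lucky t b then insert w (hits lab L u v) else hits lab L u v := by
  have hd := draws_news_of_samples (t := t) (τ := τ) (me := lab w) (b := b) h
  obtain ⟨rfl, h1, h2, h3⟩ := h
  have hw : w ∉ hits lab L u v := fun h => hd.1 (mem_hits.1 h).1
  refine ⟨hw, ?_⟩
  ext z
  by_cases hz : z = w
  · subst hz
    have : Rumor.wit (lab u) (lab z) ∉ L z := fun h => h2 (S.wit_spec z _ h).1
    rw [mem_hits, hd.2, pushLog_self, news_of_notMem h2, List.mem_append, wit_mem_learnNews]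
    by_cases hb : Lucky t b <;> simp [hb, this, hw]
  · rw [mem_hits_pushLog_of_ne _ hz]
    split_ifs <;> simp [hz]

/-- Membership in `draws` is fixed when the candidacy of `u` first arrives. A rumor that names `w`
as a witness cannot reach `w` as news, because `w` originated it. -/
theorem samples_news_of_not (S : Sound lab t τ L) (hlab : Function.Injective lab) {u v a : V}
    {b : Label T} (ha : f ∈ L a) (h : ¬ Samples lab (L w) u v w f) :
    draws lab (pushLog L w (news t τ (lab w) (L w) f b)) u v = draws lab L u v ∧
    hits lab (pushLog L w (news t τ (lab w) (L w) f b)) u v = hits lab L u v := by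
  by_cases hf : f ∈ L w
  · rw [news_of_mem hf, pushLog_nil]; exact ⟨rfl, rfl⟩
  rw [news_of_notMem hf]
  have hd : draws lab (pushLog L w (learnNews t τ (lab w) (L w) f b)) u v = draws lab L u v := by
    ext z
    by_cases hz : z = w
    · subst hz
      rw [mem_draws, mem_draws]
      refine and_congr_right fun hzu => ?_
      by_cases hc : Rumor.cand (lab u) ∈ L z
      · rw [precedes_pushLog_of_mem hc, mem_pushLog]
        simp [hc]
      · simp only [hc, false_and, iff_false, not_and, not_not, pushLog_self]
        intro hc'
        obtain ⟨e, he⟩ := learnNews_eq_cons (t := t) (τ := τ) (f := f) (lab z) b (L z)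
        have hfu := cand_mem_learnNews.1 ((List.mem_append.1 hc').resolve_left hc)
        rw [he, hfu, Precedes.append_cons_self hc]
        by_contra hv
        exact h ⟨hfu, hzu, hf, hv⟩
    · exact mem_draws_pushLog_of_ne _ hz
  refine ⟨hd, ?_⟩
  ext z
  by_cases hz : z = w
  · subst hz
    rw [mem_hits, mem_hits, hd]
    refine and_congr_right fun hzd => ?_
    rw [pushLog_self, List.mem_append, wit_mem_learnNews]
    refine or_iff_left ?_
    rintro (rfl | ⟨rfl, -⟩)
    · obtain ⟨y, hy, hy'⟩ := S.owned a _ _ ha rfl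
      rw [hlab hy] at hy'
      exact hf hy'
    · exact hf (mem_draws.1 hzd).2.1
  · exact mem_hits_pushLog_of_ne _ hz

end Samples

/-- The queues after the node `w` has sent `e` over all of its edges. -/
def pushQueue {α : Type} (G : SimpleGraph V) [DecidableRel G.Adj] (Q : V → V → List α) (w : V)
    (e : List α) : V → V → List α :=
  fun a b => if a = w ∧ G.Adj a b then Q a b ++ e else Q a b

/-- The queues after the queue from `u` to `w` has been replaced by `r`. -/
def setQueue {α : Type} (Q : V → V → List α) (u w : V) (r : List α) : V → V → List α :=
  fun a b => if a = u ∧ b = w then r else Q a b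

variable (G : SimpleGraph V) [DecidableRel G.Adj] {Q : V → V → List (Rumor T)}

/-- Every queue holds the end of the log of the sender; what has been delivered before is known to
the receiver, unless it has terminated. -/
def Fifo (L : V → List (Rumor T)) (Q : V → V → List (Rumor T)) : Prop :=
  ∀ u w, (¬ G.Adj u w → Q u w = []) ∧ (G.Adj u w → ∃ p, L u = p ++ Q u w ∧
    (Open (L w) → ∀ f ∈ p, f ∈ L w))

theorem pushQueue_setQueue {α : Type} {Q : V → V → List α} {u w : V} (h : u ≠ w) (r e : List α) :
    pushQueue G (setQueue Q u w r) w e = setQueue (pushQueue G Q w e) u w r := by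
  funext a b
  unfold pushQueue setQueue
  by_cases ha : a = w
  · have : ¬ a = u := fun h' => h (h'.symm.trans ha)
    simp [this]
  · simp [ha]

theorem pushQueue_nil {α : Type} {Q : V → V → List α} {w : V} : pushQueue G Q w [] = Q := by
  funext a b; simp [pushQueue]

variable {G}

/-- The log of the sender and its queues grow by the same tail, so the delivered prefix stays the
same. -/
theorem Fifo.push (F : Fifo G L Q) (w : V) (e : List (Rumor T)) :
    Fifo G (pushLog L w e) (pushQueue G Q w e) := by
  intro a b
  refine ⟨fun h => ?_, fun h => ?_⟩
  · unfold pushQueue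
    rw [if_neg fun h' => h h'.2]
    exact (F a b).1 h
  · obtain ⟨p, h1, h2⟩ := (F a b).2 h
    refine ⟨p, ?_, fun ho f hf => mem_pushLog.2 (Or.inl (h2 (fun x hx => ho x ?_) f hf))⟩
    · by_cases ha : a = w
      · subst ha
        simp [pushQueue, h, pushLog_self, h1]
      · simp [pushQueue, ha, pushLog_of_ne ha, h1]
    · exact mem_pushLog.2 (Or.inl hx)

theorem Fifo.adj (F : Fifo G L Q) {u w : V} (h : Q u w ≠ []) : G.Adj u w := by
  by_contra h'
  exact h ((F u w).1 h')

theorem Fifo.pop (F : Fifo G L Q) {u w : V} {r : List (Rumor T)} (h : Q u w = f :: r)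
    (hf : Open (L w) → f ∈ L w) : Fifo G L (setQueue Q u w r) := by
  intro a b
  by_cases hab : a = u ∧ b = w
  · obtain ⟨rfl, rfl⟩ := hab
    have hadj := F.adj (u := a) (w := b) (by simp [h])
    refine ⟨fun h' => absurd hadj h', fun _ => ?_⟩
    obtain ⟨p, h1, h2⟩ := (F a b).2 hadj
    refine ⟨p ++ [f], by simp [setQueue, h1, h], fun ho g hg => ?_⟩
    rcases List.mem_append.1 hg with hg | hg
    · exact h2 ho g hg
    · rw [List.mem_singleton.1 hg]; exact hf ho
  · simp only [setQueue, if_neg hab]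
    exact F a b

/-- This supplies the premises of `Push.relay`: what precedes the head of the queue in the sender's
log has been delivered before. -/
theorem Fifo.relay (F : Fifo G L Q) {u w : V} {r : List (Rumor T)} (h : Q u w = f :: r) :
    f ∈ L u ∧ (Open (L w) → ∀ g, Precedes (L u) g f → g ∈ L w) := by
  obtain ⟨p, h1, h2⟩ := (F u w).2 (F.adj (by simp [h]))
  rw [h] at h1
  refine ⟨by simp [h1], fun ho g hg => h2 ho g ?_⟩
  rw [h1] at hg
  exact hg.mem_prefix

end Net

/-! ### The configurations of the gossip protocol -/

namespace Gossip

open Protocol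

variable {V : Type} {T t τ : ℕ}

/-- The `j`-th block of coins of the node `v`. -/
def block (ω : (gossip T t τ).Coins V) (v : V) (j : ℕ) : Label T := fun i => ω (v, j, i)

/-- The label that the node `v` gets when it wakes up. -/
def label (ω : (gossip T t τ).Coins V) (v : V) : Label T := block ω v 0

/-- The log of the node `v`, empty while `v` is asleep. -/
def logs (c : (gossip T t τ).Config V) (v : V) : List (Rumor T) :=
  (c.node v).elim [] fun x => GossipState.log x.state

/-- The number of blocks of coins that the node `v` has used. -/
def flipCount (c : (gossip T t τ).Config V) (v : V) : ℕ :=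
  (c.node v).elim 0 fun x => x.flips.length

theorem isSome_output (s : GossipState T) :
    ((gossip T t τ).output s).isSome = true ↔ ¬ Open s.log := by
  unfold Open gossip
  dsimp only
  split_ifs with h
  · simpa using h
  · simpa using h

variable [Fintype V] [DecidableEq V] (G : SimpleGraph V) [DecidableRel G.Adj] (port : V → V → ℕ)
  {ω : (gossip T t τ).Coins V} {c : (gossip T t τ).Config V}

/-- The configuration `c` after the first message has been taken from the queue from `u` to `w`. -/
def pop (c : (gossip T t τ).Config V) (u w : V) (r : List (Rumor T)) : (gossip T t τ).Config V :=
  { c with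
    queue := setQueue c.queue u w r
    since := fun a b => if a = u ∧ b = w then c.now else c.since a b }

/-- The configuration `c` with new data for the node `v`. -/
def setNode (c : (gossip T t τ).Config V) (v : V) (x : (gossip T t τ).Node) :
    (gossip T t τ).Config V :=
  { c with node := Function.update c.node v (some x) }

theorem wakeUp_of_awake {v : V} (h : c.node v ≠ none) : wakeUp G port ω c v = c := by
  unfold wakeUp
  cases hx : c.node v with
  | none => exact absurd hx h
  | some x => rfl

theorem wakeUp_of_asleep {v : V} (h : c.node v = none) :
    wakeUp G port ω c v =
      emit G port (setNode c v ⟨label ω v, ⟨label ω v, initLog t (label ω v)⟩, [label ω v]⟩) v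
        (fun _ => initLog t (label ω v)) := by
  unfold wakeUp
  rw [h]
  rfl

/-- What the node `w`, in the state `x`, adds to its log when the message `f` arrives. -/
noncomputable def arrivalNews (ω : (gossip T t τ).Coins V) (w : V) (x : (gossip T t τ).Node)
    (f : Rumor T) : List (Rumor T) :=
  open Classical in
  if Open (GossipState.log x.state) then news t τ (GossipState.me x.state)
    (GossipState.log x.state) f (block ω w x.flips.length) else []

theorem accept_of_open {u w : V} {x : (gossip T t τ).Node} {f : Rumor T} (h : c.node w = some x)
    (hx : Open (GossipState.log x.state)) :
    accept G port ω c u w f = emit G port (setNode c w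
      ⟨x.ident, ⟨GossipState.me x.state, GossipState.log x.state ++ arrivalNews ω w x f⟩,
        x.flips ++ [block ω w x.flips.length]⟩) w (fun _ => arrivalNews ω w x f) := by
  have h' : ¬ ((gossip T t τ).output x.state).isSome = true := by
    exact fun h => (isSome_output _).1 h hx
  unfold accept
  rw [h]
  simp only [if_neg h', arrivalNews, if_pos hx]
  rfl

theorem accept_of_not_open {u w : V} {x : (gossip T t τ).Node} {f : Rumor T}
    (h : c.node w = some x) (hx : ¬ Open (GossipState.log x.state)) :
    accept G port ω c u w f = c := by
  have h' : ((gossip T t τ).output x.state).isSome = true := (isSome_output _).2 hx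
  unfold accept
  rw [h]
  simp only [if_pos h']

/-- Waking up `w` affects only queues leaving `w`, so it commutes with removing the message from the
queue from `u` to `w`. A delivery thus becomes a wake-up followed by a reception at an awake node.
-/
theorem arrive_eq {u w : V} {f : Rumor T} {r : List (Rumor T)} (h : c.queue u w = f :: r)
    (huw : u ≠ w) :
    arrive G port ω c u w = accept G port ω (pop (wakeUp G port ω c w) u w r) u w f := by
  have e1 : arrive G port ω c u w = accept G port ω (wakeUp G port ω (pop c u w r) w) u w f := by
    unfold arrive
    rw [h]
    rfl
  rw [e1]
  congr 1
  by_cases hw : c.node w = none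
  · have hw' : (pop c u w r).node w = none := hw
    rw [wakeUp_of_asleep G port hw, wakeUp_of_asleep G port hw']
    unfold emit pop setNode
    dsimp only
    congr 1
    · exact pushQueue_setQueue G huw r _
    · funext a b
      by_cases hab : a = u ∧ b = w
      · simp [hab]
      · simp [setQueue, hab]
  · rw [wakeUp_of_awake G port hw, wakeUp_of_awake G port (c := pop c u w r) hw]

theorem sum_emit {v : V} (e : List (Rumor T)) :
    ∑ w ∈ G.neighborFinset v, ((fun _ : ℕ => e) (port v w)).length = G.degree v * e.length := by
  simp

/-- The effect on the network of a node `v` adding `e` to its log and sending it, with `c.queue`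
replaced by `Q` in advance. -/
structure Effect (c c' : (gossip T t τ).Config V) (v : V) (e : List (Rumor T))
    (Q : V → V → List (Rumor T)) : Prop where
  now : c'.now = c.now
  logs : logs c' = pushLog (logs c) v e
  queue : c'.queue = Q
  since : ∀ a b, c'.since a b = c.since a b ∨ c'.since a b = c.now
  sent : c'.sent = c.sent + G.degree v * e.length
  node_ne : ∀ a, a ≠ v → c'.node a = c.node a

theorem effect_wakeUp {v : V} (h : c.node v = none) :
    Effect G c (wakeUp G port ω c v) v (initLog t (label ω v))
      (pushQueue G c.queue v (initLog t (label ω v))) ∧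
    (wakeUp G port ω c v).node v =
      some ⟨label ω v, ⟨label ω v, initLog t (label ω v)⟩, [label ω v]⟩ ∧
    ∀ a b, c.queue a b ≠ [] → (wakeUp G port ω c v).since a b = c.since a b := by
  rw [wakeUp_of_asleep G port h]
  refine ⟨⟨rfl, ?_, rfl, ?_, ?_, ?_⟩, ?_, ?_⟩
  · funext a
    by_cases ha : a = v
    · subst ha; simp [logs, emit, setNode, pushLog, h]
    · simp [logs, emit, setNode, pushLog, ha]
  · intro a b
    by_cases hq : c.queue a b = []
    · right; simp [emit, setNode, hq]
    · left; simp [emit, setNode, hq]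
  · unfold emit
    dsimp only
    rw [sum_emit G port]
    rfl
  · intro a ha; simp [emit, setNode, ha]
  · simp [emit, setNode]
  · intro a b hq; simp [emit, setNode, hq]

/-- A terminated receiver is covered by the same description with empty news; only an open one
consumes a block of coins. -/
theorem effect_accept {u w : V} {x : (gossip T t τ).Node} {f : Rumor T} {r : List (Rumor T)}
    (h : c.node w = some x) (huw : u ≠ w) :
    Effect G c (accept G port ω (pop c u w r) u w f) w (arrivalNews ω w x f)
      (setQueue (pushQueue G c.queue w (arrivalNews ω w x f)) u w r) ∧
    (∃ l, (accept G port ω (pop c u w r) u w f).node w = some ⟨x.ident,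
      ⟨GossipState.me x.state, GossipState.log x.state ++ arrivalNews ω w x f⟩, l⟩ ∧
      x.flips.length ≤ l.length ∧ l.length ≤ x.flips.length + 1 ∧
      (Open (GossipState.log x.state) → l.length = x.flips.length + 1)) ∧
    (∀ a b, ¬ (a = u ∧ b = w) → c.queue a b ≠ [] →
      (accept G port ω (pop c u w r) u w f).since a b = c.since a b) ∧
    (accept G port ω (pop c u w r) u w f).since u w = c.now := by
  have h' : (pop c u w r).node w = some x := h
  by_cases hx : Open (GossipState.log x.state)
  · rw [accept_of_open G port h' hx]
    refine ⟨⟨rfl, ?_, ?_, ?_, ?_, ?_⟩, ⟨_, by simp only [emit, setNode, Function.update_self]; rfl,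
      by simp, by simp, by simp⟩, ?_, ?_⟩
    · funext a
      by_cases ha : a = w
      · subst ha; simp [logs, emit, setNode, pushLog, h]
      · simp [logs, emit, setNode, pushLog, ha, pop]
    · exact pushQueue_setQueue G huw r _
    · intro a b
      by_cases h1 : setQueue c.queue u w r a b = []
      · right; exact if_pos h1
      · refine Or.imp (fun h => (if_neg h1).trans h) (fun h => (if_neg h1).trans h) ?_
        by_cases h2 : a = u ∧ b = w
        · right; exact if_pos h2
        · left; exact if_neg h2
    · unfold emit
      dsimp only
      rw [sum_emit G port]
      rfl
    · intro a ha; simp [emit, setNode, ha, pop]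
    · intro a b hab hq
      simp [emit, setNode, pop, setQueue, hab, hq]
    · simp [emit, setNode, pop]
  · rw [accept_of_not_open G port h' hx]
    have he : arrivalNews ω w x f = [] := by simp [arrivalNews, hx]
    rw [he]
    refine ⟨⟨rfl, ?_, ?_, ?_, ?_, ?_⟩, ⟨x.flips, ?_, le_rfl, by simp, fun h => absurd h hx⟩, ?_, ?_⟩
    · rw [pushLog_nil]; rfl
    · rw [pushQueue_nil (G := G) (Q := c.queue)]; rfl
    · intro a b
      simp only [pop]
      split_ifs <;> simp
    · simp [pop]
    · intro a ha; rfl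
    · rw [h', List.append_nil]
    · intro a b hab hq
      simp [pop, hab]
    · simp [pop]

end Gossip

/-! ### Invariants and monotonicity of executions. -/

namespace Gossip

open Protocol

variable {V : Type} {T t τ : ℕ} [Fintype V] [DecidableEq V] (G : SimpleGraph V)
  [DecidableRel G.Adj] (port : V → V → ℕ)
  {ω : (gossip T t τ).Coins V} {c c' : (gossip T t τ).Config V}

/-- What holds in all configurations of an execution with the coins `ω`. -/
structure Valid (ω : (gossip T t τ).Coins V) (c : (gossip T t τ).Config V) : Prop where
  node : ∀ v x, c.node v = some x → x.ident = label ω v ∧ GossipState.me x.state = label ω v ∧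
    1 ≤ x.flips.length ∧ Rumor.hello ∈ GossipState.log x.state
  sound : Sound (label ω) t τ (logs c)
  fifo : Fifo G (logs c) c.queue
  settled : ∀ v, Settled τ (label ω v) (logs c v)
  since_le : ∀ a b, c.since a b ≤ c.now
  sent_eq : c.sent = ∑ v, G.degree v * (logs c v).length

/-- The number of messages from `a` to `b` that have been delivered. -/
def gone (c : (gossip T t τ).Config V) (a b : V) : ℝ :=
  (logs c a).length - (c.queue a b).length

/-- How a configuration `c` develops into a later one. -/
structure Advance (c c' : (gossip T t τ).Config V) : Prop where
  log : ∀ v, logs c v <+: logs c' v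
  now : c.now ≤ c'.now
  awake : ∀ v, c.node v ≠ none → c'.node v ≠ none
  flips : ∀ v, flipCount c v ≤ flipCount c' v
  gone : ∀ a b, G.Adj a b → gone c a b ≤ gone c' a b
  delay : ∀ a b, c.queue a b ≠ [] → c'.queue a b ≠ [] →
    c'.since a b - Gossip.gone c' a b ≤ c.since a b - Gossip.gone c a b

variable {G}

theorem logs_of_some {v : V} {x : (gossip T t τ).Node} (h : c.node v = some x) :
    logs c v = GossipState.log x.state := by
  simp [logs, h]

theorem logs_of_none {v : V} (h : c.node v = none) : logs c v = [] := by
  simp [logs, h]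

theorem flipCount_of_some {v : V} {x : (gossip T t τ).Node} (h : c.node v = some x) :
    flipCount c v = x.flips.length := by
  simp [flipCount, h]

theorem flipCount_of_none {v : V} (h : c.node v = none) : flipCount c v = 0 := by
  simp [flipCount, h]

theorem flipCount_congr {v : V} (h : c.node v = c'.node v) : flipCount c v = flipCount c' v := by
  simp [flipCount, h]

theorem Advance.refl (c : (gossip T t τ).Config V) : Advance G c c :=
  ⟨fun _ => List.prefix_refl _, le_rfl, fun _ => id, fun _ => le_rfl, fun _ _ _ => le_rfl,
    fun _ _ _ _ => le_rfl⟩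

theorem sum_degree_pushLog (L : V → List (Rumor T)) (w : V) (e : List (Rumor T)) :
    ∑ v, G.degree v * (pushLog L w e v).length =
      ∑ v, G.degree v * (L v).length + G.degree w * e.length := by
  rw [← Finset.add_sum_erase _ _ (Finset.mem_univ w),
    ← Finset.add_sum_erase _ (fun v => G.degree v * (L v).length) (Finset.mem_univ w)]
  have : ∀ v ∈ Finset.univ.erase w, G.degree v * (pushLog L w e v).length =
      G.degree v * (L v).length := by
    intro v hv
    rw [pushLog_of_ne (Finset.ne_of_mem_erase hv)]
  rw [Finset.sum_congr rfl this, pushLog_self, List.length_append]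
  ring

theorem prefix_pushLog (L : V → List (Rumor T)) (w : V) (e : List (Rumor T)) (v : V) :
    L v <+: pushLog L w e v := by
  by_cases h : v = w
  · subst h; rw [pushLog_self]; exact List.prefix_append _ _
  · rw [pushLog_of_ne h]

theorem length_push (L : V → List (Rumor T)) (Q : V → V → List (Rumor T)) (w : V)
    (e : List (Rumor T)) {a b : V} (h : G.Adj a b) :
    ((pushLog L w e a).length : ℝ) - (pushQueue G Q w e a b).length =
      (L a).length - (Q a b).length := by
  by_cases ha : a = w
  · subst ha
    simp [pushLog_self, pushQueue, h]
  · simp [pushLog_of_ne ha, pushQueue, ha]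

theorem Valid.asleep (I : Valid G ω c) {v : V} (h : c.node v ≠ none) : Rumor.hello ∈ logs c v := by
  obtain ⟨x, hx⟩ := Option.ne_none_iff_exists'.1 h
  rw [logs_of_some hx]
  exact (I.node v x hx).2.2.2

theorem Valid.awake_of_mem {v : V} {f : Rumor T} (h : f ∈ logs c v) : c.node v ≠ none := by
  intro h'
  simp [logs_of_none h'] at h

/-! ### Letting time pass -/

theorem Valid.tick (I : Valid G ω c) {s : ℝ} (hs : c.now ≤ s) :
    Valid G ω { c with now := s } ∧ Advance G c { c with now := s } :=
  ⟨⟨I.node, I.sound, I.fifo, I.settled, fun a b => (I.since_le a b).trans hs, I.sent_eq⟩,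
    ⟨fun _ => List.prefix_refl _, hs, fun _ => id, fun _ => le_rfl, fun _ _ _ => le_rfl,
      fun _ _ _ _ => le_rfl⟩⟩

/-! ### Waking up -/

theorem valid_of_effect {v : V} {e : List (Rumor T)} {Q : V → V → List (Rumor T)}
    (E : Effect G c c' v e Q) (I : Valid G ω c)
    (hnode : ∀ x, c'.node v = some x → x.ident = label ω v ∧ GossipState.me x.state = label ω v ∧
      1 ≤ x.flips.length ∧ Rumor.hello ∈ GossipState.log x.state)
    (hsound : Sound (label ω) t τ (pushLog (logs c) v e)) (hfifo : Fifo G (pushLog (logs c) v e) Q)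
    (hset : Settled τ (label ω v) (logs c v ++ e)) : Valid G ω c' := by
  refine ⟨fun a x hx => ?_, ?_, ?_, fun a => ?_, fun a b => ?_, ?_⟩
  · by_cases ha : a = v
    · subst ha; exact hnode x hx
    · rw [E.node_ne a ha] at hx; exact I.node a x hx
  · rw [E.logs]; exact hsound
  · rw [E.logs, E.queue]; exact hfifo
  · rw [E.logs]
    by_cases ha : a = v
    · subst ha; rw [pushLog_self]; exact hset
    · rw [pushLog_of_ne ha]; exact I.settled a
  · rw [E.now]
    rcases E.since a b with h | h
    · rw [h]; exact I.since_le a b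
    · rw [h]
  · rw [E.sent, I.sent_eq, E.logs, sum_degree_pushLog]

theorem Valid.wakeUp (I : Valid G ω c) (hlab : Function.Injective (label ω)) (hτ : 1 ≤ τ) {v : V}
    (h : c.node v = none) :
    Valid G ω (wakeUp G port ω c v) ∧ Advance G c (wakeUp G port ω c v) := by
  obtain ⟨E, hn, hs⟩ := effect_wakeUp G port (ω := ω) h
  have hl := logs_of_none h
  refine ⟨valid_of_effect E I ?_ (I.sound.init hlab hl) (I.fifo.push _ _) ?_, ?_, E.now.ge, ?_, ?_, ?_, ?_⟩
  · intro x hx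
    rw [hn] at hx
    obtain rfl := Option.some.inj hx
    exact ⟨rfl, rfl, by simp, by simp [initLog]⟩
  · rw [hl, List.nil_append]; exact settled_initLog hτ _
  · intro a; rw [E.logs]; exact prefix_pushLog _ _ _ _
  · intro a ha
    by_cases hav : a = v
    · subst hav; exact absurd h ha
    · rw [E.node_ne a hav]; exact ha
  · intro a
    by_cases hav : a = v
    · subst hav; rw [flipCount_of_none h]; exact Nat.zero_le _
    · rw [flipCount_congr (E.node_ne a hav)]
  · intro a b hab
    unfold Gossip.gone
    rw [E.logs, E.queue, length_push _ _ _ _ hab]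
  · intro a b hq _
    have hab := I.fifo.adj hq
    unfold Gossip.gone
    rw [E.logs, E.queue, length_push _ _ _ _ hab, hs a b hq]

/-! ### Receiving a message -/

theorem arrivalNews_eq (I : Valid G ω c) {w : V} {x : (gossip T t τ).Node} (h : c.node w = some x)
    (ho : Open (logs c w)) (f : Rumor T) :
    arrivalNews ω w x f =
      news t τ (label ω w) (logs c w) f (block ω w (flipCount c w)) := by
  rw [logs_of_some h] at ho ⊢
  rw [arrivalNews, if_pos ho, (I.node w x h).2.1, flipCount_of_some h]

theorem arrivalNews_eq_nil {w : V} {x : (gossip T t τ).Node} (h : c.node w = some x)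
    (ho : ¬ Open (logs c w)) (f : Rumor T) : arrivalNews ω w x f = [] := by
  rw [logs_of_some h] at ho
  rw [arrivalNews, if_neg ho]

/-- The timing assumption is used for `Advance.delay`: the deadline of the current transmission
limits how far `since` can move in one delivery. -/
theorem Valid.accept (I : Valid G ω c) (hlab : Function.Injective (label ω)) {u w : V}
    {x : (gossip T t τ).Node} {f : Rumor T} {r : List (Rumor T)} (h : c.node w = some x)
    (hq : c.queue u w = f :: r) (hnow : c.now ≤ c.since u w + 1) :
    Valid G ω (accept G port ω (pop c u w r) u w f) ∧
      Advance G c (accept G port ω (pop c u w r) u w f) ∧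
      Gossip.gone (accept G port ω (pop c u w r) u w f) u w = Gossip.gone c u w + 1 := by
  have hadj : G.Adj u w := I.fifo.adj (by simp [hq])
  have huw := hadj.ne
  obtain ⟨E, ⟨l, hn, hl1, hl2, -⟩, hs, hs'⟩ := effect_accept G port (ω := ω) (f := f) (r := r) h huw
  have hr := I.fifo.relay hq
  have hlog := logs_of_some h
  have hq' : pushQueue G c.queue w (arrivalNews ω w x f) u w = f :: r := by
    simp [pushQueue, huw, hq]
  have hsound : Sound (label ω) t τ (pushLog (logs c) w (arrivalNews ω w x f)) := by
    by_cases ho : Open (logs c w)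
    · rw [arrivalNews_eq I h ho]
      by_cases hf : f ∈ logs c w
      · rw [news_of_mem hf, pushLog_nil]; exact I.sound
      · rw [news_of_notMem hf]
        exact I.sound.learn hlab _ (I.asleep (by simp [h])) hr.1 (hr.2 ho) hf ho
    · rw [arrivalNews_eq_nil h ho, pushLog_nil]; exact I.sound
  have hset : Settled τ (label ω w) (logs c w ++ arrivalNews ω w x f) := by
    by_cases ho : Open (logs c w)
    · rw [arrivalNews_eq I h ho]
      by_cases hf : f ∈ logs c w
      · rw [news_of_mem hf, List.append_nil]; exact I.settled w
      · rw [news_of_notMem hf]; exact settled_learn _ _ _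
    · rw [arrivalNews_eq_nil h ho, List.append_nil]; exact I.settled w
  have hfifo : Fifo G (pushLog (logs c) w (arrivalNews ω w x f))
      (setQueue (pushQueue G c.queue w (arrivalNews ω w x f)) u w r) := by
    refine (I.fifo.push w _).pop hq' fun ho => ?_
    have ho' : Open (logs c w) := fun y hy => ho y (mem_pushLog.2 (Or.inl hy))
    rw [arrivalNews_eq I h ho', pushLog_self]
    by_cases hf : f ∈ logs c w
    · simp [hf]
    · rw [news_of_notMem hf]; simp [learnNews]
  have hlen : (r.length : ℝ) + 1 = (c.queue u w).length := by rw [hq]; simp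
  have hgone : Gossip.gone (Protocol.accept G port ω (pop c u w r) u w f) u w =
      Gossip.gone c u w + 1 := by
    unfold Gossip.gone
    rw [E.logs, E.queue, pushLog_of_ne huw, ← hlen]
    simp only [setQueue, and_self, if_true]
    ring
  have hgone' : ∀ a b, G.Adj a b → ¬ (a = u ∧ b = w) →
      Gossip.gone (Protocol.accept G port ω (pop c u w r) u w f) a b = Gossip.gone c a b := by
    intro a b hab hne
    unfold Gossip.gone
    rw [E.logs, E.queue]
    simp only [setQueue, if_neg hne]
    exact length_push _ _ _ _ hab
  refine ⟨valid_of_effect E I ?_ hsound hfifo hset, ⟨?_, E.now.ge, ?_, ?_, ?_, ?_⟩, hgone⟩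
  · intro y hy
    rw [hn] at hy
    obtain rfl := Option.some.inj hy
    obtain ⟨h1, h2, h3, h4⟩ := I.node w x h
    exact ⟨h1, h2, h3.trans hl1, List.mem_append_left _ h4⟩
  · intro a; rw [E.logs]; exact prefix_pushLog _ _ _ _
  · intro a ha
    by_cases haw : a = w
    · subst haw; rw [hn]; simp
    · rw [E.node_ne a haw]; exact ha
  · intro a
    by_cases haw : a = w
    · subst haw; rw [flipCount_of_some h, flipCount_of_some hn]; exact hl1
    · rw [flipCount_congr (E.node_ne a haw)]
  · intro a b hab
    by_cases hne : a = u ∧ b = w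
    · obtain ⟨rfl, rfl⟩ := hne; rw [hgone]; linarith
    · rw [hgone' a b hab hne]
  · intro a b hqa _
    by_cases hne : a = u ∧ b = w
    -- The next transmission starts now, at most one unit after the last one started, while `gone`
    -- grows by exactly one.
    · obtain ⟨rfl, rfl⟩ := hne; rw [hgone, hs']; linarith
    · rw [hgone' a b (I.fifo.adj hqa) hne, hs a b hne hqa]

/-! ### One step of the execution -/

/-- The extra premise is needed because delays are compared only across nonempty queues; a queue
that empties and refills would restart its clock. -/
theorem Advance.trans' {c₁ c₂ c₃ : (gossip T t τ).Config V} (A : Advance G c₁ c₂)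
    (B : Advance G c₂ c₃) (h : ∀ a b, c₁.queue a b ≠ [] → c₃.queue a b ≠ [] → c₂.queue a b ≠ []) :
    Advance G c₁ c₃ :=
  ⟨fun v => (A.log v).trans (B.log v), A.now.trans B.now, fun v hv => B.awake v (A.awake v hv),
    fun v => (A.flips v).trans (B.flips v),
    fun a b hab => (A.gone a b hab).trans (B.gone a b hab),
    fun a b h1 h3 => (B.delay a b (h a b h1 h3) h3).trans (A.delay a b h1 (h a b h1 h3))⟩

/-- The number of nodes awake and of messages delivered. -/
noncomputable def progress (G : SimpleGraph V) [DecidableRel G.Adj] (c : (gossip T t τ).Config V) :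
    ℝ :=
  open Classical in
  (Finset.univ.filter fun v => c.node v ≠ none).card +
    ∑ p : V × V, if G.Adj p.1 p.2 then Gossip.gone c p.1 p.2 else 0

theorem Advance.card_awake_le (A : Advance G c c') :
    open Classical in
    (Finset.univ.filter fun v => c.node v ≠ none).card ≤
      (Finset.univ.filter fun v => c'.node v ≠ none).card := by
  classical
  refine Finset.card_le_card fun v hv => ?_
  simp only [Finset.mem_filter, Finset.mem_univ, true_and] at hv ⊢
  exact A.awake v hv

theorem Advance.sum_gone_le (A : Advance G c c') (p : V × V) :
    (if G.Adj p.1 p.2 then Gossip.gone c p.1 p.2 else 0) ≤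
      if G.Adj p.1 p.2 then Gossip.gone c' p.1 p.2 else 0 := by
  split_ifs with h
  · exact A.gone _ _ h
  · exact le_rfl

theorem Advance.progress_of_wake (A : Advance G c c') {v : V} (h : c.node v = none)
    (h' : c'.node v ≠ none) : progress G c + 1 ≤ progress G c' := by
  classical
  have h1 := Finset.sum_le_sum fun p (_ : p ∈ Finset.univ) => A.sum_gone_le p
  have h2 : (Finset.univ.filter fun v => c.node v ≠ none).card + 1 ≤
      (Finset.univ.filter fun v => c'.node v ≠ none).card := by
    rw [← Finset.card_insert_of_notMem (a := v) (by simp [h])]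
    refine Finset.card_le_card fun a ha => ?_
    simp only [Finset.mem_insert, Finset.mem_filter, Finset.mem_univ, true_and] at ha ⊢
    rcases ha with rfl | ha
    · exact h'
    · exact A.awake a ha
  have h3 : ((Finset.univ.filter fun v => c.node v ≠ none).card : ℝ) + 1 ≤
      (Finset.univ.filter fun v => c'.node v ≠ none).card := by exact_mod_cast h2
  unfold progress
  linarith

theorem Advance.progress_of_gone (A : Advance G c c') {u w : V} (hadj : G.Adj u w)
    (h : Gossip.gone c u w + 1 ≤ Gossip.gone c' u w) : progress G c + 1 ≤ progress G c' := by
  classical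
  have h1 : (∑ p : V × V, if G.Adj p.1 p.2 then Gossip.gone c p.1 p.2 else 0) + 1 ≤
      ∑ p : V × V, if G.Adj p.1 p.2 then Gossip.gone c' p.1 p.2 else 0 := by
    rw [← Finset.add_sum_erase _ _ (Finset.mem_univ (u, w)),
      ← Finset.add_sum_erase Finset.univ (fun p : V × V => if G.Adj p.1 p.2 then
        Gossip.gone c' p.1 p.2 else 0) (Finset.mem_univ (u, w))]
    have h2 := Finset.sum_le_sum fun p (_ : p ∈ Finset.univ.erase (u, w)) => A.sum_gone_le p
    simp only [if_pos hadj]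
    linarith
  have h3 : ((Finset.univ.filter fun v => c.node v ≠ none).card : ℝ) ≤
      (Finset.univ.filter fun v => c'.node v ≠ none).card := by exact_mod_cast A.card_awake_le
  unfold progress
  linarith

/-- Besides preserving the invariants, each action increases `progress`, and the clock stays within
one unit of every current transmission start. The first gives termination, the second the time
bound. -/
theorem Valid.step (I : Valid G ω c) (hlab : Function.Injective (label ω)) (hτ : 1 ≤ τ)
    {act : Option (ℝ × Action V)} (h : Allowed c act) :
    Valid G ω (step G port ω c act) ∧ Advance G c (step G port ω c act) ∧
      (act ≠ none → progress G c + 1 ≤ progress G (step G port ω c act)) ∧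
      ∀ a b, c.queue a b ≠ [] → (step G port ω c act).now ≤ c.since a b + 1 := by
  obtain _ | ⟨s, v | ⟨u, w⟩⟩ := act
  · exact ⟨I, Advance.refl c, fun h => absurd rfl h, fun a b hab => absurd (h.2 a b) hab⟩
  · obtain ⟨h1, -, h3, h4⟩ := h
    obtain ⟨J, A⟩ := I.tick h1
    have h4' : ({ c with now := s } : (gossip T t τ).Config V).node v = none := h4
    obtain ⟨J', B⟩ := J.wakeUp port hlab hτ h4'
    have C := A.trans' B fun a b h _ => h
    obtain ⟨E, hn, -⟩ := effect_wakeUp G port (ω := ω) h4'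
    refine ⟨J', C, fun _ => C.progress_of_wake h4 ?_, fun a b hab => ?_⟩
    · simp [hn]
    · simp only [Protocol.step]
      rw [E.now]
      exact h3 a b hab
  · obtain ⟨h1, -, h3, h4⟩ := h
    obtain ⟨J, A⟩ := I.tick h1
    obtain ⟨f, r, hq⟩ := List.exists_cons_of_ne_nil h4
    have hadj : G.Adj u w := I.fifo.adj h4
    have harr := arrive_eq (c := { c with now := s }) G port (ω := ω) hq hadj.ne
    have key : ∃ c₁ : (gossip T t τ).Config V, c₁ = Protocol.wakeUp G port ω { c with now := s } w ∧
        Valid G ω c₁ ∧ Advance G c c₁ ∧ c₁.node w ≠ none ∧ c₁.queue u w = f :: r ∧ c₁.now = s ∧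
        c₁.since u w = c.since u w ∧ ∀ a b, c.queue a b ≠ [] → c₁.queue a b ≠ [] := by
      refine ⟨_, rfl, ?_⟩
      by_cases hw : c.node w = none
      · have hw' : ({ c with now := s } : (gossip T t τ).Config V).node w = none := hw
        obtain ⟨J', B⟩ := J.wakeUp port hlab hτ hw'
        obtain ⟨E, hn, hs⟩ := effect_wakeUp G port (ω := ω) hw'
        refine ⟨J', A.trans' B fun a b h _ => h, by simp [hn], ?_, E.now, hs u w h4, ?_⟩
        · rw [E.queue]
          simp [pushQueue, hadj.ne, hq]
        · intro a b hab
          rw [E.queue]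
          unfold pushQueue
          split_ifs
          · simp [hab]
          · exact hab
      · rw [wakeUp_of_awake (c := { c with now := s }) G port hw]
        exact ⟨J, A, hw, hq, rfl, rfl, fun a b h => h⟩
    obtain ⟨c₁, hc₁, J', B, hn, hq₁, hnow, hsince, hne⟩ := key
    obtain ⟨x, hx⟩ := Option.ne_none_iff_exists'.1 hn
    obtain ⟨J'', C, hg⟩ := J'.accept port hlab hx hq₁ (by rw [hnow, hsince]; exact h3 u w h4)
    have heq : Protocol.step G port ω c (some (s, .deliver u w)) =
        Protocol.accept G port ω (pop c₁ u w r) u w f := by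
      rw [hc₁, ← harr]; rfl
    have D := B.trans' C fun a b h _ => hne a b h
    rw [heq]
    refine ⟨J'', D, fun _ => D.progress_of_gone hadj ?_, fun a b hab => ?_⟩
    · have := B.gone u w hadj
      rw [hg]; linarith
    · rw [(effect_accept G port (ω := ω) (f := f) (r := r) hx hadj.ne).1.now, hnow]
      exact h3 a b hab

theorem valid_start (ω : (gossip T t τ).Coins V) : Valid G ω ((gossip T t τ).start V) := by
  have hl : ∀ v, logs ((gossip T t τ).start V) v = [] := fun v => rfl
  have hL : logs ((gossip T t τ).start V) = fun _ => [] := rfl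
  refine ⟨fun v x h => by simp [start] at h, ?_, ?_, fun v => ?_, fun _ _ => le_rfl, ?_⟩
  · rw [hL]
    constructor <;> simp
  · rw [hL]
    exact fun u w => ⟨fun _ => rfl, fun _ => ⟨[], rfl, by simp⟩⟩
  · rw [hl]
    exact ⟨fun h => by simp [DoneRule] at h, fun h => by simp [ElectRule] at h⟩
  · rw [hL]; simp [start]

end Gossip

/-! ### Propagation of rumors and its speed. -/

namespace Gossip

open Protocol

variable {V : Type} {T t τ : ℕ} [Fintype V] [DecidableEq V] {G : SimpleGraph V}
  [DecidableRel G.Adj] {port : V → V → ℕ}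
  {ω : (gossip T t τ).Coins V} {adv : Adversary (gossip T t τ) V}

section

variable (hadv : adv.IsLegal G port) (hlab : Function.Injective (label ω)) (hτ : 1 ≤ τ)
include hadv hlab hτ

theorem valid_config (k : ℕ) : Valid G ω (config G port adv ω k) := by
  induction k with
  | zero => exact valid_start ω
  | succ k ih => exact (ih.step port hlab hτ (hadv ω k)).1

theorem advance_config (k : ℕ) :
    Advance G (config G port adv ω k) (config G port adv ω (k + 1)) :=
  ((valid_config hadv hlab hτ k).step port hlab hτ (hadv ω k)).2.1

theorem stable_config {X : (gossip T t τ).Config V → Prop}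
    (hX : ∀ c c', Advance G c c' → X c → X c') {j k : ℕ} (hjk : j ≤ k)
    (h : X (config G port adv ω j)) : X (config G port adv ω k) := by
  induction k, hjk using Nat.le_induction with
  | base => exact h
  | succ k _ ih => exact hX _ _ (advance_config hadv hlab hτ k) ih

theorem gone_nonneg (k : ℕ) {a b : V} (hab : G.Adj a b) :
    0 ≤ gone (config G port adv ω k) a b := by
  obtain ⟨p, h, -⟩ := ((valid_config hadv hlab hτ k).fifo a b).2 hab
  unfold gone
  rw [h, List.length_append]
  push_cast
  linarith [(Nat.cast_nonneg p.length : (0 : ℝ) ≤ _)]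

variable {B : ℕ} (hB : ∀ k v, (logs (config G port adv ω k) v).length ≤ B)
include hB

/-- Again and again, no message is waiting. -/
theorem exists_idle (j : ℕ) : ∃ k, j ≤ k ∧ ∀ a b, (config G port adv ω k).queue a b = [] := by
  classical
  by_contra hcon
  push Not at hcon
  have hact : ∀ k, j ≤ k → adv (trace G port adv ω k).1 (trace G port adv ω k).2 ≠ none := by
    intro k hk h
    obtain ⟨a, b, hab⟩ := hcon k hk
    have := hadv ω k
    rw [h] at this
    exact hab (this.2 a b)
  -- With a message always waiting the adversary must act at every step. Each action raises
  -- `progress` by at least one, but bounded logs bound the number of deliveries.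
  have hgrow : ∀ i : ℕ, (i : ℝ) ≤ progress G (config G port adv ω (j + i)) := by
    intro i
    induction i with
    | zero =>
      unfold progress
      have : ∀ p ∈ (Finset.univ : Finset (V × V)), 0 ≤ (if G.Adj p.1 p.2 then
          gone (config G port adv ω (j + 0)) p.1 p.2 else 0) := by
        intro p _
        split_ifs with h
        · exact gone_nonneg hadv hlab hτ _ h
        · exact le_rfl
      have := Finset.sum_nonneg this
      rw [Nat.cast_zero]
      positivity
    | succ i ih =>
      have h1 := ((valid_config hadv hlab hτ (j + i)).step port hlab hτ (hadv ω (j + i))).2.2.1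
        (hact _ (Nat.le_add_right j i))
      push_cast
      exact (add_le_add_left ih 1).trans h1
  have hbound : ∀ k, progress G (config G port adv ω k) ≤
      Fintype.card V + ∑ _p : V × V, (B : ℝ) := by
    intro k
    refine add_le_add (by exact_mod_cast Finset.card_le_univ _) (Finset.sum_le_sum fun p _ => ?_)
    split_ifs
    · unfold gone
      have h1 : ((logs (config G port adv ω k) p.1).length : ℝ) ≤ B := by exact_mod_cast hB k p.1
      have h2 : (0 : ℝ) ≤ ((config G port adv ω k).queue p.1 p.2).length := Nat.cast_nonneg _
      linarith
    · positivity
  obtain ⟨i, hi⟩ := exists_nat_gt ((Fintype.card V : ℝ) + ∑ _p : V × V, (B : ℝ))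
  exact absurd ((hgrow i).trans (hbound _)) (not_le.2 hi)

/-- A rumor crosses an edge, or the node at the other end has terminated, within time `B`. -/
theorem spread_edge {u w : V} (hadj : G.Adj u w) {f : Rumor T} {j : ℕ}
    (hf : f ∈ logs (config G port adv ω j) u) :
    ∃ k, (config G port adv ω k).now ≤ (config G port adv ω j).now + B ∧
      (f ∈ logs (config G port adv ω k) w ∨ ¬ Open (logs (config G port adv ω k) w)) := by
  classical
  have hfk : ∀ k, j ≤ k → f ∈ logs (config G port adv ω k) u := fun k hk =>
    stable_config (X := fun c => f ∈ logs c u) hadv hlab hτ (fun _ _ A h => (A.log u).subset h) hk hf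
  have hqueue : ∀ k, j ≤ k → ¬ (f ∈ logs (config G port adv ω k) w ∨
      ¬ Open (logs (config G port adv ω k) w)) → (config G port adv ω k).queue u w ≠ [] := by
    intro k hk hn hq
    push Not at hn
    obtain ⟨p, h1, h2⟩ := ((valid_config hadv hlab hτ k).fifo u w).2 hadj
    rw [hq, List.append_nil] at h1
    exact hn.1 (h2 hn.2 f (h1 ▸ hfk k hk))
  have hex : ∃ k, j ≤ k ∧ (f ∈ logs (config G port adv ω k) w ∨
      ¬ Open (logs (config G port adv ω k) w)) := by
    obtain ⟨k, hk, hq⟩ := exists_idle hadv hlab hτ hB j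
    exact ⟨k, hk, by_contra fun h => hqueue k hk h (hq u w)⟩
  obtain ⟨hk1, hk2⟩ := Nat.find_spec hex
  have hmin := fun i => Nat.find_min (H := hex) (m := i)
  generalize Nat.find hex = k₀ at hk1 hk2 hmin
  refine ⟨k₀, ?_, hk2⟩
  rcases hk1.eq_or_lt with rfl | hlt
  · linarith [(Nat.cast_nonneg B : (0 : ℝ) ≤ B)]
  obtain ⟨k, rfl⟩ : ∃ k, k₀ = k + 1 := ⟨k₀ - 1, by omega⟩
  have hq : ∀ i, j ≤ i → i ≤ k → (config G port adv ω i).queue u w ≠ [] := fun i hi hik =>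
    hqueue i hi fun h => hmin i (by omega) ⟨hi, h⟩
  -- While the queue is nonempty, `since - gone` does not increase: each delivery costs at most one
  -- time unit. At step `j` it is at most the current time, as `gone` is nonnegative.
  have hdelay : ∀ i, j ≤ i → i ≤ k → (config G port adv ω i).since u w -
      gone (config G port adv ω i) u w ≤ (config G port adv ω j).now := by
    intro i hi
    induction i, hi using Nat.le_induction with
    | base =>
      intro _
      have h1 := (valid_config hadv hlab hτ j).since_le u w
      have h2 := gone_nonneg hadv hlab hτ j hadj
      linarith
    | succ i hi ih =>
      intro hik
      exact ((advance_config hadv hlab hτ i).delay u w (hq i hi (by omega))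
        (hq (i + 1) (by omega) hik)).trans (ih (by omega))
  have hjk : j ≤ k := by omega
  have h1 := hdelay k hjk le_rfl
  have h2 := ((valid_config hadv hlab hτ k).step port hlab hτ (hadv ω k)).2.2.2 u w
    (hq k hjk le_rfl)
  -- At least one message is still waiting, so at most `B - 1` have been delivered; the last unit of
  -- the bound pays for the one being transmitted.
  have h3 : (1 : ℝ) ≤ ((config G port adv ω k).queue u w).length := by
    exact_mod_cast List.length_pos_iff.2 (hq k hjk le_rfl)
  have h4 : ((logs (config G port adv ω k) u).length : ℝ) ≤ B := by exact_mod_cast hB k u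
  have h5 : (config G port adv ω (k + 1)).now ≤ (config G port adv ω k).since u w + 1 := h2
  unfold gone at h1
  linarith

end

/-- The configuration has the property `X` at time `s` at the latest. -/
def By (G : SimpleGraph V) [DecidableRel G.Adj] (port : V → V → ℕ)
    (adv : Adversary (gossip T t τ) V) (ω : (gossip T t τ).Coins V)
    (X : (gossip T t τ).Config V → Prop) (s : ℝ) : Prop :=
  ∃ k, X (config G port adv ω k) ∧ (config G port adv ω k).now ≤ s

/-- Some node has terminated. -/
def Closed (c : (gossip T t τ).Config V) : Prop := ∃ v, ¬ Open (logs c v)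

theorem By.mono {X Y : (gossip T t τ).Config V → Prop} {s s' : ℝ} (h : By G port adv ω X s)
    (hs : s ≤ s') (hXY : ∀ k, X (config G port adv ω k) → Y (config G port adv ω k)) :
    By G port adv ω Y s' := by
  obtain ⟨k, h1, h2⟩ := h
  exact ⟨k, hXY k h1, h2.trans hs⟩

theorem not_open_of_advance {c c' : (gossip T t τ).Config V} (A : Advance G c c') {v : V}
    (h : ¬ Open (logs c v)) : ¬ Open (logs c' v) :=
  fun h' => h fun x hx => h' x ((A.log v).subset hx)

theorem Closed.advance {c c' : (gossip T t τ).Config V} (A : Advance G c c') (h : Closed c) :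
    Closed c' := by
  obtain ⟨v, hv⟩ := h
  exact ⟨v, not_open_of_advance A hv⟩

section

variable (hadv : adv.IsLegal G port) (hlab : Function.Injective (label ω)) (hτ : 1 ≤ τ)
include hadv hlab hτ

/-- The latest of finitely many steps serves for all: stable properties persist until then, and that
step itself meets the time bound. -/
theorem by_forall {ι : Type*} [Finite ι] {X : ι → (gossip T t τ).Config V → Prop} {s : ℝ}
    (hs : 0 ≤ s) (hX : ∀ i c c', Advance G c c' → X i c → X i c')
    (h : ∀ i, By G port adv ω (X i) s) : By G port adv ω (fun c => ∀ i, X i c) s := by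
  classical
  cases nonempty_fintype ι
  choose k h1 h2 using h
  rcases isEmpty_or_nonempty ι with hι | hι
  · exact ⟨0, fun i => isEmptyElim i, hs⟩
  · obtain ⟨i, -, hi⟩ := Finset.exists_max_image Finset.univ k Finset.univ_nonempty
    exact ⟨k i, fun j => stable_config hadv hlab hτ (hX j) (hi j (Finset.mem_univ j)) (h1 j), h2 i⟩

theorem by_or_forall {ι : Type*} [Finite ι] {X : ι → (gossip T t τ).Config V → Prop} {s : ℝ}
    (hs : 0 ≤ s) (hX : ∀ i c c', Advance G c c' → X i c → X i c')
    (h : ∀ i, By G port adv ω (fun c => X i c ∨ Closed c) s) :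
    By G port adv ω (fun c => (∀ i, X i c) ∨ Closed c) s := by
  refine (by_forall hadv hlab hτ hs (X := fun i c => X i c ∨ Closed c) ?_ h).mono le_rfl ?_
  · rintro i c c' A (h | h)
    · exact Or.inl (hX i c c' A h)
    · exact Or.inr (h.advance A)
  · intro k h
    by_cases hc : Closed (config G port adv ω k)
    · exact Or.inr hc
    · exact Or.inl fun i => (h i).resolve_right hc

variable {B : ℕ} (hB : ∀ k v, (logs (config G port adv ω k) v).length ≤ B)
include hB

theorem spread_walk {u w : V} (p : G.Walk u w) {f : Rumor T} {s : ℝ}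
    (h : By G port adv ω (fun c => f ∈ logs c u ∨ Closed c) s) :
    By G port adv ω (fun c => f ∈ logs c w ∨ Closed c) (s + B * p.length) := by
  induction p generalizing s with
  | nil => simpa using h
  | @cons u v w hadj p ih =>
    have h' : By G port adv ω (fun c => f ∈ logs c v ∨ Closed c) (s + B) := by
      obtain ⟨j, hj | hj, hjs⟩ := h
      · obtain ⟨k, h1, h2⟩ := spread_edge hadv hlab hτ hB hadj hj
        exact ⟨k, h2.imp id fun h => ⟨v, h⟩, by linarith⟩
      · exact ⟨j, Or.inr hj, by linarith [(Nat.cast_nonneg B : (0 : ℝ) ≤ B)]⟩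
    refine (ih h').mono (le_of_eq ?_) fun _ h => h
    rw [SimpleGraph.Walk.length_cons]
    push_cast
    ring

/-- The election rumor moves along each edge unless the neighbor, having terminated, ignores it, and
then nothing is left to show for that edge. -/
theorem spread_closed_walk {u w : V} (p : G.Walk u w) {s : ℝ}
    (h : By G port adv ω (fun c => ¬ Open (logs c u)) s) :
    By G port adv ω (fun c => ¬ Open (logs c w)) (s + B * p.length) := by
  induction p generalizing s with
  | nil => simpa using h
  | @cons u v w hadj p ih =>
    have h' : By G port adv ω (fun c => ¬ Open (logs c v)) (s + B) := by
      obtain ⟨j, hj, hjs⟩ := h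
      unfold Open at hj
      push Not at hj
      obtain ⟨x, hx⟩ := hj
      obtain ⟨k, h1, h2⟩ := spread_edge hadv hlab hτ hB hadj hx
      refine ⟨k, ?_, by linarith⟩
      rcases h2 with h2 | h2
      · exact fun h => h x h2
      · exact h2
    refine (ih h').mono (le_of_eq ?_) fun _ h => h
    rw [SimpleGraph.Walk.length_cons]
    push_cast
    ring

variable (hG : G.Connected)
include hG

theorem exists_walk_le (u w : V) : ∃ p : G.Walk u w, (B : ℝ) * p.length ≤ B * G.diam := by
  obtain ⟨p, hp⟩ := hG.exists_walk_length_eq_dist u w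
  refine ⟨p, mul_le_mul_of_nonneg_left ?_ (Nat.cast_nonneg B)⟩
  rw [hp]
  have := hG.nonempty
  exact_mod_cast SimpleGraph.dist_le_diam (SimpleGraph.connected_iff_ediam_ne_top.1 hG)

theorem spread (u : V) {f : Rumor T} {s : ℝ}
    (h : By G port adv ω (fun c => f ∈ logs c u ∨ Closed c) s) (w : V) :
    By G port adv ω (fun c => f ∈ logs c w ∨ Closed c) (s + B * G.diam) := by
  obtain ⟨p, hp⟩ := exists_walk_le hadv hlab hτ hB hG u w
  exact (spread_walk hadv hlab hτ hB p h).mono (by linarith) fun _ h => h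

theorem spread_closed {s : ℝ} (h : By G port adv ω Closed s) (w : V) :
    By G port adv ω (fun c => ¬ Open (logs c w)) (s + B * G.diam) := by
  obtain ⟨k, ⟨u, hu⟩, hk⟩ := h
  obtain ⟨p, hp⟩ := exists_walk_le hadv hlab hτ hB hG u w
  exact (spread_closed_walk hadv hlab hτ hB p ⟨k, hu, hk⟩).mono (by linarith) fun _ h => h

end

end Gossip

namespace Gossip

open Protocol

variable {V : Type} {T t τ : ℕ} [Fintype V] [DecidableEq V] {G : SimpleGraph V}
  [DecidableRel G.Adj] {port : V → V → ℕ}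
  {ω : (gossip T t τ).Coins V} {adv : Adversary (gossip T t τ) V}

/-! ### Sizes of logs and numbers of messages -/

theorem lucky_of_cand_mem {c : (gossip T t τ).Config V} (S : Sound (label ω) t τ (logs c)) {v : V}
    {x : Label T} (h : Rumor.cand x ∈ logs c v) : ∃ u, label ω u = x ∧ Lucky t (label ω u) ∧
      Rumor.cand (label ω u) ∈ logs c u := by
  obtain ⟨u, rfl, hu⟩ := S.owned v _ _ h rfl
  exact ⟨u, rfl, S.lucky_of_cand u hu, hu⟩

open Classical in
/-- The nodes that are candidates once they are awake. -/
noncomputable def luckyNodes (ω : (gossip T t τ).Coins V) : Finset V :=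
  Finset.univ.filter fun v => Lucky t (label ω v)

theorem mem_luckyNodes {v : V} : v ∈ luckyNodes ω ↔ Lucky t (label ω v) := by
  simp [luckyNodes]

/-- The summands count `hello`, candidacies, witness rumors, announcements and the election. With
the second index equal to the first, `hits` imposes no order condition and counts all witnesses of a
candidate. -/
theorem length_logs_le {c : (gossip T t τ).Config V} (S : Sound (label ω) t τ (logs c))
    (hlab : Function.Injective (label ω))
    {k U : ℕ} (hk : (luckyNodes ω).card ≤ k)
    (hU : ∀ u, (hits (label ω) (logs c) u u).card ≤ U) (v : V) :
    (logs c v).length ≤ 1 + k + k * U + k + 1 := by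
  classical
  rw [← List.toFinset_card_of_nodup (S.nodup v)]
  let s : V → Fin (2 ^ T + 1) := fun u =>
    if h : ∃ s, Rumor.done (label ω u) s ∈ logs c v then h.choose else 0
  let E : Finset (Rumor T) := (logs c v).toFinset.filter fun f => ∃ x, f = .elect x
  have hsub : (logs c v).toFinset ⊆ {Rumor.hello} ∪
      (luckyNodes ω).image (fun u => Rumor.cand (label ω u)) ∪
      (luckyNodes ω).biUnion (fun u => (hits (label ω) (logs c) u u).image
        fun z => Rumor.wit (label ω u) (label ω z)) ∪
      (luckyNodes ω).image (fun u => Rumor.done (label ω u) (s u)) ∪ E := by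
    intro f hf
    have hf' := List.mem_toFinset.1 hf
    simp only [Finset.mem_union]
    cases f with
    | hello => simp
    | cand x =>
      obtain ⟨u, rfl, hu, -⟩ := lucky_of_cand_mem S hf'
      exact Or.inl (Or.inl (Or.inl (Or.inr (Finset.mem_image.2 ⟨u, mem_luckyNodes.2 hu, rfl⟩))))
    | wit x w =>
      obtain ⟨z, rfl, hz⟩ := S.owned v _ _ hf' rfl
      obtain ⟨h1, h2, -⟩ := S.wit_spec z x hz
      obtain ⟨u, rfl, hu, -⟩ := lucky_of_cand_mem S h1
      refine Or.inl (Or.inl (Or.inr (Finset.mem_biUnion.2 ⟨u, mem_luckyNodes.2 hu,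
        Finset.mem_image.2 ⟨z, mem_hits.2 ⟨mem_draws.2 ⟨?_, h1, Precedes.irrefl⟩, hz⟩, rfl⟩⟩)))
      rintro rfl
      exact h2 rfl
    | done x s' =>
      obtain ⟨u, rfl, hu⟩ := S.owned v _ _ hf' rfl
      have hl := S.lucky_of_cand u (S.done_spec u s' hu).2.1.mem_left
      have hex : ∃ s, Rumor.done (label ω u) s ∈ logs c v := ⟨s', hf'⟩
      have hs : s u = s' := by
        have hsu : s u = hex.choose := dif_pos hex
        rw [hsu]
        exact S.done_unique' hlab hex.choose_spec hf'
      exact Or.inl (Or.inr (Finset.mem_image.2 ⟨u, mem_luckyNodes.2 hl, by rw [hs]⟩))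
    | elect x => exact Or.inr (Finset.mem_filter.2 ⟨hf, x, rfl⟩)
  have hE : E.card ≤ 1 := by
    rw [Finset.card_le_one]
    intro a ha b hb
    obtain ⟨ha, x, rfl⟩ := Finset.mem_filter.1 ha
    obtain ⟨hb, y, rfl⟩ := Finset.mem_filter.1 hb
    rw [S.elect_unique v x y (List.mem_toFinset.1 ha) (List.mem_toFinset.1 hb)]
  refine (Finset.card_le_card hsub).trans ?_
  refine (Finset.card_union_le _ _).trans (add_le_add ?_ hE)
  refine (Finset.card_union_le _ _).trans (add_le_add ?_ (Finset.card_image_le.trans hk))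
  refine (Finset.card_union_le _ _).trans (add_le_add ?_ ?_)
  · refine (Finset.card_union_le _ _).trans (add_le_add (by simp) (Finset.card_image_le.trans hk))
  · refine Finset.card_biUnion_le.trans ((Finset.sum_le_card_nsmul _ _ U fun u _ =>
      Finset.card_image_le.trans (hU u)).trans ?_)
    rw [smul_eq_mul]
    exact Nat.mul_le_mul_right U hk

/-- Every log entry was sent once over each incident edge, so the handshake lemma applies. -/
theorem sent_le {c : (gossip T t τ).Config V} (I : Valid G ω c) {B : ℕ}
    (hB : ∀ v, (logs c v).length ≤ B) : (c.sent : ℝ) ≤ 2 * G.edgeFinset.card * B := by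
  rw [I.sent_eq]
  have : ∑ v, G.degree v * (logs c v).length ≤ 2 * G.edgeFinset.card * B := by
    rw [← G.sum_degrees_eq_twice_card_edges, Finset.sum_mul]
    exact Finset.sum_le_sum fun v _ => Nat.mul_le_mul_left _ (hB v)
  exact_mod_cast this

/-! ### The time until a leader is elected -/

/-- When all nodes have terminated, a leader is elected. -/
theorem leaderElected {c : (gossip T t τ).Config V} (I : Valid G ω c)
    (hlab : Function.Injective (label ω)) (hN : NoSplit (label ω) τ (logs c)) [Nonempty V]
    (h : ∀ v, ¬ Open (logs c v)) : LeaderElected c := by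
  have h' : ∀ v, ∃ x, Rumor.elect x ∈ logs c v := fun v => by
    have := h v
    unfold Open at this
    push Not at this
    exact this
  choose x hx using h'
  have v₀ : V := Classical.arbitrary V
  have hall : ∀ v y, Rumor.elect y ∈ logs c v → y = x v₀ := fun v y hy =>
    I.sound.certified_unique hlab hN (I.sound.elect_spec v y hy) (I.sound.elect_spec _ _ (hx v₀))
  have hout : ∀ v y, c.node v = some y →
      (gossip T t τ).output y.state = some (decide (x v₀ = label ω v), x v₀) := by
    intro v y hy
    have hl := logs_of_some hy
    have hex : ∃ x, Rumor.elect x ∈ GossipState.log y.state := ⟨x v, by rw [← hl]; exact hx v⟩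
    have hc := hall v hex.choose (by rw [hl]; exact hex.choose_spec)
    have hme := (I.node v y hy).2.1
    simp only [gossip]
    rw [dif_pos hex, hc, hme]
  have hawake : ∀ v, ∃ y, c.node v = some y := fun v =>
    Option.ne_none_iff_exists'.1 (Valid.awake_of_mem (hx v))
  -- The certificate shows that the elected label belongs to an actual node.
  obtain ⟨K, σ, hK, hxK, H⟩ := I.sound.elect_spec _ _ (hx v₀)
  obtain ⟨u, s, hu, -⟩ := H _ (leaderOf_mem hK σ)
  rw [← hxK] at hu
  obtain ⟨y, hy⟩ := hawake u
  have hid := (I.node u y hy).1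
  refine ⟨u, y, hy, ?_, fun v hvu => ?_⟩
  · rw [hout u y hy, hid, hu]; simp
  · obtain ⟨z, hz⟩ := hawake v
    have hne : label ω v ≠ x v₀ := fun h => hvu (hlab (h.trans hu.symm))
    refine ⟨z, hz, ?_, ?_⟩
    · rw [(I.node v z hz).1, hid, hu]; exact hne
    · rw [hout v z hz, hid, hu]; simp [hne.symm]

section

variable (hadv : adv.IsLegal G port) (hlab : Function.Injective (label ω)) (hτ : 1 ≤ τ)
  {B : ℕ} (hB : ∀ k v, (logs (config G port adv ω k) v).length ≤ B) (hG : G.Connected)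
include hadv hlab hτ

/-- In the initial configuration neither inactivity nor delivery is allowed, so the first action
wakes a node at time 0. -/
theorem by_awake : By G port adv ω (fun c => ∃ v, c.node v ≠ none) 0 := by
  have h0 := hadv ω 0
  have e0 : config G port adv ω 0 = (gossip T t τ).start V := rfl
  have e1 : config G port adv ω 1 = step G port ω (config G port adv ω 0)
    (adv (trace G port adv ω 0).1 (trace G port adv ω 0).2) := rfl
  generalize adv (trace G port adv ω 0).1 (trace G port adv ω 0).2 = act at h0 e1
  rw [e0] at h0 e1
  obtain _ | ⟨s, v | ⟨u, w⟩⟩ := act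
  · obtain ⟨v, hv⟩ := h0.1
    exact absurd rfl hv
  · obtain ⟨-, h2, -, h4⟩ := h0
    have hs : s = 0 := h2 fun v => rfl
    subst hs
    obtain ⟨E, hn, -⟩ := effect_wakeUp (c := { (gossip T t τ).start V with now := 0 }) G port
      (ω := ω) (v := v) rfl
    refine ⟨1, ⟨v, ?_⟩, ?_⟩
    · rw [e1]; simp [Protocol.step, hn]
    · rw [e1]
      exact E.now.le
  · exact absurd rfl h0.2.2.2

include hB hG

/-- Four floodings of duration `B * diam` force a first election. Each has the alternative that some
node has already terminated, since terminated nodes block further gossip. -/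
theorem by_closed (hcand : ∃ u, Lucky t (label ω u))
    (hhit : ∀ k u, (∀ z, z ≠ u → z ∈ draws (label ω) (logs (config G port adv ω k)) u u) →
      τ ≤ (hits (label ω) (logs (config G port adv ω k)) u u).card) :
    By G port adv ω Closed (4 * (B * G.diam)) := by
  classical
  set d : ℝ := B * G.diam with hd
  have hd0 : 0 ≤ d := by positivity
  have hmem : ∀ (f : Rumor T) (v : V) (c c' : (gossip T t τ).Config V), Advance G c c' →
      f ∈ logs c v → f ∈ logs c' v := fun f v c c' A h => (A.log v).subset h
  have hI := valid_config hadv hlab hτ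
  -- all nodes wake up
  have m1 : By G port adv ω (fun c => (∀ w, Rumor.hello ∈ logs c w) ∨ Closed c) d := by
    refine by_or_forall hadv hlab hτ hd0 (fun w => hmem _ w) fun w => ?_
    obtain ⟨k, ⟨v, hv⟩, hk⟩ := by_awake hadv hlab hτ
    have := spread hadv hlab hτ hB hG v (f := .hello) ⟨k, Or.inl ((hI k).asleep hv), hk⟩ w
    rwa [zero_add] at this
  -- all candidates become known
  have m2 : By G port adv ω (fun c => (∀ p : {u // Lucky t (label ω u)} × V,
      Rumor.cand (label ω p.1) ∈ logs c p.2) ∨ Closed c) (d + d) := by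
    refine by_or_forall hadv hlab hτ (by linarith) (fun p => hmem _ p.2) fun p => ?_
    refine spread hadv hlab hτ hB hG p.1 (m1.mono le_rfl fun k h => h.imp (fun h => ?_) id) p.2
    exact (hI k).sound.cand_of_lucky _ (h _) p.1.2
  obtain ⟨k₂, hk₂, hn₂⟩ := m2
  -- every candidate gets its witnesses
  have m3 : By G port adv ω (fun c => (∀ u : {u // Lucky t (label ω u)},
      ∃ s, Rumor.done (label ω u) s ∈ logs c u) ∨ Closed c) (d + d + d) := by
    rcases hk₂ with hk₂ | hk₂
    swap
    · exact ⟨k₂, Or.inr hk₂, by linarith⟩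
    have h3 : By G port adv ω (fun c => (∀ p : {p : V × V // Lucky t (label ω p.1) ∧
        p.2 ∈ hits (label ω) (logs (config G port adv ω k₂)) p.1 p.1},
        Rumor.wit (label ω p.1.1) (label ω p.1.2) ∈ logs c p.1.1) ∨ Closed c) (d + d + d) := by
      refine by_or_forall hadv hlab hτ (by linarith) (fun p => hmem _ p.1.1) fun p => ?_
      exact spread hadv hlab hτ hB hG p.1.2
        ⟨k₂, Or.inl (mem_hits.1 p.2.2).2, hn₂⟩ p.1.1
    obtain ⟨k, hk, hn⟩ := h3
    rcases hk with hk | hk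
    swap
    · exact ⟨k, Or.inr hk, hn⟩
    have h4 : By G port adv ω (fun c => (∀ p : {u // Lucky t (label ω u)} × V,
        Rumor.cand (label ω p.1) ∈ logs c p.2)) (d + d + d) := ⟨k₂, hk₂, by linarith⟩
    have h5 : By G port adv ω (fun c => ∀ p : {p : V × V // Lucky t (label ω p.1) ∧
        p.2 ∈ hits (label ω) (logs (config G port adv ω k₂)) p.1 p.1},
        Rumor.wit (label ω p.1.1) (label ω p.1.2) ∈ logs c p.1.1) (d + d + d) := ⟨k, hk, hn⟩
    -- Indexing by `Bool` merges the two stable properties into one configuration that has both.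
    have h6 := by_forall hadv hlab hτ (ι := Bool) (s := d + d + d) (by linarith)
      (X := fun b c => bif b then (∀ p : {u // Lucky t (label ω u)} × V,
        Rumor.cand (label ω p.1) ∈ logs c p.2) else
        ∀ p : {p : V × V // Lucky t (label ω p.1) ∧
          p.2 ∈ hits (label ω) (logs (config G port adv ω k₂)) p.1 p.1},
          Rumor.wit (label ω p.1.1) (label ω p.1.2) ∈ logs c p.1.1)
      (by rintro (_ | _) c c' A h p
          · exact hmem _ _ c c' A (h p)
          · exact hmem _ _ c c' A (h p))
      (by rintro (_ | _); exacts [h5, h4])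
    obtain ⟨j, hj, hjn⟩ := h6
    refine ⟨j, Or.inl fun u => ?_, hjn⟩
    have hc := hj true
    have hw := hj false
    simp only [cond_true, cond_false] at hc hw
    by_contra hno
    push Not at hno
    refine ((hI j).settled u.1).1 ⟨hc (u, u.1), hno, ?_⟩
    -- At step `k₂` all other nodes have sampled for `u`, and by now all resulting witness rumors
    -- have reached it. A settled log cannot then leave the announcement unmade.
    refine (hhit k₂ u.1 fun z hz => mem_draws.2 ⟨hz, hk₂ (u, z), Precedes.irrefl⟩).trans ?_
    rw [← Finset.card_image_of_injective _ hlab]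
    refine Finset.card_le_card fun x hx => ?_
    obtain ⟨z, hz, rfl⟩ := Finset.mem_image.1 hx
    exact mem_wits.2 (hw ⟨(u.1, z), u.2, hz⟩)
  obtain ⟨k₃, hk₃, hn₃⟩ := m3
  rcases hk₃ with hk₃ | hk₃
  swap
  · exact ⟨k₃, hk₃, by linarith⟩
  rcases hk₂ with hk₂ | hk₂
  swap
  · exact ⟨k₂, hk₂, by linarith⟩
  choose s hs using hk₃
  -- all counts become known
  have m4 : By G port adv ω (fun c => (∀ p : {u // Lucky t (label ω u)} × V,
      Rumor.done (label ω p.1) (s p.1) ∈ logs c p.2) ∨ Closed c) (d + d + d + d) := by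
    refine by_or_forall hadv hlab hτ (by linarith) (fun p => hmem _ p.2) fun p => ?_
    exact spread hadv hlab hτ hB hG p.1 ⟨k₃, Or.inl (hs p.1), hn₃⟩ p.2
  refine m4.mono (by linarith) fun k hk => ?_
  rcases hk with hk | hk
  swap
  · exact hk
  obtain ⟨u, hu⟩ := hcand
  refine ⟨u, fun ho => ((hI k).settled u).2 ⟨ho, ⟨label ω u, ?_⟩, fun x hx => ?_⟩⟩
  · exact (hI k).sound.cand_of_lucky u ((hI k).asleep (Valid.awake_of_mem (hk (⟨u, hu⟩, u)))) hu
  · obtain ⟨v, rfl, hv, -⟩ := lucky_of_cand_mem (hI k).sound hx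
    exact ⟨_, hk (⟨v, hv⟩, u)⟩

/-- The fifth flooding brings the first election to all nodes. -/
theorem solvesWithin (hcand : ∃ u, Lucky t (label ω u))
    (hhit : ∀ k u, (∀ z, z ≠ u → z ∈ draws (label ω) (logs (config G port adv ω k)) u u) →
      τ ≤ (hits (label ω) (logs (config G port adv ω k)) u u).card)
    (hN : ∀ k, NoSplit (label ω) τ (logs (config G port adv ω k))) :
    SolvesWithin G port adv ω (5 * (B * G.diam)) := by
  have h := by_forall hadv hlab hτ (by positivity) (X := fun w c => ¬ Open (logs c w))
    (fun w c c' A => not_open_of_advance A)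
    (fun w => spread_closed hadv hlab hτ hB hG (by_closed hadv hlab hτ hB hG hcand hhit) w)
  obtain ⟨k, h1, h2⟩ := h
  have := hG.nonempty
  exact ⟨k, leaderElected (valid_config hadv hlab hτ k) hlab (hN k) h1, by linarith⟩

end

end Gossip

/-! ### Adaptive sampling with fair coins -/

open scoped ENNReal

section FairCoins

variable {ι : Type}

/-- Independent fair coins indexed by `ι`. -/
noncomputable def fairCoins (ι : Type) : Measure (ι → Bool) :=
  Measure.infinitePi fun _ => (PMF.uniformOfFintype Bool).toMeasure

instance : IsProbabilityMeasure (fairCoins ι) := by unfold fairCoins; infer_instance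

/-- The set `A` depends on the coins in `S` only. -/
def DependsOnCoins (A : Set (ι → Bool)) (S : Finset ι) : Prop :=
  ∀ ω ω' : ι → Bool, (∀ i ∈ S, ω i = ω' i) → ω ∈ A → ω' ∈ A

theorem DependsOnCoins.preimage_image {A : Set (ι → Bool)} {S : Finset ι}
    (h : DependsOnCoins A S) : S.restrict ⁻¹' (S.restrict '' A) = A := by
  ext ω
  constructor
  · rintro ⟨ω', h1, h2⟩
    exact h ω' ω (fun i hi => congrFun h2 ⟨i, hi⟩) h1
  · exact fun hω => ⟨ω, hω, rfl⟩

theorem DependsOnCoins.measurableSet {A : Set (ι → Bool)} {S : Finset ι}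
    (h : DependsOnCoins A S) : MeasurableSet A := by
  rw [← h.preimage_image]
  exact (Finset.measurable_restrict S) (Set.toFinite _).measurableSet

/-- The coins in `S` show the values given by `f`. -/
def Shows (S : Finset ι) (f : ι → Bool) : Set (ι → Bool) := {ω | ∀ i ∈ S, ω i = f i}

theorem dependsOnCoins_shows (S : Finset ι) (f : ι → Bool) : DependsOnCoins (Shows S f) S :=
  fun _ _ h h' i hi => (h i hi).symm.trans (h' i hi)

theorem fairCoins_shows (S : Finset ι) (f : ι → Bool) :
    fairCoins ι (Shows S f) = (2⁻¹ : ℝ≥0∞) ^ S.card := by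
  have : Shows S f = Set.pi S fun i => {f i} := by
    ext ω; simp [Shows]
  rw [this, fairCoins, Measure.infinitePi_pi _ fun i _ => measurableSet_singleton _]
  have h : ∀ b : Bool, (PMF.uniformOfFintype Bool).toMeasure {b} = 2⁻¹ := by
    intro b
    rw [PMF.toMeasure_apply_singleton _ _ (measurableSet_singleton b)]
    simp
  simp [h]

variable [DecidableEq ι]

/-- Coins outside of `S` are independent of a set that depends on `S` only. -/
theorem fairCoins_inter_shows {A : Set (ι → Bool)} {S B : Finset ι} (hA : DependsOnCoins A S)
    (hB : Disjoint S B) (f : ι → Bool) :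
    fairCoins ι (A ∩ Shows B f) = fairCoins ι A * (2⁻¹ : ℝ≥0∞) ^ B.card := by
  classical
  let ext : (S → Bool) → ι → Bool := fun a i => if h : i ∈ S then a ⟨i, h⟩ else f i
  let R : Finset (S → Bool) := Finset.univ.filter fun a => a ∈ S.restrict '' A
  have hext : ∀ a i (h : i ∈ S), ext a i = a ⟨i, h⟩ := fun a i h => dif_pos h
  have hext' : ∀ a i, i ∈ B → ext a i = f i := fun a i h =>
    dif_neg fun h' => Finset.disjoint_left.1 hB h' h
  -- The event is a disjoint union of cylinders on `U`, one for each pattern on `S` occurring in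
  -- `A`. Comparing `U = S` with `U = S ∪ B` gives the product formula.
  have key : ∀ U : Finset ι, S ⊆ U → U ⊆ S ∪ B →
      fairCoins ι (A ∩ Shows (U \ S) f) = R.card * (2⁻¹ : ℝ≥0∞) ^ U.card := by
    intro U hSU hU
    have hUf : ∀ i ∈ U \ S, i ∈ B := fun i hi =>
      (Finset.mem_union.1 (hU (Finset.mem_sdiff.1 hi).1)).resolve_left (Finset.mem_sdiff.1 hi).2
    have hun : A ∩ Shows (U \ S) f = ⋃ a ∈ R, Shows U (ext a) := by
      ext ω
      simp only [Set.mem_inter_iff, Set.mem_iUnion, exists_prop]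
      constructor
      · rintro ⟨h1, h2⟩
        refine ⟨S.restrict ω, by simpa [R] using ⟨ω, h1, rfl⟩, fun i hi => ?_⟩
        by_cases hiS : i ∈ S
        · rw [hext _ i hiS]; rfl
        · have hi' := Finset.mem_sdiff.2 ⟨hi, hiS⟩
          rw [hext' _ i (hUf i hi')]; exact h2 i hi'
      · rintro ⟨a, ha, h⟩
        obtain ⟨-, ω', h1, rfl⟩ := Finset.mem_filter.1 ha
        refine ⟨hA ω' ω (fun i hi => ?_) h1, fun i hi => ?_⟩
        · rw [h i (hSU hi), hext _ i hi]; rfl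
        · rw [h i (Finset.mem_sdiff.1 hi).1, hext' _ i (hUf i hi)]
    rw [hun, measure_biUnion_finset]
    · simp [fairCoins_shows]
    · intro a _ b _ hab
      refine Set.disjoint_left.2 fun ω h1 h2 => hab (funext fun i => ?_)
      rw [← hext a i i.2, ← hext b i i.2, ← h1 i (hSU i.2), h2 i (hSU i.2)]
    · exact fun a _ => (dependsOnCoins_shows U _).measurableSet
  have k1 := key S (Finset.Subset.refl _) Finset.subset_union_left
  have k2 := key (S ∪ B) Finset.subset_union_left (Finset.Subset.refl _)
  have e1 : S \ S = ∅ := Finset.sdiff_self S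
  have e2 : (S ∪ B) \ S = B := by
    rw [Finset.union_sdiff_left, Finset.sdiff_eq_self_of_disjoint hB.symm]
  have e3 : Shows (∅ : Finset ι) f = Set.univ := by ext; simp [Shows]
  rw [e1, e3, Set.inter_univ] at k1
  rw [e2, Finset.card_union_of_disjoint hB, pow_add] at k2
  rw [k2, k1, mul_assoc]

theorem two_inv_pow_add (t : ℕ) : (2⁻¹ : ℝ≥0∞) ^ t = ENNReal.ofReal ((2⁻¹ : ℝ) ^ t) := by
  rw [ENNReal.ofReal_pow (by norm_num), ENNReal.ofReal_inv_of_pos (by norm_num)]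
  simp

/-- The probability that not all of the coins in `B` show heads. -/
theorem fairCoins_diff_shows {A : Set (ι → Bool)} {S B : Finset ι} (hA : DependsOnCoins A S)
    (hB : Disjoint S B) (f : ι → Bool) :
    fairCoins ι (A \ Shows B f) = fairCoins ι A * ENNReal.ofReal (1 - (2⁻¹ : ℝ) ^ B.card) := by
  have h1 := measure_inter_add_sdiff (μ := fairCoins ι) A (dependsOnCoins_shows B f).measurableSet
  rw [fairCoins_inter_shows hA hB f, two_inv_pow_add] at h1
  have h2 : fairCoins ι A * ENNReal.ofReal ((2⁻¹ : ℝ) ^ B.card) +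
      fairCoins ι A * ENNReal.ofReal (1 - (2⁻¹ : ℝ) ^ B.card) = fairCoins ι A := by
    rw [← mul_add, ← ENNReal.ofReal_add (by positivity)]
    · simp
    · rw [sub_nonneg]; exact pow_le_one₀ (by norm_num) (by norm_num)
  refine (ENNReal.add_right_inj ?_).1 (h1.trans h2.symm)
  exact ENNReal.mul_ne_top (measure_ne_top _ _) ENNReal.ofReal_ne_top

/-- Coins are flipped in an order that may depend on earlier outcomes: `hist k` is what is known
after `k` steps, and depends on the coins `seen k` only. In each step, at most one set of `t` new
coins, `ask k`, is inspected, which is a hit if all of them show heads; `tries k` and `hits k`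
count the inspections and the hits, provided that the event `good` occurs. -/
structure Sampling (ι : Type) [DecidableEq ι] (t : ℕ) where
  H : Type
  hist : ℕ → (ι → Bool) → H
  bound : ℕ → Finset ι
  hist_eq : ∀ k ω ω', (∀ i ∈ bound k, ω i = ω' i) → hist k ω = hist k ω'
  seen : ℕ → (ι → Bool) → Finset ι
  hist_eq_of_seen : ∀ k ω ω', (∀ i ∈ seen k ω, ω i = ω' i) → hist k ω' = hist k ω
  seen_congr : ∀ k ω ω', hist k ω = hist k ω' → seen k ω = seen k ω'
  ask : ℕ → (ι → Bool) → Option (Finset ι)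
  ask_congr : ∀ k ω ω', hist k ω = hist k ω' → ask k ω = ask k ω'
  ask_new : ∀ k ω B, ask k ω = some B → Disjoint (seen k ω) B ∧ B.card = t
  good : Set (ι → Bool)
  good_congr : ∀ k ω ω', hist k ω = hist k ω' → (ω ∈ good ↔ ω' ∈ good)
  tries : ℕ → (ι → Bool) → ℕ
  tries_congr : ∀ k ω ω', hist k ω = hist k ω' → tries k ω = tries k ω'
  hits : ℕ → (ι → Bool) → ℕ
  hits_congr : ∀ k ω ω', hist k ω = hist k ω' → hits k ω = hits k ω'
  zero : ∀ ω, tries 0 ω = 0 ∧ hits 0 ω = 0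
  idle : ∀ k ω, ω ∈ good → ask k ω = none →
    tries (k + 1) ω = tries k ω ∧ hits (k + 1) ω = hits k ω
  try_ : ∀ k ω B, ω ∈ good → ask k ω = some B → tries (k + 1) ω = tries k ω + 1 ∧
    (ω ∈ Shows B (fun _ => true) → hits (k + 1) ω = hits k ω + 1) ∧
    (ω ∉ Shows B (fun _ => true) → hits (k + 1) ω = hits k ω)

namespace Sampling

variable {t : ℕ} (X : Sampling ι t)

open Classical in
/-- The exponential weight of the outcome of `k` steps. -/
noncomputable def weight (a : ℝ) (k : ℕ) (ω : ι → Bool) : ℝ≥0∞ :=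
  if ω ∈ X.good then
    ENNReal.ofReal (a ^ X.hits k ω * ((1 + (2⁻¹ : ℝ) ^ t * (a - 1))⁻¹) ^ X.tries k ω)
  else 0

theorem weight_congr (a : ℝ) {k : ℕ} {ω ω' : ι → Bool} (h : X.hist k ω = X.hist k ω') :
    X.weight a k ω = X.weight a k ω' := by
  classical
  unfold weight
  rw [X.hits_congr k ω ω' h, X.tries_congr k ω ω' h]
  exact if_congr (X.good_congr k ω ω' h) rfl rfl

theorem dependsOnCoins (k : ℕ) {A : Set (ι → Bool)}
    (hA : ∀ ω ω', X.hist k ω = X.hist k ω' → ω ∈ A → ω' ∈ A) : DependsOnCoins A (X.bound k) :=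
  fun ω ω' h => hA ω ω' (X.hist_eq k ω ω' h)

/-- A deterministic finite set of coins bounds the history, so integrals can be split into finitely
many history classes. -/
theorem finite_range (k : ℕ) : (Set.range (X.hist k)).Finite := by
  have : Set.range (X.hist k) ⊆ Set.range fun a : X.bound k → Bool =>
      X.hist k fun i => if h : i ∈ X.bound k then a ⟨i, h⟩ else true := by
    rintro _ ⟨ω, rfl⟩
    refine ⟨fun i => ω i, X.hist_eq k _ _ fun i hi => ?_⟩
    simp [hi]
  exact (Set.finite_range _).subset this

/-- On each history, the weight does not grow on average. -/
theorem setLIntegral_weight_le {a : ℝ} (ha : 0 < a) (k : ℕ) (ω₀ : ι → Bool) :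
    ∫⁻ ω in {ω | X.hist k ω = X.hist k ω₀}, X.weight a (k + 1) ω ∂fairCoins ι ≤
      ∫⁻ ω in {ω | X.hist k ω = X.hist k ω₀}, X.weight a k ω ∂fairCoins ι := by
  set A : Set (ι → Bool) := {ω | X.hist k ω = X.hist k ω₀} with hAdef
  -- The set of seen coins varies with the outcome but is constant on a history class, so the class
  -- depends on one fixed finite set, disjoint from the coins asked next.
  have hA : DependsOnCoins A (X.seen k ω₀) := by
    intro ω ω' h hω
    have h1 : X.hist k ω = X.hist k ω₀ := hω
    rw [← X.seen_congr k ω ω₀ h1] at h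
    exact (X.hist_eq_of_seen k ω ω' h).trans h1
  have hAm := hA.measurableSet
  set g : ℝ := 1 + (2⁻¹ : ℝ) ^ t * (a - 1) with hg
  have hq1 : (2⁻¹ : ℝ) ^ t ≤ 1 := pow_le_one₀ (by norm_num) (by norm_num)
  have hq0 : (0 : ℝ) < (2⁻¹ : ℝ) ^ t := by positivity
  have hg0 : 0 < g := by
    rw [hg]; nlinarith [mul_pos hq0 ha]
  have hconst : ∀ ω ∈ A, X.weight a k ω = X.weight a k ω₀ := fun ω hω => X.weight_congr a hω
  rw [setLIntegral_congr_fun hAm hconst, setLIntegral_const]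
  by_cases hgood : ω₀ ∈ X.good
  swap
  · have : ∀ ω ∈ A, X.weight a (k + 1) ω = 0 := fun ω hω =>
      if_neg fun h => hgood ((X.good_congr k ω ω₀ hω).1 h)
    rw [setLIntegral_congr_fun hAm this]
    simp
  have hgoodA : ∀ ω ∈ A, ω ∈ X.good := fun ω hω => (X.good_congr k ω ω₀ hω).2 hgood
  cases hask : X.ask k ω₀ with
  | none =>
    have : ∀ ω ∈ A, X.weight a (k + 1) ω = X.weight a k ω₀ := by
      intro ω hω
      rw [← hconst ω hω]
      obtain ⟨h1, h2⟩ := X.idle k ω (hgoodA ω hω) ((X.ask_congr k ω ω₀ hω).trans hask)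
      simp only [weight, h1, h2]
    rw [setLIntegral_congr_fun hAm this, setLIntegral_const]
  | some B =>
    obtain ⟨hB1, hB2⟩ := X.ask_new k ω₀ B hask
    set E := Shows B (fun _ => true) with hE
    have hEm : MeasurableSet E := (dependsOnCoins_shows B _).measurableSet
    have hw₀ : X.weight a k ω₀ =
        ENNReal.ofReal (a ^ X.hits k ω₀ * (g⁻¹) ^ X.tries k ω₀) := if_pos hgood
    have hpos : 0 ≤ a ^ X.hits k ω₀ * (g⁻¹) ^ X.tries k ω₀ := by positivity
    have h1 : ∀ ω ∈ A ∩ E, X.weight a (k + 1) ω = X.weight a k ω₀ * ENNReal.ofReal (a * g⁻¹) := by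
      rintro ω ⟨hω, hωE⟩
      obtain ⟨e1, e2, -⟩ := X.try_ k ω B (hgoodA ω hω) ((X.ask_congr k ω ω₀ hω).trans hask)
      rw [hw₀, ← ENNReal.ofReal_mul hpos]
      simp only [weight, if_pos (hgoodA ω hω)]
      rw [e1, e2 hωE, X.hits_congr k ω ω₀ hω, X.tries_congr k ω ω₀ hω, ← hg]
      congr 1
      ring
    have h2 : ∀ ω ∈ A \ E, X.weight a (k + 1) ω = X.weight a k ω₀ * ENNReal.ofReal g⁻¹ := by
      rintro ω ⟨hω, hωE⟩
      obtain ⟨e1, -, e2⟩ := X.try_ k ω B (hgoodA ω hω) ((X.ask_congr k ω ω₀ hω).trans hask)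
      rw [hw₀, ← ENNReal.ofReal_mul hpos]
      simp only [weight, if_pos (hgoodA ω hω)]
      rw [e1, e2 hωE, X.hits_congr k ω ω₀ hω, X.tries_congr k ω ω₀ hω, ← hg]
      congr 1
      ring
    rw [← lintegral_inter_add_sdiff _ A hEm, setLIntegral_congr_fun (hAm.inter hEm) h1,
      setLIntegral_congr_fun (hAm.diff hEm) h2, setLIntegral_const, setLIntegral_const,
      fairCoins_inter_shows hA hB1, fairCoins_diff_shows hA hB1, hB2, two_inv_pow_add]
    -- The normalization `g` is the mean factor of a sample: a with probability q and 1 otherwise.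
    have hsum : ENNReal.ofReal (a * g⁻¹) * ENNReal.ofReal ((2⁻¹ : ℝ) ^ t) +
        ENNReal.ofReal g⁻¹ * ENNReal.ofReal (1 - (2⁻¹ : ℝ) ^ t) = 1 := by
      rw [← ENNReal.ofReal_mul (by positivity), ← ENNReal.ofReal_mul (by positivity),
        ← ENNReal.ofReal_add (by positivity) (mul_nonneg (by positivity) (by linarith))]
      rw [← ENNReal.ofReal_one]
      congr 1
      field_simp
      rw [hg]
      ring
    refine le_of_eq ?_
    calc _ = X.weight a k ω₀ * fairCoins ι A *
        (ENNReal.ofReal (a * g⁻¹) * ENNReal.ofReal ((2⁻¹ : ℝ) ^ t) +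
          ENNReal.ofReal g⁻¹ * ENNReal.ofReal (1 - (2⁻¹ : ℝ) ^ t)) := by ring
      _ = _ := by rw [hsum, mul_one]

theorem lintegral_weight_le {a : ℝ} (ha : 0 < a) (k : ℕ) :
    ∫⁻ ω, X.weight a k ω ∂fairCoins ι ≤ 1 := by
  classical
  induction k with
  | zero =>
    calc ∫⁻ ω, X.weight a 0 ω ∂fairCoins ι ≤ ∫⁻ _, 1 ∂fairCoins ι := by
          refine lintegral_mono fun ω => ?_
          simp only [weight, (X.zero ω).1, (X.zero ω).2, pow_zero, mul_one, ENNReal.ofReal_one]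
          split_ifs <;> simp
      _ = 1 := by simp
  | succ k ih =>
    refine le_trans ?_ ih
    let R := (X.finite_range k).toFinset
    have hun : (Set.univ : Set (ι → Bool)) = ⋃ h ∈ R, {ω | X.hist k ω = h} := by
      ext ω; simp [R]
    have hm : ∀ h ∈ R, MeasurableSet {ω | X.hist k ω = h} := fun h _ =>
      (X.dependsOnCoins k (A := {ω | X.hist k ω = h})
        fun ω ω' e hω => e.symm.trans hω).measurableSet
    have hd : Set.PairwiseDisjoint (R : Set X.H) fun h => {ω | X.hist k ω = h} := by
      intro h _ h' _ hne
      exact Set.disjoint_left.2 fun ω h1 h2 => hne (h1.symm.trans h2)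
    rw [← setLIntegral_univ, ← setLIntegral_univ (X.weight a k), hun,
      lintegral_biUnion_finset hd hm, lintegral_biUnion_finset hd hm]
    refine Finset.sum_le_sum fun h hh => ?_
    obtain ⟨ω₀, rfl⟩ := (X.finite_range k).mem_toFinset.1 hh
    exact X.setLIntegral_weight_le ha k ω₀

/-- A tail bound for adaptive sampling. -/
theorem measure_le {a b : ℝ} (ha : 0 < a) (hb : 0 < b) (k : ℕ) {E : Set (ι → Bool)}
    (hE : ∀ ω ω', X.hist k ω = X.hist k ω' → ω ∈ E → ω' ∈ E)
    (hbE : ∀ ω ∈ X.good, ω ∈ E →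
      b⁻¹ ≤ a ^ X.hits k ω * ((1 + (2⁻¹ : ℝ) ^ t * (a - 1))⁻¹) ^ X.tries k ω) :
    fairCoins ι (X.good ∩ E) ≤ ENNReal.ofReal b := by
  have hm : MeasurableSet (X.good ∩ E) :=
    (X.dependsOnCoins k (A := X.good ∩ E) fun ω ω' h hω =>
      ⟨(X.good_congr k ω ω' h).1 hω.1, hE ω ω' h hω.2⟩).measurableSet
  have h1 : ENNReal.ofReal b⁻¹ * fairCoins ι (X.good ∩ E) ≤ 1 := by
    rw [← setLIntegral_const]
    refine le_trans ?_ (X.lintegral_weight_le ha k)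
    refine (setLIntegral_mono' hm fun ω hω => ?_).trans (setLIntegral_le_lintegral _ _)
    rw [weight, if_pos hω.1]
    exact ENNReal.ofReal_le_ofReal (hbE ω hω.1 hω.2)
  calc fairCoins ι (X.good ∩ E)
      = ENNReal.ofReal b * (ENNReal.ofReal b⁻¹ * fairCoins ι (X.good ∩ E)) := by
        rw [← mul_assoc, ← ENNReal.ofReal_mul hb.le, mul_inv_cancel₀ hb.ne', ENNReal.ofReal_one,
          one_mul]
    _ ≤ ENNReal.ofReal b * 1 := by gcongr
    _ = _ := mul_one _

end Sampling

end FairCoins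

namespace Gossip

open Protocol

variable {V : Type} {T t τ : ℕ} [Fintype V] [DecidableEq V] (G : SimpleGraph V)
  [DecidableRel G.Adj] (port : V → V → ℕ) (adv : Adversary (gossip T t τ) V)

/-! ### Executions depend only on the coins that have been flipped -/

section Locality

variable {ω ω' : (gossip T t τ).Coins V} {c : (gossip T t τ).Config V}

theorem flipCount_wakeUp (ω : (gossip T t τ).Coins V) (c : (gossip T t τ).Config V) (v a : V) :
    flipCount c a ≤ flipCount (wakeUp G port ω c v) a ∧
      flipCount (wakeUp G port ω c v) a ≤ flipCount c a + 1 := by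
  by_cases h : c.node v = none
  · rw [wakeUp_of_asleep G port h]
    by_cases ha : a = v
    · subst ha
      simp [flipCount, emit, setNode, h]
    · simp [flipCount, emit, setNode, ha]
  · rw [wakeUp_of_awake G port h]
    omega

theorem wakeUp_congr {v : V} (h : label ω v = label ω' v) :
    wakeUp G port ω' c v = wakeUp G port ω c v := by
  by_cases hv : c.node v = none
  · rw [wakeUp_of_asleep G port hv, wakeUp_of_asleep G port hv, h]
  · rw [wakeUp_of_awake G port hv, wakeUp_of_awake G port hv]

theorem flipCount_accept (ω : (gossip T t τ).Coins V) (c : (gossip T t τ).Config V) (u w : V)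
    (f : Rumor T) (a : V) : flipCount c a ≤ flipCount (accept G port ω c u w f) a ∧
      flipCount (accept G port ω c u w f) a ≤ flipCount c a + 1 := by
  cases h : c.node w with
  | none =>
    have : accept G port ω c u w f = c := by unfold accept; rw [h]
    rw [this]; omega
  | some x =>
    by_cases ho : Open (GossipState.log x.state)
    · rw [accept_of_open G port h ho]
      by_cases ha : a = w
      · subst ha
        simp [flipCount, emit, setNode, h]
      · simp [flipCount, emit, setNode, ha]
    · rw [accept_of_not_open G port h ho]; omega

theorem accept_congr {u w : V} {f : Rumor T} (h : ∀ v j, j < flipCount (accept G port ω c u w f) v →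
    block ω v j = block ω' v j) : accept G port ω' c u w f = accept G port ω c u w f := by
  cases hw : c.node w with
  | none => unfold accept; rw [hw]
  | some x =>
    by_cases ho : Open (GossipState.log x.state)
    · have hb : block ω w x.flips.length = block ω' w x.flips.length := by
        refine h w _ ?_
        rw [accept_of_open G port hw ho]
        simp [flipCount, emit, setNode]
      have hn : arrivalNews ω w x f = arrivalNews ω' w x f := by
        unfold arrivalNews; rw [hb]
      rw [accept_of_open G port hw ho, accept_of_open G port hw ho, hb, hn]
    · rw [accept_of_not_open G port hw ho, accept_of_not_open G port hw ho]

theorem arrive_cons {u w : V} {f : Rumor T} {r : List (Rumor T)} (h : c.queue u w = f :: r) :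
    arrive G port ω c u w = accept G port ω (wakeUp G port ω (pop c u w r) w) u w f := by
  unfold arrive
  rw [h]
  rfl

theorem arrive_nil {u w : V} (h : c.queue u w = []) : arrive G port ω c u w = c := by
  unfold arrive
  rw [h]

/-- A delivery can use two blocks at a sleeping receiver: one for waking up and one for the message.
-/
theorem flipCount_step (ω : (gossip T t τ).Coins V) (c : (gossip T t τ).Config V)
    (act : Option (ℝ × Action V)) (a : V) : flipCount c a ≤ flipCount (step G port ω c act) a ∧
      flipCount (step G port ω c act) a ≤ flipCount c a + 2 := by
  obtain _ | ⟨s, v | ⟨u, w⟩⟩ := act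
  · exact ⟨le_rfl, by simp [Protocol.step]⟩
  · have := flipCount_wakeUp G port ω { c with now := s } v a
    exact ⟨this.1, this.2.trans (by simp [flipCount])⟩
  · change flipCount c a ≤ flipCount (arrive G port ω { c with now := s } u w) a ∧
      flipCount (arrive G port ω { c with now := s } u w) a ≤ flipCount c a + 2
    cases hq : c.queue u w with
    | nil =>
      rw [arrive_nil (c := { c with now := s }) G port hq]
      exact ⟨le_rfl, Nat.le_add_right _ 2⟩
    | cons f r =>
      rw [arrive_cons (c := { c with now := s }) G port hq]
      have h1 := flipCount_wakeUp G port ω (pop { c with now := s } u w r) w a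
      have h2 := flipCount_accept G port ω
        (wakeUp G port ω (pop { c with now := s } u w r) w) u w f a
      have h3 : flipCount (pop { c with now := s } u w r) a = flipCount c a := rfl
      omega

theorem step_congr (h0 : ∀ v, label ω v = label ω' v) {act : Option (ℝ × Action V)}
    (h : ∀ v j, j < flipCount (step G port ω c act) v → block ω v j = block ω' v j) :
    step G port ω' c act = step G port ω c act := by
  obtain _ | ⟨s, v | ⟨u, w⟩⟩ := act
  · rfl
  · exact wakeUp_congr G port (h0 v)
  · change arrive G port ω' { c with now := s } u w = arrive G port ω { c with now := s } u w
    change ∀ v j, j < flipCount (arrive G port ω { c with now := s } u w) v → _ at h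
    cases hq : c.queue u w with
    | nil =>
      rw [arrive_nil (c := { c with now := s }) G port hq,
        arrive_nil (c := { c with now := s }) G port hq]
    | cons f r =>
      rw [arrive_cons (c := { c with now := s }) G port hq] at h ⊢
      rw [arrive_cons (c := { c with now := s }) G port hq, wakeUp_congr G port (h0 w)]
      exact accept_congr G port h

theorem flipCount_config (k : ℕ) (v : V) : flipCount (config G port adv ω k) v ≤ 2 * k := by
  induction k with
  | zero => exact Nat.le_refl 0
  | succ k ih =>
    have : flipCount (config G port adv ω (k + 1)) v ≤ flipCount (config G port adv ω k) v + 2 :=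
      (flipCount_step G port ω _ _ v).2
    omega

/-- All labels are fixed at the outset, even those of sleeping nodes, so that the injectivity of the
labels can be decided from the history from step 0 on. -/
theorem trace_congr (h0 : ∀ v, label ω v = label ω' v) (k : ℕ)
    (h : ∀ v j, j < flipCount (config G port adv ω k) v → block ω v j = block ω' v j) :
    trace G port adv ω' k = trace G port adv ω k := by
  induction k with
  | zero => rfl
  | succ k ih =>
    have ih' := ih fun v j hj => h v j (hj.trans_le (flipCount_step G port ω _ _ v).1)
    unfold trace
    rw [ih']
    exact Prod.ext rfl (step_congr G port h0 h)

end Locality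

/-! ### The witnesses as a sample -/

/-- The first `t` coins in the `j`-th block of the node `v`. -/
def bits (V : Type) [DecidableEq V] (T t : ℕ) (v : V) (j : ℕ) : Finset (V × ℕ × Fin T) :=
  (Finset.univ.filter fun i : Fin T => i.val < t).image fun i => (v, j, i)

theorem mem_bits {v : V} {j : ℕ} {p : V × ℕ × Fin T} :
    p ∈ bits V T t v j ↔ p.1 = v ∧ p.2.1 = j ∧ p.2.2.val < t := by
  obtain ⟨a, b, i⟩ := p
  simp only [bits, Finset.mem_image, Finset.mem_filter, Finset.mem_univ, true_and, Prod.mk.injEq]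
  constructor
  · rintro ⟨i', h, rfl, rfl, rfl⟩; exact ⟨rfl, rfl, h⟩
  · rintro ⟨rfl, rfl, h⟩; exact ⟨i, h, rfl, rfl, rfl⟩

theorem card_bits (ht : t ≤ T) (v : V) (j : ℕ) : (bits V T t v j).card = t := by
  rw [bits, Finset.card_image_of_injective]
  · rw [Fin.card_filter_val_lt]
    omega
  · intro a b h; simpa using h

theorem mem_shows_bits {ω : (gossip T t τ).Coins V} {v : V} {j : ℕ} :
    ω ∈ Shows (bits V T t v j) (fun _ => true) ↔ Lucky t (block ω v j) := by
  constructor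
  · exact fun h i hi => h (v, j, i) (mem_bits.2 ⟨rfl, rfl, hi⟩)
  · rintro h ⟨a, b, i⟩ hp
    obtain ⟨rfl, rfl, hi⟩ := mem_bits.1 hp
    exact h i hi

open Classical in
/-- The node and the block of coins that are used if, in the configuration `c`, the action `act`
makes a node that has not heard of `v` sample whether to become a witness for `u`. -/
noncomputable def askAt (lab : V → Label T) (u v : V) (c : (gossip T t τ).Config V) :
    Option (ℝ × Action V) → Option (V × ℕ)
  | some (_, .deliver a w) =>
    match c.queue a w with
    | [] => none
    | f :: _ =>
      let l := if c.node w = none then initLog t (lab w) else logs c w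
      if Open l ∧ Samples lab l u v w f then some (w, max 1 (flipCount c w)) else none
  | _ => none

variable {G}

/-- An action adds a node to the sample exactly when it lets an open node newly hear of `u` without
knowing of `v`. A sleeping receiver is first given its initial log, and its sampling coins are then
block 1. -/
theorem askAt_spec {ω : (gossip T t τ).Coins V} {c : (gossip T t τ).Config V} (I : Valid G ω c)
    (hlab : Function.Injective (label ω)) (hτ : 1 ≤ τ) {act : Option (ℝ × Action V)}
    (h : Allowed c act) (u v : V) :
    (askAt (label ω) u v c act = none →
      draws (label ω) (logs (step G port ω c act)) u v = draws (label ω) (logs c) u v ∧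
      hits (label ω) (logs (step G port ω c act)) u v = hits (label ω) (logs c) u v) ∧
    ∀ w j, askAt (label ω) u v c act = some (w, j) →
      (draws (label ω) (logs (step G port ω c act)) u v).card =
        (draws (label ω) (logs c) u v).card + 1 ∧
      (Lucky t (block ω w j) → (hits (label ω) (logs (step G port ω c act)) u v).card =
        (hits (label ω) (logs c) u v).card + 1) ∧
      (¬ Lucky t (block ω w j) → (hits (label ω) (logs (step G port ω c act)) u v).card =
        (hits (label ω) (logs c) u v).card) := by
  classical
  obtain _ | ⟨s, b | ⟨a, b⟩⟩ := act
  · exact ⟨fun _ => ⟨rfl, rfl⟩, by simp [askAt]⟩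
  · refine ⟨fun _ => ?_, by simp [askAt]⟩
    have hb : ({ c with now := s } : (gossip T t τ).Config V).node b = none := h.2.2.2
    obtain ⟨E, -, -⟩ := effect_wakeUp G port (ω := ω) hb
    have hl : logs c b = [] := logs_of_none h.2.2.2
    have e : logs (step G port ω c (some (s, .wake b))) =
        pushLog (logs c) b (initLog t (label ω b)) := E.logs
    rw [e]
    exact ⟨draws_init hlab hl u v, hits_init hlab hl u v⟩
  · obtain ⟨h1, -, h3, h4⟩ := h
    obtain ⟨f, r, hq⟩ := List.exists_cons_of_ne_nil h4
    obtain ⟨J, -⟩ := I.tick h1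
    have hadj : G.Adj a b := I.fifo.adj h4
    have harr := arrive_eq (c := { c with now := s }) G port (ω := ω) hq hadj.ne
    have key : ∃ c₁ : (gossip T t τ).Config V, c₁ = wakeUp G port ω { c with now := s } b ∧
        Valid G ω c₁ ∧ c₁.node b ≠ none ∧ c₁.queue a b = f :: r ∧
        draws (label ω) (logs c₁) u v = draws (label ω) (logs c) u v ∧
        hits (label ω) (logs c₁) u v = hits (label ω) (logs c) u v ∧
        logs c₁ b = (if c.node b = none then initLog t (label ω b) else logs c b) ∧
        flipCount c₁ b = max 1 (flipCount c b) := by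
      refine ⟨_, rfl, ?_⟩
      by_cases hw : c.node b = none
      · have hw' : ({ c with now := s } : (gossip T t τ).Config V).node b = none := hw
        have J' := (J.wakeUp port hlab hτ hw').1
        obtain ⟨E, hn, hs⟩ := effect_wakeUp G port (ω := ω) hw'
        have hl : logs c b = [] := logs_of_none hw
        have e : logs (wakeUp G port ω { c with now := s } b) =
          pushLog (logs c) b (initLog t (label ω b)) := E.logs
        refine ⟨J', by simp [hn], ?_, ?_, ?_, ?_, ?_⟩
        · rw [E.queue]
          simp [pushQueue, hadj.ne, hq]
        · rw [e]; exact draws_init hlab hl u v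
        · rw [e]; exact hits_init hlab hl u v
        · rw [e, pushLog_self, hl, if_pos hw]; rfl
        · rw [flipCount_of_some hn, flipCount_of_none hw]; rfl
      · rw [wakeUp_of_awake (c := { c with now := s }) G port hw]
        refine ⟨J, hw, hq, rfl, rfl, ?_, ?_⟩
        · rw [if_neg hw]; rfl
        · obtain ⟨x, hx⟩ := Option.ne_none_iff_exists'.1 hw
          have h5 := (I.node b x hx).2.2.1
          rw [← flipCount_of_some hx] at h5
          rw [max_eq_right h5]; rfl
    obtain ⟨c₁, hc₁, J', hn, hq₁, hd, hh, hl, hfl⟩ := key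
    obtain ⟨x, hx⟩ := Option.ne_none_iff_exists'.1 hn
    have heq : step G port ω c (some (s, .deliver a b)) =
        accept G port ω (pop c₁ a b r) a b f := by
      rw [hc₁, ← harr]; rfl
    have E := (effect_accept G port (ω := ω) (f := f) (r := r) hx hadj.ne).1
    have hask : askAt (label ω) u v c (some (s, .deliver a b)) =
        if Open (logs c₁ b) ∧ Samples (label ω) (logs c₁ b) u v b f then
          some (b, flipCount c₁ b) else none := by
      rw [hl, hfl]
      simp only [askAt, hq]
    rw [heq, E.logs, hask, ← hd, ← hh]
    by_cases ho : Open (logs c₁ b)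
    · rw [arrivalNews_eq J' hx ho]
      by_cases hS : Samples (label ω) (logs c₁ b) u v b f
      · rw [if_pos ⟨ho, hS⟩]
        refine ⟨fun h => by simp at h, fun w j hwj => ?_⟩
        obtain ⟨rfl, rfl⟩ : b = w ∧ flipCount c₁ b = j := by simpa using hwj
        obtain ⟨d1, d2⟩ := draws_news_of_samples (t := t) (τ := τ) (me := label ω b)
          (b := block ω b (flipCount c₁ b)) hS
        obtain ⟨g1, g2⟩ := hits_news_of_samples (b := block ω b (flipCount c₁ b)) J'.sound hS
        rw [d2, g2, Finset.card_insert_of_notMem d1]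
        refine ⟨rfl, fun hb => ?_, fun hb => ?_⟩
        · rw [if_pos hb, Finset.card_insert_of_notMem g1]
        · rw [if_neg hb]
      · rw [if_neg fun h => hS h.2]
        exact ⟨fun _ => samples_news_of_not J'.sound hlab (J'.fifo.relay hq₁).1 hS, by simp⟩
    · rw [if_neg fun h => ho h.1, arrivalNews_eq_nil hx ho, pushLog_nil]
      exact ⟨fun _ => ⟨rfl, rfl⟩, by simp⟩

end Gossip

/-! ### The two sampling processes and collisions of labels. -/

namespace Gossip

open Protocol

variable {V : Type} {T t τ : ℕ} [Fintype V] [DecidableEq V] {G : SimpleGraph V}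
  [DecidableRel G.Adj] {port : V → V → ℕ} {adv : Adversary (gossip T t τ) V}

/-- The coins in the first `N v` blocks of each node `v`. -/
def blocksBelow (T : ℕ) (N : V → ℕ) : Finset (V × ℕ × Fin T) :=
  Finset.univ.biUnion fun v => ({v} : Finset V) ×ˢ (Finset.range (N v) ×ˢ Finset.univ)

theorem mem_blocksBelow {N : V → ℕ} {p : V × ℕ × Fin T} : p ∈ blocksBelow T N ↔ p.2.1 < N p.1 := by
  obtain ⟨a, j, i⟩ := p
  simp [blocksBelow]

theorem block_eq_of_blocksBelow {N : V → ℕ} {ω ω' : (gossip T t τ).Coins V}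
    (h : ∀ p ∈ blocksBelow T N, ω p = ω' p) {v : V} {j : ℕ} (hj : j < N v) :
    block ω v j = block ω' v j :=
  funext fun i => h (v, j, i) (mem_blocksBelow.2 hj)

/-- The sampling of witnesses for `u` at nodes that have not heard of `v`. -/
noncomputable def witnessSampling (ht : t ≤ T) (hτ : 1 ≤ τ) (hadv : adv.IsLegal G port) (u v : V) :
    Sampling (V × ℕ × Fin T) t where
  H := (V → Label T) × List ((gossip T t τ).Config V) × (gossip T t τ).Config V
  -- The history reveals all labels in advance. This is harmless, as block 0 is never asked for in
  -- this process.
  hist k ω := (label ω, trace G port adv ω k)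
  -- At most two blocks per step are used at a node, plus one for its label.
  bound k := blocksBelow T fun _ => 2 * k + 1
  hist_eq k ω ω' h := by
    have h0 : ∀ v, label (t := t) (τ := τ) ω v = label (t := t) (τ := τ) ω' v :=
      fun v => block_eq_of_blocksBelow h (by omega)
    refine Prod.ext (funext h0) (trace_congr G port adv h0 k fun v j hj => ?_).symm
    have := flipCount_config G port adv (ω := ω) k v
    exact block_eq_of_blocksBelow h (by omega)
  seen k ω := blocksBelow T fun a => max 1 (flipCount (trace G port adv ω k).2 a)
  hist_eq_of_seen k ω ω' h := by
    have h0 : ∀ v, label (t := t) (τ := τ) ω v = label (t := t) (τ := τ) ω' v :=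
      fun v => block_eq_of_blocksBelow h (by simp)
    refine Prod.ext (funext fun a => (h0 a).symm) (trace_congr G port adv h0 k fun v j hj => ?_)
    exact block_eq_of_blocksBelow h (hj.trans_le (le_max_right _ _))
  seen_congr k ω ω' h := by
    obtain ⟨-, h2⟩ := Prod.mk.inj h
    rw [h2]
  ask k ω := (askAt (label ω) u v (trace G port adv ω k).2
    (adv (trace G port adv ω k).1 (trace G port adv ω k).2)).map fun p => bits V T t p.1 p.2
  ask_congr k ω ω' h := by
    obtain ⟨h1, h2⟩ := Prod.mk.inj h
    rw [h1, h2]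
  ask_new k ω B h := by
    obtain ⟨⟨w, j⟩, hwj, rfl⟩ := Option.map_eq_some_iff.1 h
    refine ⟨Finset.disjoint_left.2 fun p hp hp' => ?_, card_bits ht w j⟩
    obtain ⟨h1, h2, -⟩ := mem_bits.1 hp'
    rw [mem_blocksBelow, h1, h2] at hp
    dsimp only at hp
    -- The inspected block is the first unseen one; the maximum with 1 skips the label of a node
    -- that is still asleep.
    have : j = max 1 (flipCount (trace G port adv ω k).2 w) := by
      unfold askAt at hwj
      split at hwj
      · split at hwj
        · cases hwj
        · obtain ⟨-, hwj⟩ := Option.ite_none_right_eq_some.1 hwj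
          obtain ⟨rfl, rfl⟩ := Prod.mk.inj (Option.some.inj hwj)
          rfl
      · cases hwj
    omega
  good := {ω | Function.Injective (label (t := t) (τ := τ) ω)}
  good_congr k ω ω' h := by
    obtain ⟨h1, -⟩ := Prod.mk.inj h
    change Function.Injective _ ↔ Function.Injective _
    rw [h1]
  tries k ω := (draws (label (t := t) (τ := τ) ω) (logs (config G port adv ω k)) u v).card
  tries_congr k ω ω' h := by
    obtain ⟨h1, h2⟩ := Prod.mk.inj h
    unfold config
    rw [h1, h2]
  hits k ω := (hits (label (t := t) (τ := τ) ω) (logs (config G port adv ω k)) u v).card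
  hits_congr k ω ω' h := by
    obtain ⟨h1, h2⟩ := Prod.mk.inj h
    unfold config
    rw [h1, h2]
  zero ω := by
    have hd : draws (label (t := t) (τ := τ) ω) (logs (config G port adv ω 0)) u v = ∅ := by
      ext z
      have : logs (config G port adv ω 0) z = [] := rfl
      simp [mem_draws, this]
    have hh := hits_subset_draws (label (t := t) (τ := τ) ω) (L := logs (config G port adv ω 0)) u v
    rw [hd, Finset.subset_empty] at hh
    exact ⟨by rw [hd]; rfl, by rw [hh]; rfl⟩
  idle k ω hω h := by
    have h' := (askAt_spec port (valid_config hadv hω hτ k) hω hτ (hadv ω k) u v).1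
      (Option.map_eq_none_iff.1 h)
    exact ⟨congrArg Finset.card h'.1, congrArg Finset.card h'.2⟩
  try_ k ω B hω h := by
    obtain ⟨⟨w, j⟩, hwj, rfl⟩ := Option.map_eq_some_iff.1 h
    have h' := (askAt_spec port (valid_config hadv hω hτ k) hω hτ (hadv ω k) u v).2 w j hwj
    exact ⟨h'.1, fun hb => h'.2.1 (mem_shows_bits.1 hb),
      fun hb => h'.2.2 fun hl => hb (mem_shows_bits.2 hl)⟩

/-- The sampling of candidates, with the nodes listed by `e`. -/
noncomputable def candidateSampling (ht : t ≤ T) {n : ℕ} (e : V ≃ Fin n) :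
    Sampling (V × ℕ × Fin T) t where
  H := V → Label T
  hist k ω v := if (e v).val < k then fun i => ω (v, 0, i) else fun _ => true
  bound k := blocksBelow T fun v => if (e v).val < k then 1 else 0
  hist_eq k ω ω' h := by
    funext v
    split_ifs with hv
    · exact funext fun i => h (v, 0, i) (mem_blocksBelow.2 (by simp [hv]))
    · rfl
  seen k _ := blocksBelow T fun v => if (e v).val < k then 1 else 0
  hist_eq_of_seen k ω ω' h := by
    funext v
    split_ifs with hv
    · exact funext fun i => (h (v, 0, i) (mem_blocksBelow.2 (by simp [hv]))).symm
    · rfl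
  seen_congr _ _ _ _ := rfl
  ask k _ := if h : k < n then some (bits V T t (e.symm ⟨k, h⟩) 0) else none
  ask_congr _ _ _ _ := rfl
  ask_new k ω B h := by
    split_ifs at h with hk
    · obtain rfl := Option.some.inj h
      refine ⟨Finset.disjoint_left.2 fun p hp hp' => ?_, card_bits ht _ _⟩
      obtain ⟨h1, h2, -⟩ := mem_bits.1 hp'
      rw [mem_blocksBelow, h1] at hp
      simp at hp
  good := Set.univ
  good_congr _ _ _ _ := by simp
  tries k _ := min k n
  tries_congr _ _ _ _ := rfl
  hits k ω := open Classical in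
    (Finset.univ.filter fun v => (e v).val < k ∧ Lucky t (fun i : Fin T => ω (v, 0, i))).card
  hits_congr k ω ω' h := by
    congr 1
    ext v
    simp only [Finset.mem_filter, Finset.mem_univ, true_and]
    refine and_congr_right fun hv => ?_
    have := congrFun h v
    simp only [if_pos hv] at this
    rw [this]
  zero ω := by simp
  idle k ω _ h := by
    have hk : ¬ k < n := fun hk => by simp [hk] at h
    refine ⟨by omega, ?_⟩
    congr 1
    ext v
    have := (e v).isLt
    simp only [Finset.mem_filter, Finset.mem_univ, true_and]
    refine and_congr_left fun _ => ?_
    omega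
  try_ k ω B _ h := by
    classical
    have hk : k < n := by by_contra hk; simp [hk] at h
    rw [dif_pos hk] at h
    obtain rfl := Option.some.inj h
    have hiff : ω ∈ Shows (bits V T t (e.symm ⟨k, hk⟩) 0) (fun _ => true) ↔
        Lucky t (fun i : Fin T => ω (e.symm ⟨k, hk⟩, 0, i)) :=
      mem_shows_bits (t := t) (τ := 0) (ω := ω)
    have hv : ∀ v, (e v).val < k + 1 ↔ (v = e.symm ⟨k, hk⟩ ∨ (e v).val < k) := by
      intro v
      rw [Equiv.eq_symm_apply, Fin.ext_iff]
      simp only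
      omega
    refine ⟨by omega, fun hb => ?_, fun hb => ?_⟩
    · rw [← Finset.card_insert_of_notMem (a := e.symm ⟨k, hk⟩) (by simp)]
      congr 1
      ext v
      simp only [Finset.mem_filter, Finset.mem_univ, true_and, Finset.mem_insert, hv]
      constructor
      · rintro ⟨h1 | h1, h2⟩
        · exact Or.inl h1
        · exact Or.inr ⟨h1, h2⟩
      · rintro (rfl | ⟨h1, h2⟩)
        · exact ⟨Or.inl rfl, hiff.1 hb⟩
        · exact ⟨Or.inr h1, h2⟩
    · congr 1
      ext v
      simp only [Finset.mem_filter, Finset.mem_univ, true_and, hv]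
      constructor
      · rintro ⟨rfl | h1, h2⟩
        · exact absurd (hiff.2 h2) hb
        · exact ⟨h1, h2⟩
      · rintro ⟨h1, h2⟩
        exact ⟨Or.inr h1, h2⟩

/-- Two nodes rarely get the same label. -/
theorem measure_label_eq {u v : V} (huv : u ≠ v) :
    fairCoins (V × ℕ × Fin T) {ω | ∀ i, ω (u, 0, i) = ω (v, 0, i)} ≤ (2⁻¹ : ℝ≥0∞) ^ T := by
  classical
  have hsub : {ω : V × ℕ × Fin T → Bool | ∀ i, ω (u, 0, i) = ω (v, 0, i)} ⊆
      ⋃ b ∈ (Finset.univ : Finset (Label T)), Shows (bits V T T u 0) (fun p => b p.2.2) ∩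
        Shows (bits V T T v 0) (fun p => b p.2.2) := by
    intro ω hω
    simp only [Set.mem_iUnion, Finset.mem_univ, exists_prop, true_and]
    refine ⟨fun i => ω (u, 0, i), ?_, ?_⟩
    · rintro ⟨a, j, i⟩ hp
      obtain ⟨rfl, rfl, -⟩ := mem_bits.1 hp
      rfl
    · rintro ⟨a, j, i⟩ hp
      obtain ⟨rfl, rfl, -⟩ := mem_bits.1 hp
      exact (hω i).symm
  have hd : Disjoint (bits V T T u 0) (bits V T T v 0) :=
    Finset.disjoint_left.2 fun p h h' => huv ((mem_bits.1 h).1.symm.trans (mem_bits.1 h').1)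
  refine (measure_mono hsub).trans ((measure_biUnion_finset_le _ _).trans (le_of_eq ?_))
  have : ∀ b ∈ (Finset.univ : Finset (Label T)), fairCoins (V × ℕ × Fin T)
      (Shows (bits V T T u 0) (fun p => b p.2.2) ∩ Shows (bits V T T v 0) (fun p => b p.2.2)) =
      (2⁻¹ : ℝ≥0∞) ^ T * (2⁻¹ : ℝ≥0∞) ^ T := by
    intro b _
    rw [fairCoins_inter_shows (dependsOnCoins_shows _ _) hd, fairCoins_shows, card_bits le_rfl,
      card_bits le_rfl]
  -- There are 2^T common labels, each taken by both nodes with probability 2^(-2T).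
  rw [Finset.sum_congr rfl this, Finset.sum_const, nsmul_eq_mul, ← mul_assoc]
  simp only [Finset.card_univ, Fintype.card_pi, Fintype.card_bool, Finset.prod_const,
    Fintype.card_fin, Nat.cast_pow, Nat.cast_ofNat]
  rw [← mul_pow, ENNReal.mul_inv_cancel (by norm_num) (by norm_num), one_pow, one_mul]

end Gossip

/-! ### Chernoff bounds for adaptive sampling. -/

namespace Sampling

variable {ι : Type} [DecidableEq ι] {t : ℕ} (X : Sampling ι t)

theorem step_cases {ω : ι → Bool} (hω : ω ∈ X.good) (k : ℕ) :
    (X.tries (k + 1) ω = X.tries k ω ∧ X.hits (k + 1) ω = X.hits k ω) ∨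
      (X.tries (k + 1) ω = X.tries k ω + 1 ∧ X.hits k ω ≤ X.hits (k + 1) ω) := by
  cases h : X.ask k ω with
  | none => exact Or.inl (X.idle k ω hω h)
  | some B =>
    obtain ⟨h1, h2, h3⟩ := X.try_ k ω B hω h
    refine Or.inr ⟨h1, ?_⟩
    by_cases hB : ω ∈ Shows B (fun _ => true)
    · rw [h2 hB]; omega
    · rw [h3 hB]

theorem hits_mono {ω : ι → Bool} (hω : ω ∈ X.good) : Monotone fun k => X.hits k ω :=
  monotone_nat_of_le_succ fun k => by
    rcases X.step_cases hω k with h | h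
    · exact h.2.ge
    · exact h.2

/-- The exponential tail bound for adaptive sampling. -/
theorem measure_le_exp {a : ℝ} (ha : 0 < a) (δ : ℝ) (k : ℕ) :
    fairCoins ι (X.good ∩ {ω | δ ≤ Real.log a * X.hits k ω -
      (2⁻¹ : ℝ) ^ t * (a - 1) * X.tries k ω}) ≤ ENNReal.ofReal (Real.exp (-δ)) := by
  refine X.measure_le ha (Real.exp_pos _) k (fun ω ω' h hω => ?_) fun ω _ hω => ?_
  · change δ ≤ _ at hω
    change δ ≤ _
    rwa [← X.hits_congr k ω ω' h, ← X.tries_congr k ω ω' h]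
  · have hq1 : (2⁻¹ : ℝ) ^ t ≤ 1 := pow_le_one₀ (by norm_num) (by norm_num)
    have hq0 : (0 : ℝ) < (2⁻¹ : ℝ) ^ t := by positivity
    have hg0 : 0 < 1 + (2⁻¹ : ℝ) ^ t * (a - 1) := by nlinarith [mul_pos hq0 ha]
    have hg1 : 1 + (2⁻¹ : ℝ) ^ t * (a - 1) ≤ Real.exp ((2⁻¹ : ℝ) ^ t * (a - 1)) := by
      linarith [Real.add_one_le_exp ((2⁻¹ : ℝ) ^ t * (a - 1))]
    have he : Real.exp (Real.log a * X.hits k ω - (2⁻¹ : ℝ) ^ t * (a - 1) * X.tries k ω) =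
        a ^ X.hits k ω * ((Real.exp ((2⁻¹ : ℝ) ^ t * (a - 1)))⁻¹) ^ X.tries k ω := by
      rw [sub_eq_add_neg, Real.exp_add, mul_comm (Real.log a), Real.exp_nat_mul, Real.exp_log ha,
        Real.exp_neg, mul_comm _ (X.tries k ω : ℝ), Real.exp_nat_mul, inv_pow (Real.exp _)]
    rw [Real.exp_neg, inv_inv]
    refine (Real.exp_le_exp.2 hω).trans ?_
    rw [he]
    gcongr

end Sampling

theorem measure_iUnion_le_card {Ω α : Type*} [MeasurableSpace Ω] (μ : Measure Ω) [Fintype α]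
    {s : α → Set Ω} {b : ℝ≥0∞} (h : ∀ a, μ (s a) ≤ b) : μ (⋃ a, s a) ≤ Fintype.card α * b := by
  refine (measure_iUnion_fintype_le μ s).trans ((Finset.sum_le_sum fun a _ => h a).trans ?_)
  rw [Finset.sum_const, nsmul_eq_mul, Finset.card_univ]

/-- Bounds uniform in the number of steps extend to the whole unbounded execution by continuity from
below. -/
theorem measure_iUnion_le_of_monotone {Ω : Type*} [MeasurableSpace Ω] (μ : Measure Ω)
    {s : ℕ → Set Ω} (hs : Monotone s) {b : ℝ≥0∞} (h : ∀ k, μ (s k) ≤ b) : μ (⋃ k, s k) ≤ b := by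
  rw [hs.measure_iUnion]
  exact iSup_le h

theorem two_fifths_le_log : (2 / 5 : ℝ) ≤ Real.log (3 / 2) := by
  have h : (2 : ℝ) ≤ Real.log ((3 / 2) ^ 5) := by
    rw [Real.le_log_iff_exp_le (by norm_num), show (2 : ℝ) = 1 + 1 by norm_num, Real.exp_add]
    have h1 := Real.exp_one_lt_d9
    have h2 := Real.exp_pos 1
    nlinarith
  rw [Real.log_pow] at h
  norm_num at h
  linarith

theorem neg_le_log_three_quarters : -(3 / 10 : ℝ) ≤ Real.log (3 / 4) := by
  rw [Real.le_log_iff_exp_le (by norm_num), Real.exp_neg]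
  have := Real.quadratic_le_exp_of_nonneg (x := 3 / 10) (by norm_num)
  rw [inv_le_comm₀ (Real.exp_pos _) (by norm_num)]
  linarith

/-! ### The failure probability. -/

namespace Gossip

open Protocol

variable {V : Type} {T t τ : ℕ} [Fintype V] [DecidableEq V] {G : SimpleGraph V}
  [DecidableRel G.Adj] {port : V → V → ℕ} {adv : Adversary (gossip T t τ) V}

theorem card_draws_lt (lab : V → Label T) (L : V → List (Rumor T)) (u v : V) :
    (draws lab L u v).card + 1 ≤ Fintype.card V := by
  rw [← Finset.card_univ, ← Finset.card_erase_add_one (Finset.mem_univ u)]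
  exact Nat.succ_le_succ (Finset.card_le_card fun z hz =>
    Finset.mem_erase.2 ⟨(mem_draws.1 hz).1, Finset.mem_univ z⟩)

/-- The expected number of lucky nodes. -/
noncomputable def rate (V : Type) [Fintype V] (t : ℕ) : ℝ := (2⁻¹ : ℝ) ^ t * Fintype.card V

theorem rate_nonneg : 0 ≤ rate V t := by unfold rate; positivity

section Tails

variable (ht : t ≤ T) (hτ : 1 ≤ τ) (hadv : adv.IsLegal G port)
include ht hτ hadv

/-- Two candidates rarely both get enough witnesses that have heard of them first. -/
theorem measure_split_le (hr : 3 / 4 * rate V t ≤ τ) {u v : V} (huv : u ≠ v) :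
    fairCoins (V × ℕ × Fin T) (⋃ k, {ω | Function.Injective (label (t := t) (τ := τ) ω) ∧
      τ ≤ (hits (label (t := t) (τ := τ) ω) (logs (config G port adv ω k)) u v).card ∧
      τ ≤ (hits (label (t := t) (τ := τ) ω) (logs (config G port adv ω k)) v u).card}) ≤
    2 * ENNReal.ofReal (Real.exp (-(rate V t / 50))) := by
  let X := witnessSampling ht hτ hadv u v
  let Y := witnessSampling ht hτ hadv v u
  refine measure_iUnion_le_of_monotone _ ?_ fun k => ?_
  -- Hits are never lost, so the failures at successive steps form an increasing sequence.
  · rintro i j hij ω ⟨h1, h2, h3⟩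
    exact ⟨h1, h2.trans (X.hits_mono (ω := ω) h1 hij), h3.trans (Y.hits_mono (ω := ω) h1 hij)⟩
  rw [two_mul]
  refine le_trans ?_ (add_le_add (X.measure_le_exp (a := 3 / 2) (by norm_num) _ k)
    (Y.measure_le_exp (a := 3 / 2) (by norm_num) _ k))
  refine (measure_mono ?_).trans (measure_union_le _ _)
  rintro ω ⟨h1, h2, h3⟩
  have hq : (0 : ℝ) < (2⁻¹ : ℝ) ^ t := by positivity
  have hd := Finset.card_union_of_disjoint
    (disjoint_draws (label (t := t) (τ := τ) ω) (L := logs (config G port adv ω k)) h1 huv)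
  have hle := Finset.card_le_univ (draws (label (t := t) (τ := τ) ω) (logs (config G port adv ω k)) u v ∪
    draws (label (t := t) (τ := τ) ω) (logs (config G port adv ω k)) v u)
  rw [hd] at hle
  -- With `a = 3/2` the exponent is at least (2/5)(3/4) - 1/4 = 1/20 times `rate`, which exceeds the
  -- required 1/50.
  have key : ∀ h r : ℕ, τ ≤ h → 2 * r ≤ Fintype.card V → rate V t / 50 ≤
      Real.log (3 / 2) * h - (2⁻¹ : ℝ) ^ t * (3 / 2 - 1) * r := by
    intro h r hh hr'
    have e1 : (τ : ℝ) ≤ h := by exact_mod_cast hh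
    have e2 : (2 : ℝ) * r ≤ Fintype.card V := by exact_mod_cast hr'
    have e3 : (2⁻¹ : ℝ) ^ t * (2 * r) ≤ rate V t := mul_le_mul_of_nonneg_left e2 hq.le
    have e4 : (2 / 5 : ℝ) * h ≤ Real.log (3 / 2) * h :=
      mul_le_mul_of_nonneg_right two_fifths_le_log (by positivity)
    have := rate_nonneg (V := V) (t := t)
    linarith
  by_cases hc : 2 * (draws (label (t := t) (τ := τ) ω) (logs (config G port adv ω k)) u v).card ≤
      Fintype.card V
  · exact Or.inl ⟨h1, key _ _ h2 hc⟩
  · exact Or.inr ⟨h1, key _ _ h3 (by change 2 * (draws _ _ _ _).card ≤ _; omega)⟩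

/-- A candidate rarely gets many witnesses. -/
theorem measure_many_hits_le {U : ℕ} (hU : 3 * rate V t ≤ U) (u : V) :
    fairCoins (V × ℕ × Fin T) (⋃ k, {ω | Function.Injective (label (t := t) (τ := τ) ω) ∧
      U < (hits (label (t := t) (τ := τ) ω) (logs (config G port adv ω k)) u u).card}) ≤
    ENNReal.ofReal (Real.exp (-(rate V t / 50))) := by
  let X := witnessSampling ht hτ hadv u u
  refine measure_iUnion_le_of_monotone _ ?_ fun k => ?_
  · rintro i j hij ω ⟨h1, h2⟩
    exact ⟨h1, h2.trans_le (X.hits_mono (ω := ω) h1 hij)⟩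
  refine le_trans (measure_mono ?_) (X.measure_le_exp (a := 2) (by norm_num) _ k)
  rintro ω ⟨h1, h2⟩
  refine ⟨h1, ?_⟩
  have hr : X.tries k ω ≤ Fintype.card V := Finset.card_le_univ _
  have e1 : (U : ℝ) ≤ X.hits k ω := by exact_mod_cast h2.le
  have e2 : (X.tries k ω : ℝ) ≤ Fintype.card V := by exact_mod_cast hr
  have e3 : (2⁻¹ : ℝ) ^ t * X.tries k ω ≤ rate V t :=
    mul_le_mul_of_nonneg_left e2 (by positivity)
  have e4 : (0.6931471803 : ℝ) * X.hits k ω ≤ Real.log 2 * X.hits k ω :=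
    mul_le_mul_of_nonneg_right Real.log_two_gt_d9.le (by positivity)
  have := rate_nonneg (V := V) (t := t)
  change rate V t / 50 ≤ _
  linarith

/-- When all other nodes know about a candidate, it rarely has few witnesses. -/
theorem measure_few_hits_le (hr : τ = ⌈3 / 4 * rate V t⌉₊) (hn : 50 ≤ Fintype.card V) (u : V) :
    fairCoins (V × ℕ × Fin T) (⋃ k, {ω | Function.Injective (label (t := t) (τ := τ) ω) ∧
      Fintype.card V ≤ (draws (label (t := t) (τ := τ) ω) (logs (config G port adv ω k)) u u).card + 1 ∧
      (hits (label (t := t) (τ := τ) ω) (logs (config G port adv ω k)) u u).card < τ}) ≤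
    ENNReal.ofReal (Real.exp (-(rate V t / 50))) := by
  let X := witnessSampling ht hτ hadv u u
  have hX : ∀ k ω, X.tries k ω + 1 ≤ Fintype.card V := fun k ω => card_draws_lt _ _ _ _
  refine measure_iUnion_le_of_monotone _ (monotone_nat_of_le_succ ?_) fun k => ?_
  -- Once all other nodes have been sampled no further try is possible, so the hits are frozen and
  -- the event persists.
  · rintro k ω ⟨h1, h2, h3⟩
    rcases X.step_cases (ω := ω) h1 k with h | h
    · exact ⟨h1, h2.trans_eq (congrArg (· + 1) h.1.symm), h.2.trans_lt h3⟩
    · have := hX (k + 1) ω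
      change _ ≤ X.tries k ω + 1 at h2
      omega
  refine le_trans (measure_mono ?_) (X.measure_le_exp (a := 3 / 4) (by norm_num) _ k)
  rintro ω ⟨h1, h2, h3⟩
  refine ⟨h1, ?_⟩
  have h3' : X.hits k ω < ⌈3 / 4 * rate V t⌉₊ := hr ▸ h3
  have e1 := (Nat.lt_ceil.1 h3').le
  have e2 : (Fintype.card V : ℝ) ≤ X.tries k ω + 1 := by exact_mod_cast h2
  have hq : (0 : ℝ) < (2⁻¹ : ℝ) ^ t := by positivity
  have e3 : rate V t ≤ (2⁻¹ : ℝ) ^ t * (X.tries k ω + 1) := mul_le_mul_of_nonneg_left e2 hq.le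
  have e4 : -(3 / 10 : ℝ) * X.hits k ω ≤ Real.log (3 / 4) * X.hits k ω :=
    mul_le_mul_of_nonneg_right neg_le_log_three_quarters (by positivity)
  -- The candidate itself is not sampled, which costs 2^(-t), at most `rate / 50`. The exponent is
  -- then at least (49/50)/4 - (3/10)(3/4) = 1/50 times `rate`; this is where the constant 50 comes
  -- from.
  have e5 : (2⁻¹ : ℝ) ^ t * 50 ≤ rate V t :=
    mul_le_mul_of_nonneg_left (by exact_mod_cast hn) hq.le
  change rate V t / 50 ≤ _
  linarith

end Tails

section Candidates

variable (ht : t ≤ T)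
include ht

/-- Here all `n` nodes are sampled once and `a = 2`: the exponent is at least 3 log 2 - 1 > 1/50
times `rate`. -/
theorem measure_many_lucky_le {U : ℕ} (hU : 3 * rate V t ≤ U) :
    fairCoins (V × ℕ × Fin T) {ω | U < (luckyNodes (t := t) (τ := τ) ω).card} ≤
    ENNReal.ofReal (Real.exp (-(rate V t / 50))) := by
  classical
  let e := Fintype.equivFin V
  let X := candidateSampling ht e
  refine le_trans (measure_mono ?_)
    (X.measure_le_exp (a := 2) (by norm_num) _ (Fintype.card V))
  intro ω h2
  refine ⟨trivial, ?_⟩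
  have hh : X.hits (Fintype.card V) ω = (luckyNodes (t := t) (τ := τ) ω).card := by
    refine congrArg Finset.card (Finset.ext fun v => ?_)
    rw [mem_luckyNodes, Finset.mem_filter]
    exact ⟨fun h => h.2.2, fun h => ⟨Finset.mem_univ v, (e v).isLt, h⟩⟩
  have hr : X.tries (Fintype.card V) ω = Fintype.card V := min_self _
  change rate V t / 50 ≤ _
  rw [hh, hr]
  have e1 : (U : ℝ) ≤ (luckyNodes (t := t) (τ := τ) ω).card := by
    exact_mod_cast (show U < _ from h2).le
  have e4 : (0.6931471803 : ℝ) * (luckyNodes (t := t) (τ := τ) ω).card ≤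
      Real.log 2 * (luckyNodes (t := t) (τ := τ) ω).card :=
    mul_le_mul_of_nonneg_right Real.log_two_gt_d9.le (by positivity)
  have := rate_nonneg (V := V) (t := t)
  have e5 : (2⁻¹ : ℝ) ^ t * (2 - 1) * Fintype.card V = rate V t := by unfold rate; ring
  linarith

/-- With `a = 1/2` and no hits, the exponent is `rate / 2`. -/
theorem measure_no_lucky_le :
    fairCoins (V × ℕ × Fin T) {ω | luckyNodes (t := t) (τ := τ) ω = ∅} ≤
    ENNReal.ofReal (Real.exp (-(rate V t / 50))) := by
  classical
  let e := Fintype.equivFin V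
  let X := candidateSampling ht e
  refine le_trans (measure_mono ?_)
    (X.measure_le_exp (a := 1 / 2) (by norm_num) _ (Fintype.card V))
  intro ω h2
  refine ⟨trivial, ?_⟩
  have hh : X.hits (Fintype.card V) ω = (luckyNodes (t := t) (τ := τ) ω).card := by
    refine congrArg Finset.card (Finset.ext fun v => ?_)
    rw [mem_luckyNodes, Finset.mem_filter]
    exact ⟨fun h => h.2.2, fun h => ⟨Finset.mem_univ v, (e v).isLt, h⟩⟩
  have hr : X.tries (Fintype.card V) ω = Fintype.card V := min_self _
  change rate V t / 50 ≤ _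
  rw [hh, hr, show luckyNodes (t := t) (τ := τ) ω = ∅ from h2]
  have := rate_nonneg (V := V) (t := t)
  have e5 : (2⁻¹ : ℝ) ^ t * (1 / 2 - 1) * Fintype.card V = -(rate V t) / 2 := by unfold rate; ring
  rw [e5]
  simp only [Finset.card_empty, Nat.cast_zero, mul_zero]
  linarith

end Candidates

/-- The outcomes of the coin flips for which the election works. -/
structure Good (G : SimpleGraph V) [DecidableRel G.Adj] (port : V → V → ℕ)
    (adv : Adversary (gossip T t τ) V) (U : ℕ) (ω : (gossip T t τ).Coins V) : Prop where
  injective : Function.Injective (label ω)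
  nonempty : luckyNodes ω ≠ ∅
  card_le : (luckyNodes ω).card ≤ U
  noSplit : ∀ k, NoSplit (label ω) τ (logs (config G port adv ω k))
  hits_le : ∀ k u, (hits (label ω) (logs (config G port adv ω k)) u u).card ≤ U
  le_hits : ∀ k u, (∀ z, z ≠ u → z ∈ draws (label ω) (logs (config G port adv ω k)) u u) →
    τ ≤ (hits (label ω) (logs (config G port adv ω k)) u u).card

/-- The union bound has pairs for label collisions and splits, nodes for too many or too few
witnesses, and two single events for the candidates. The split bound contributes 2 and the four
other tails 1 each to the factor 6. -/
theorem measure_not_good_le (ht : t ≤ T) (hτ : 1 ≤ τ) (hadv : adv.IsLegal G port)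
    (hr : τ = ⌈3 / 4 * rate V t⌉₊) (hn : 50 ≤ Fintype.card V) {U : ℕ} (hU : 3 * rate V t ≤ U) :
    fairCoins (V × ℕ × Fin T) {ω | ¬ Good G port adv U ω} ≤
      (Fintype.card V : ℝ≥0∞) ^ 2 * (2⁻¹ : ℝ≥0∞) ^ T +
        6 * (Fintype.card V : ℝ≥0∞) ^ 2 * ENNReal.ofReal (Real.exp (-(rate V t / 50))) := by
  set n : ℝ≥0∞ := (Fintype.card V : ℝ≥0∞)
  set b := ENNReal.ofReal (Real.exp (-(rate V t / 50)))
  have hn1 : 1 ≤ n := by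
    have : (1 : ℕ) ≤ Fintype.card V := by omega
    exact Nat.one_le_cast.2 this
  have hV2 : ((Fintype.card (V × V) : ℕ) : ℝ≥0∞) = n ^ 2 := by
    rw [Fintype.card_prod, Nat.cast_mul, sq]
  have m1 := measure_iUnion_le_card (fairCoins (V × ℕ × Fin T)) (b := (2⁻¹ : ℝ≥0∞) ^ T)
    (s := fun p : V × V => {ω | p.1 ≠ p.2 ∧ ∀ i, ω (p.1, 0, i) = ω (p.2, 0, i)}) fun p => by
      by_cases hp : p.1 = p.2
      · simp [hp]
      · exact (measure_mono fun ω h => h.2).trans (measure_label_eq hp)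
  have m2 := measure_iUnion_le_card (fairCoins (V × ℕ × Fin T)) (b := 2 * b)
    (s := fun p : V × V => {ω | p.1 ≠ p.2 ∧
      ω ∈ (⋃ k, {ω | Function.Injective (label (t := t) (τ := τ) ω) ∧
      τ ≤ (hits (label (t := t) (τ := τ) ω) (logs (config G port adv ω k)) p.1 p.2).card ∧
      τ ≤ (hits (label (t := t) (τ := τ) ω) (logs (config G port adv ω k)) p.2 p.1).card})}) fun p => by
      by_cases hp : p.1 = p.2
      · simp [hp]
      · exact (measure_mono fun ω h => h.2).trans
          (measure_split_le ht hτ hadv (u := p.1) (v := p.2) (hr ▸ Nat.le_ceil _) hp)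
  have m3 := measure_iUnion_le_card _ (measure_many_hits_le ht hτ hadv hU)
  have m4 := measure_iUnion_le_card _ (measure_few_hits_le ht hτ hadv hr hn)
  have m5 := measure_many_lucky_le (τ := τ) ht hU
  have m6 := measure_no_lucky_le (V := V) (τ := τ) ht
  rw [hV2] at m1 m2
  refine (measure_mono ?_).trans <| (measure_union_le _ _).trans <| (add_le_add m1 <|
    (measure_union_le _ _).trans <| add_le_add m2 <|
    (measure_union_le _ _).trans <| add_le_add m3 <|
    (measure_union_le _ _).trans <| add_le_add m4 <|
    (measure_union_le _ _).trans <| add_le_add m5 m6).trans ?_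
  · intro ω hω
    by_contra hc
    simp only [Set.mem_union, Set.mem_iUnion, not_or, not_exists] at hc
    obtain ⟨c1, c2, c3, c4, c5, c6⟩ := hc
    have hinj : Function.Injective (label (t := t) (τ := τ) ω) := fun u v huv => by
      by_contra hne
      exact c1 (u, v) ⟨hne, fun i => congrFun huv i⟩
    refine hω (show Good G port adv U ω from ⟨hinj, c6, not_lt.1 c5, fun k u v huv h => ?_,
      fun k u => ?_, fun k u hz => ?_⟩)
    · exact c2 (u, v) ⟨huv, k, hinj, h⟩
    · by_contra h
      exact c3 u k ⟨hinj, not_le.1 h⟩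
    · by_contra h
      refine c4 u k ⟨hinj, ?_, not_le.1 h⟩
      rw [← Finset.card_univ, ← Finset.card_erase_add_one (Finset.mem_univ u)]
      exact Nat.succ_le_succ (Finset.card_le_card fun z hz' => hz z (Finset.mem_erase.1 hz').1)
  · gcongr
    have h1 : n ≤ n ^ 2 := by
      calc n = n * 1 := (mul_one n).symm
        _ ≤ n * n := by gcongr
        _ = n ^ 2 := (sq n).symm
    have h2 : b ≤ n ^ 2 * b := by
      calc b = 1 * b := (one_mul b).symm
        _ ≤ n ^ 2 * b := by gcongr; exact hn1.trans h1
    calc n ^ 2 * (2 * b) + (n * b + (n * b + (b + b)))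
        ≤ n ^ 2 * (2 * b) + (n ^ 2 * b + (n ^ 2 * b + (n ^ 2 * b + n ^ 2 * b))) := by gcongr
      _ = 6 * n ^ 2 * b := by ring

end Gossip

namespace Gossip

open Protocol

/-! ### The parameters -/

/-- `t` such that about `a` out of `n` nodes are lucky. -/
def luckExponent (a n : ℕ) : ℕ := Nat.log 2 (n / a)

/-- The number of witnesses a candidate needs. -/
noncomputable def threshold (t n : ℕ) : ℕ := ⌈3 / 4 * ((2⁻¹ : ℝ) ^ t * n)⌉₊

/-- Rounding the exponent down to an integer loses at most a factor 2 against the target `a`. -/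
theorem le_rate {a n : ℕ} (ha : 0 < a) (h : a ≤ n) :
    (a : ℝ) ≤ (2⁻¹ : ℝ) ^ luckExponent a n * n ∧
      (2⁻¹ : ℝ) ^ luckExponent a n * n ≤ 2 * a := by
  have h0 : n / a ≠ 0 := (Nat.div_pos h ha).ne'
  have h1 : 2 ^ luckExponent a n * a ≤ n :=
    (Nat.le_div_iff_mul_le ha).1 (Nat.pow_log_le_self 2 h0)
  have h2 : n < 2 ^ (luckExponent a n + 1) * a :=
    (Nat.div_lt_iff_lt_mul ha).1 (Nat.lt_pow_succ_log_self one_lt_two _)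
  have h1' : (2 : ℝ) ^ luckExponent a n * a ≤ n := by exact_mod_cast h1
  have h2' : (n : ℝ) ≤ 2 ^ (luckExponent a n + 1) * a := by exact_mod_cast h2.le
  have hp : (0 : ℝ) < 2 ^ luckExponent a n := by positivity
  rw [inv_pow, inv_mul_eq_div]
  constructor
  · rw [le_div_iff₀ hp]; linarith
  · rw [div_le_iff₀ hp]; rw [pow_succ] at h2'; linarith

theorem luckExponent_le (a n : ℕ) : luckExponent a n ≤ Nat.log 2 n :=
  Nat.log_mono_right (Nat.div_le_self n a)

theorem sq_le_two_pow {l : ℕ} (h : 4 ≤ l) : l ^ 2 ≤ 2 ^ l := by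
  induction l, h using Nat.le_induction with
  | base => norm_num
  | succ l h ih => rw [pow_succ 2 l]; nlinarith

/-- Label collisions contribute n^(-C-2) and the tails 6 n^(-C-4); together these are at most
n^(-C). -/
theorem failure_le {n C T : ℕ} {c r : ℝ} (hn : 3 ≤ n) (hc : c ≤ C)
    (hT : (C + 4) * (Nat.log 2 n + 1) ≤ T) (hr : (C + 6) * (Nat.log 2 n + 1) ≤ r / 50) :
    (n : ℝ) ^ 2 * (2⁻¹ : ℝ) ^ T + 6 * (n : ℝ) ^ 2 * Real.exp (-(r / 50)) ≤ 1 / (n : ℝ) ^ c := by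
  have hn0 : (3 : ℝ) ≤ n := by exact_mod_cast hn
  have hn1 : (0 : ℝ) < n := by linarith
  have hlt : (n : ℝ) ≤ 2 ^ (Nat.log 2 n + 1) := by
    exact_mod_cast (Nat.lt_pow_succ_log_self one_lt_two n).le
  have h1 : (2⁻¹ : ℝ) ^ T ≤ ((n : ℝ) ^ (C + 4))⁻¹ := by
    rw [inv_pow]
    refine inv_anti₀ (by positivity) ?_
    calc (n : ℝ) ^ (C + 4) ≤ (2 ^ (Nat.log 2 n + 1)) ^ (C + 4) := by gcongr
      _ = 2 ^ ((C + 4) * (Nat.log 2 n + 1)) := by rw [← pow_mul, mul_comm]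
      _ ≤ 2 ^ T := pow_le_pow_right₀ (by norm_num) hT
  have h2 : Real.exp (-(r / 50)) ≤ ((n : ℝ) ^ (C + 6))⁻¹ := by
    rw [Real.exp_neg]
    refine inv_anti₀ (by positivity) ?_
    have h2e : (2 : ℝ) ≤ Real.exp 1 := by linarith [Real.add_one_le_exp 1]
    calc (n : ℝ) ^ (C + 6) ≤ (2 ^ (Nat.log 2 n + 1)) ^ (C + 6) := by gcongr
      _ ≤ (Real.exp 1 ^ (Nat.log 2 n + 1)) ^ (C + 6) := by gcongr
      _ = Real.exp ((C + 6) * (Nat.log 2 n + 1)) := by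
        rw [← pow_mul, ← Real.exp_nat_mul]
        congr 1
        push_cast
        ring
      _ ≤ _ := Real.exp_le_exp.2 hr
  have h3 : (1 : ℝ) / (n : ℝ) ^ C ≤ 1 / (n : ℝ) ^ c := by
    rw [← Real.rpow_natCast]
    refine one_div_le_one_div_of_le (by positivity) ?_
    exact Real.rpow_le_rpow_of_exponent_le (by linarith) hc
  refine le_trans ?_ h3
  calc (n : ℝ) ^ 2 * (2⁻¹ : ℝ) ^ T + 6 * (n : ℝ) ^ 2 * Real.exp (-(r / 50))
      ≤ (n : ℝ) ^ 2 * ((n : ℝ) ^ (C + 4))⁻¹ + 6 * (n : ℝ) ^ 2 * ((n : ℝ) ^ (C + 6))⁻¹ := by gcongr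
    _ = (1 / (n : ℝ) ^ C) * ((n ^ 2 + 6) / (n : ℝ) ^ 4) := by
      field_simp
      ring
    _ ≤ (1 / (n : ℝ) ^ C) * 1 := by
      gcongr
      rw [div_le_one (by positivity)]
      have hn9 : (9 : ℝ) ≤ (n : ℝ) ^ 2 := by nlinarith
      nlinarith
    _ = _ := mul_one _

theorem log_le_two_mul_log {n : ℕ} (hn : n ≠ 0) : (Nat.log 2 n : ℝ) ≤ 2 * Real.log n := by
  have h : ((2 : ℝ)) ^ Nat.log 2 n ≤ n := by exact_mod_cast Nat.pow_log_le_self 2 hn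
  have h1 := Real.log_le_log (by positivity) h
  rw [Real.log_pow] at h1
  have h2 := Real.log_two_gt_d9
  have h3 : (0 : ℝ) ≤ Nat.log 2 n := by positivity
  nlinarith

theorem card_rumor_le {C n : ℕ} (hn : 10 ≤ n) (hl : 1 ≤ Nat.log 2 n) :
    Fintype.card (Rumor ((C + 4) * (Nat.log 2 n + 1))) ≤ n ^ (6 * (C + 4) + 1) := by
  have h : 2 ^ ((C + 4) * (Nat.log 2 n + 1)) ≤ n ^ (2 * (C + 4)) := by
    calc 2 ^ ((C + 4) * (Nat.log 2 n + 1)) ≤ 2 ^ (Nat.log 2 n * (2 * (C + 4))) :=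
          Nat.pow_le_pow_right two_pos (by nlinarith)
      _ = (2 ^ Nat.log 2 n) ^ (2 * (C + 4)) := pow_mul _ _ _
      _ ≤ n ^ (2 * (C + 4)) := Nat.pow_le_pow_left (Nat.pow_log_le_self 2 (by omega)) _
  refine Rumor.card_le.trans ?_
  have h1 : 1 ≤ n ^ (2 * (C + 4)) := Nat.one_le_pow _ _ (by omega)
  calc 5 * (2 ^ ((C + 4) * (Nat.log 2 n + 1)) * (2 ^ ((C + 4) * (Nat.log 2 n + 1)) *
        (2 ^ ((C + 4) * (Nat.log 2 n + 1)) + 1)))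
      ≤ 5 * (n ^ (2 * (C + 4)) * (n ^ (2 * (C + 4)) * (n ^ (2 * (C + 4)) + n ^ (2 * (C + 4))))) := by
        gcongr
    _ = 10 * n ^ (6 * (C + 4)) := by ring
    _ ≤ n * n ^ (6 * (C + 4)) := by gcongr
    _ = _ := by ring

section

variable {V : Type} {T t τ : ℕ} [Fintype V] [DecidableEq V] {G : SimpleGraph V}
  [DecidableRel G.Adj] {port : V → V → ℕ} {adv : Adversary (gossip T t τ) V}

/-- For U at least 1 the log bound satisfies 5(U² + 2U + 2) ≤ 25U². This covers both the five
floodings and the factor 2 for the two directions of an edge. -/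
theorem Good.succeeds (hadv : adv.IsLegal G port) (hτ : 1 ≤ τ) (hG : G.Connected) {U : ℕ}
    (hU : 1 ≤ U) {ω : (gossip T t τ).Coins V} (h : Good G port adv U ω) {S : ℝ}
    (hS : 25 * (U : ℝ) ^ 2 ≤ S) : SolvesWithin G port adv ω (S * G.diam) ∧
      SendsAtMost G port adv ω (S * G.edgeFinset.card) := by
  have hB : ∀ k v, (logs (config G port adv ω k) v).length ≤ 1 + U + U * U + U + 1 := fun k v =>
    length_logs_le (valid_config hadv h.injective hτ k).sound h.injective h.card_le (h.hits_le k) v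
  have hBS : 5 * ((1 + U + U * U + U + 1 : ℕ) : ℝ) ≤ S := by
    have hU' : (1 : ℝ) ≤ U := by exact_mod_cast hU
    push_cast
    nlinarith
  obtain ⟨u, hu⟩ := Finset.nonempty_iff_ne_empty.2 h.nonempty
  constructor
  · obtain ⟨k, h1, h2⟩ := solvesWithin hadv h.injective hτ hB hG ⟨u, mem_luckyNodes.1 hu⟩
      h.le_hits h.noSplit
    refine ⟨k, h1, h2.trans ?_⟩
    rw [← mul_assoc]
    gcongr
  · intro k
    refine (sent_le (valid_config hadv h.injective hτ k) (hB k)).trans ?_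
    have hm : (0 : ℝ) ≤ G.edgeFinset.card := by positivity
    have hb : (0 : ℝ) ≤ ((1 + U + U * U + U + 1 : ℕ) : ℝ) := by positivity
    nlinarith [mul_le_mul_of_nonneg_right hBS hm]

end

end Gossip

/-! ### The theorem, by choice of the parameters. -/

theorem mainTheorem2 (c : ℝ) (hc : 0 < c) :
    ∃ (P : ℕ → Protocol) (κ n₀ : ℕ) (K : ℝ), ∀ n : ℕ, n₀ ≤ n →
      Fintype.card (P n).Msg ≤ n ^ κ ∧ Fintype.card (P n).Ident ≤ n ^ κ ∧
      ∀ (V : Type) [Fintype V] [DecidableEq V] (G : SimpleGraph V) [DecidableRel G.Adj]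
        (port : V → V → ℕ) (adv : Protocol.Adversary (P n) V),
        Fintype.card V = n → G.Connected → IsPortNumbering G port → adv.IsLegal G port →
        (P n).coinMeasure V
            {ω | ¬ (Protocol.SolvesWithin G port adv ω (K * G.diam * Real.log n ^ 2) ∧
              Protocol.SendsAtMost G port adv ω (K * G.edgeFinset.card * Real.log n ^ 2))} ≤
          ENNReal.ofReal (1 / (n : ℝ) ^ c) := by
  -- The factor 100 pays for the 50 in the tail exponent and for replacing l + 1 by 2l, where l is
  -- the integer logarithm of n.
  have hslack : ∀ x y : ℝ, 0 ≤ x → 1 ≤ y → (x + 6) * (y + 1) ≤ 100 * (x + 6) * y / 50 := by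
    intro x y hx hy
    nlinarith
  set C := ⌈c⌉₊
  set A := 100 * (C + 6) with hA
  let a : ℕ → ℕ := fun n => A * Nat.log 2 n
  let t : ℕ → ℕ := fun n => Gossip.luckExponent (a n) n
  -- The label length makes collisions rarer than n^(-C-2) in total. The bound 2^A on n ensures `A ≤
  -- Nat.log 2 n`, so that the target `a n` is at most the square of the logarithm and hence at most
  -- `n`.
  refine ⟨fun n => gossip ((C + 4) * (Nat.log 2 n + 1)) (t n) (Gossip.threshold (t n) n),
    6 * (C + 4) + 1, 2 ^ A, 3600 * (A : ℝ) ^ 2, fun n hn => ?_⟩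
  have hn0 : n ≠ 0 := (Nat.two_pow_pos A |>.trans_le hn).ne'
  have hl : A ≤ Nat.log 2 n := Nat.le_log_of_pow_le one_lt_two hn
  clear hn
  have hln := Nat.pow_log_le_self 2 hn0
  have hsq : Nat.log 2 n ^ 2 ≤ n := (Gossip.sq_le_two_pow (by omega)).trans hln
  have hl600 : 600 ≤ Nat.log 2 n := by omega
  have hn600 : 600 ≤ n := (hl600.trans (Nat.le_self_pow two_ne_zero _)).trans hsq
  have ha0 : 0 < a n := Nat.mul_pos (by omega) (by omega)
  have han : a n ≤ n := (Nat.mul_le_mul_right _ hl).trans (by rwa [← sq])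
  have hmsg := Gossip.card_rumor_le (C := C) (n := n) (by omega) (by omega)
  refine ⟨hmsg, ?_, ?_⟩
  · refine le_trans ?_ hmsg
    exact Fintype.card_le_of_injective (fun x => Rumor.cand x) fun x y h => by simpa using h
  intro V _ _ G _ port adv hV hG _ hadv
  obtain ⟨hr1, hr2⟩ := Gossip.le_rate ha0 han
  have hrate : Gossip.rate V (t n) = (2⁻¹ : ℝ) ^ t n * n := by rw [Gossip.rate, hV]
  have ha1 : (1 : ℝ) ≤ a n := by exact_mod_cast ha0
  have hτ : 1 ≤ Gossip.threshold (t n) n := by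
    refine Nat.one_le_ceil_iff.2 ?_
    have : (0 : ℝ) < (2⁻¹ : ℝ) ^ t n * n := by linarith
    linarith
  have ht : t n ≤ (C + 4) * (Nat.log 2 n + 1) := by
    have := Gossip.luckExponent_le (a n) n
    exact (this.trans (Nat.le_succ _)).trans (Nat.le_mul_of_pos_left _ (by omega))
  -- Since `rate` is at most twice `a n`, the choice `U = 6 * a n` dominates `3 * rate`.
  have hbad := Gossip.measure_not_good_le (G := G) (port := port) (adv := adv) ht hτ hadv
    (by rw [hrate]; rfl) (by rw [hV]; omega) (U := 6 * a n) (by rw [hrate]; push_cast; linarith)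
  refine (measure_mono (Set.compl_subset_compl.2 fun ω (hgood : Gossip.Good G port adv _ ω) =>
    ?_)).trans (hbad.trans ?_)
  -- The constant is 25 · 6² · 2² = 3600, the last factor coming from the change from binary to
  -- natural logarithms.
  · have hS : 25 * ((6 * a n : ℕ) : ℝ) ^ 2 ≤ 3600 * (A : ℝ) ^ 2 * Real.log n ^ 2 := by
      have h1 := Gossip.log_le_two_mul_log hn0
      have h2 : (Nat.log 2 n : ℝ) ^ 2 ≤ (2 * Real.log n) ^ 2 := by gcongr
      have h3 : 25 * ((6 * a n : ℕ) : ℝ) ^ 2 = 900 * (A : ℝ) ^ 2 * (Nat.log 2 n : ℝ) ^ 2 := by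
        simp only [a]
        push_cast
        ring
      rw [h3]
      calc 900 * (A : ℝ) ^ 2 * (Nat.log 2 n : ℝ) ^ 2
          ≤ 900 * (A : ℝ) ^ 2 * (2 * Real.log n) ^ 2 := by gcongr
        _ = _ := by ring
    have := Gossip.Good.succeeds hadv hτ hG (by omega) hgood hS
    rw [mul_right_comm, mul_right_comm _ (G.edgeFinset.card : ℝ)]
    exact this
  · rw [hV, two_inv_pow_add]
    have e : ∀ x : ℝ, 0 ≤ x → (n : ℝ≥0∞) ^ 2 * ENNReal.ofReal x =
        ENNReal.ofReal ((n : ℝ) ^ 2 * x) := fun x hx => by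
      rw [ENNReal.ofReal_mul (by positivity), ENNReal.ofReal_pow (by positivity),
        ENNReal.ofReal_natCast]
    rw [mul_assoc, e _ (by positivity), e _ (by positivity),
      show (6 : ℝ≥0∞) = ENNReal.ofReal 6 by simp, ← ENNReal.ofReal_mul (by norm_num),
      ← ENNReal.ofReal_add (by positivity) (by positivity), ← mul_assoc]
    refine ENNReal.ofReal_le_ofReal (Gossip.failure_le (by omega) (Nat.le_ceil c) le_rfl ?_)
    rw [hrate]
    have h1 : ((a n : ℕ) : ℝ) = 100 * ((C : ℝ) + 6) * Nat.log 2 n := by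
      simp only [a, hA]
      push_cast
      ring
    have h2 : (1 : ℝ) ≤ Nat.log 2 n := by
      have : 1 ≤ Nat.log 2 n := by omega
      exact_mod_cast this
    refine (hslack _ _ C.cast_nonneg h2).trans ?_
    rw [← h1]
    gcongr
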